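/- **Setting.** Fix $\tau$ in the upper half plane and let $\vartheta(z)=\vartheta(z|\tau)$ be Jacobi's odd theta function, an entire function with zero set $\mathbb Z+\tau\mathbb Z$, normalised by $\vartheta'(0)=1$. Put $g_\lambda(z)=\frac{\vartheta(z+\lambda)}{\vartheta(z)\vartheta(\lambda)}$. Let $Q$ be a finite quiver without edge loops, with vertex set $I$ and arrow set $H$; let $a_{kl}$ be the number of arrows from $k$ to $l$, $c_{kk}=2$ and $c_{kl}=-a_{kl}-a_{lk}$ for $k\ne l$. To each arrow $h$ are attached integers $m_h,m_{h^*}$ with $m_h+m_{h^*}=2$ such that for $k\neq l$ the numbers $m_h$ ($h:k\to l$) together with $m_{h^*}$ ($h:l\to k$) are, with multiplicity, $\mathbf a,\mathbf a-2,\dots,-\mathbf a+2$, where $\mathbf a=-c_{kl}$. Let $\hbar\in\mathbb C\setminus(\mathbb Z+\tau\mathbb Z)$. Let $\mathfrak h$ be a complex vector space with elements $\alpha_i\in\mathfrak h^*$ ($i\in I$) and a bilinear form $(\ ,\ )$ on $\mathfrak h^*$ such that $(\alpha_i,\alpha_j)=c_{ij}$. For $\lambda\in\mathfrak h^*$ write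 $\lambda_j=(\lambda,\alpha_j)$. **The shuffle algebra.** For $v\in\mathbb N^I$ consider $\prod_i\mathfrak S_{v^i}$-invariant functions of variables $z^i_t$ ($i\in I$, $1\le t\le v^i$), identified if they agree away from countably many hyperplanes $z_s=c$, $z_s-z_t=c$. On the families of such functions (one for each $v$) there is the associative product $$(f_1\star f_2)(z)=\sum_{(A,B)}(-1)^{(v_2,(1-\mathbf A)v_1)}f_1(z_A)f_2(z_B)\,\mathrm{fac}(z_A|z_B),\qquad (v,(1-\mathbf A)v')=\sum_{k,l}v^k(\delta_{kl}-a_{kl})v'^l,$$ where the sum is over all ways of distributing the variables of dimension $v_1+v_2$ into parts $A,B$ of dimensions $v_1,v_2$ (all $v_1,v_2$), and $\mathrm{fac}(z_A|z_B)$ is the product over $x\in A$, $y\in B$, of colours $k,l$, of $$\Big(\tfrac{\vartheta(z_x-z_y+\hbar)}{\vartheta(z_y-z_x)}\Big)^{\delta_{kl}}\prod_{h:k\to l}\vartheta\big(z_y-z_x+m_h\tfrac\hbar2\big)\prod_{h:l\to k}\vartheta\big(z_y-z_x+m_{h^*}\tfrac\hbar2\big).$$ Let $\mathbf{SH}_{e_k}$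 be the space of meromorphic functions on $\mathbb C$ of one variable $z_k$ of colour $k$, and let $\mathbf{SH}^{\mathrm{sph}}$ be the subalgebra generated by all $\mathbf{SH}_{e_k}$, $k\in I$. Let $\mathbf{SH}^{\mathrm{sph,coop}}$ be a second copy of this algebra. Let $\mathbf{SH}^0$ be the commutative algebra $\mathrm{Sym}(\mathfrak h)[\Phi^+_{k,n}:k\in I,n\ge0]$ with the $\Phi^+_{k,0}$ inverted, and put $\Phi_k^+(u)=\sum_{n}\Phi^+_{k,n}u^n$, $\Phi^-_k(u)=\Phi^+_k(-u)$. **The Drinfeld double.** For $k,j\in I$ let $\widehat\Phi_{k,e_j}(u)=\frac{\vartheta(u-z_j+c_{kj}\hbar/2)}{\vartheta(u-z_j-c_{kj}\hbar/2)}$, expanded at $u=0$. On $\mathbf{SH}_{e_k}$ use the pairing $(f,f')=\mathrm{Res}_{z=0}f(z)f'(-z)\,dz$, and for a series $\varphi(z)=\sum_n\varphi_nz^n$ write $(\varphi f,f')=\sum_n(z^nf,f')\varphi_n$. Then $D=D(\mathbf{SH}^{\mathrm{sph}})$ is the algebra generated by (images of) the three algebras $\mathbf{SH}^{\mathrm{sph}}$,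 $\mathbf{SH}^0$, $\mathbf{SH}^{\mathrm{sph,coop}}$ with the following relations, in which $h\in\mathfrak h$, $j,k,l\in I$, $f^+$, $b^+$ are in $\mathbf{SH}^{\mathrm{sph}}$ and $f^-$, $a^-$ in $\mathbf{SH}^{\mathrm{sph,coop}}$: * $[h,f^{\pm}]=\pm\alpha_j(h)f^\pm$ and $\Phi_k^{\pm}(u)f^\pm=(f\,\widehat\Phi_{k,e_j}(u))^\pm\,\Phi_k^\pm(u)$ for $f\in\mathbf{SH}_{e_j}$; * $(\Phi^-_k(z)a,b)+a^-b^+=b^+a^-+(\Phi_k^+(z)b,a)$ for $a,b\in\mathbf{SH}_{e_k}$; * $a^-b^+=b^+a^-$ for $a\in\mathbf{SH}_{e_l}$, $b\in\mathbf{SH}_{e_k}$, $k\ne l$. The middle relation is $\sum a_1^-b_2^+(a_2,b_1)=\sum b^+_1a^-_2(b_2,a_1)$ for the coproducts $\Delta(b)=\Phi_k^+(z)\otimes b+b\otimes1$, $\Delta(a)=\Phi^-_k(z)\otimes a+a\otimes1$. **Generating series.** For $\lambda\in\mathfrak h^*$ with $\lambda_k\notin\mathbb Z+\tau\mathbb Z$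 let $$\mathfrak X_k^+(u,\lambda)=g_{\lambda_k}(u-z_k)=\frac{\vartheta(u-z_k+\lambda_k)}{\vartheta(u-z_k)\vartheta(\lambda_k)}\in\mathbf{SH}^{\mathrm{sph}}[[u]],$$ and let $\mathfrak X_k^-(u,\lambda)=g_{\lambda_k}(u+z_k)$ be the series in $\mathbf{SH}^{\mathrm{sph,coop}}[[u]]$ which corresponds to $-\mathfrak X_k^+(-u,-\lambda)$. Shifted series $\mathfrak X_k^\pm(u+s,\lambda)$, $s\in\mathbb C$, are defined by expanding $g_{\lambda_k}(u+s\mp z_k)$ at $u=0$. Let $\Phi_k(u)=\vartheta(\hbar)\Phi_k^+(u)+\vartheta(\hbar)\Phi_k^-(-u)$. **Theorem.** The following relations hold in $D[[u,v]]$. Functions of $u-v$ are expanded at $u=v=0$. The factors $\vartheta(u-v\mp a)$ and $\vartheta(u-v)$ in the denominators of EQ3 and EQ5 mean that the relation holds after multiplication by this factor. All $\lambda$'s are such that the series in the relation are defined (i.e. the relevant numbers $(\lambda,\alpha_k)$ are not in $\mathbb Z+\tau\mathbb Z$; in EQ4 this means $l\pm a\notin\mathbb Z+\tau\mathbb Z$).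 * **EQ1.** $[\Phi_i(u),\Phi_j(v)]=0$ and $[h,\Phi_i(u)]=0$ for $i,j\in I$, $h\in\mathfrak h$. * **EQ2.** $[h,\mathfrak X_i^\pm(u,\lambda)]=\pm\alpha_i(h)\mathfrak X_i^\pm(u,\lambda)$ for $i\in I$, $h\in\mathfrak h$. * **EQ3.** Each $\Phi_i(u)$ is invertible, and for $i,j\in I$ and $a=\frac{c_{ij}}2\hbar$, $$\Phi_i(u)\mathfrak X_j^{\pm}(v,\lambda)\Phi_i(u)^{-1}=\frac{\vartheta(u-v\pm a)}{\vartheta(u-v\mp a)}\mathfrak X_j^{\pm}(v,\lambda\pm\hbar\alpha_i)\pm\frac{\vartheta(2a)\vartheta(u-v\mp a-\lambda_j)}{\vartheta(\lambda_j)\vartheta(u-v\mp a)}\mathfrak X_j^{\pm}(u\mp a,\lambda\pm\hbar\alpha_i).$$ * **EQ4.** For $i\ne j$, $a=\frac{c_{ij}}2\hbar$ and $\lambda$ with $(\lambda,\alpha_i)=(\lambda,\alpha_j)=l$, $$\begin{aligned}&\vartheta(2l)\vartheta(u-v\mp a)\,\mathfrak X_i^{\pm}(u,\lambda\pm\tfrac\hbar2\alpha_j)\,\mathfrak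 X_j^{\pm}(v,\lambda\mp\tfrac\hbar2\alpha_i)\\&-\vartheta(l\pm a)\vartheta(u-v-l)\,\mathfrak X_i^{\pm}(u,\lambda\pm\tfrac\hbar2\alpha_j)\,\mathfrak X_j^{\pm}(u+l,\lambda\mp\tfrac\hbar2\alpha_i)\\&-\vartheta(l\mp a)\vartheta(u-v+l)\,\mathfrak X_i^{\pm}(v+l,\lambda\pm\tfrac\hbar2\alpha_j)\,\mathfrak X_j^{\pm}(v,\lambda\mp\tfrac\hbar2\alpha_i)\\=\;&\vartheta(2l)\vartheta(u-v\pm a)\,\mathfrak X_j^{\pm}(v,\lambda\pm\tfrac\hbar2\alpha_i)\,\mathfrak X_i^{\pm}(u,\lambda\mp\tfrac\hbar2\alpha_j)\\&-\vartheta(l\mp a)\vartheta(u-v-l)\,\mathfrak X_j^{\pm}(u+l,\lambda\pm\tfrac\hbar2\alpha_i)\,\mathfrak X_i^{\pm}(u,\lambda\mp\tfrac\hbar2\alpha_j)\\&-\vartheta(l\pm a)\vartheta(u-v+l)\,\mathfrak X_j^{\pm}(v,\lambda\pm\tfrac\hbar2\alpha_i)\,\mathfrak X_i^{\pm}(v+l,\lambda\mp\tfrac\hbar2\alpha_j).\end{aligned}$$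 * **EQ5.** For $i\ne j$ and all $\lambda_1,\lambda_2\in\mathfrak h^*$: $[\mathfrak X_i^+(u,\lambda_1),\mathfrak X_j^-(v,\lambda_2)]=0$. For all $i\in I$ and all $\lambda_1,\lambda_2\in\mathfrak h^*$, with $\lambda_{s,i}=(\lambda_s,\alpha_i)$, $$\vartheta(\hbar)[\mathfrak X_i^+(u,\lambda_1),\mathfrak X_i^-(v,\lambda_2)]=\frac{\vartheta(u-v+\lambda_{1,i})}{\vartheta(u-v)\vartheta(\lambda_{1,i})}\Phi_i(v)+\frac{\vartheta(u-v-\lambda_{2,i})}{\vartheta(u-v)\vartheta(\lambda_{2,i})}\Phi_i(u).$$ In particular the last relation holds on every weight space $\mathbb V_\mu$ of every $D$-module on which $(\lambda_1+\lambda_2,\alpha_i)=\hbar(\mu,\alpha_i)$. -/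

import Mathlib

open scoped BigOperators Topology

set_option linter.unusedSectionVars false

noncomputable section

namespace EllQG

/-! ### The odd theta function -/

/-- The odd theta function `e^{πiz} θ(z + (1 + τ)/2 | τ)`, before normalisation. -/
def thetaAux (τ : UpperHalfPlane) (z : ℂ) : ℂ :=
  Complex.exp (Real.pi * Complex.I * z) * jacobiTheta₂ (z + (1 + (τ : ℂ)) / 2) (τ : ℂ)

/-- Jacobi's odd theta function `ϑ(z | τ)`, normalised by `ϑ'(0 | τ) = 1`. -/
def theta (τ : UpperHalfPlane) (z : ℂ) : ℂ := thetaAux τ z / deriv (thetaAux τ) 0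

/-- The period lattice `ℤ + τ ℤ`, which is the zero set of `ϑ`. -/
def periodLattice (τ : UpperHalfPlane) : Set ℂ := {z | ∃ m n : ℤ, z = m + n * (τ : ℂ)}

/-- `g_λ(z) = ϑ(z + λ) / (ϑ(z) ϑ(λ))`. -/
def g (τ : UpperHalfPlane) (lam z : ℂ) : ℂ := theta τ (z + lam) / (theta τ z * theta τ lam)

theorem differentiable_thetaAux (τ : UpperHalfPlane) : Differentiable ℂ (thetaAux τ) := by
  intro z
  unfold thetaAux
  refine DifferentiableAt.mul (by fun_prop) ?_
  exact (differentiableAt_jacobiTheta₂_fst (z + (1 + (τ : ℂ)) / 2) τ.im_pos).comp z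
    (f := fun w : ℂ => w + (1 + (τ : ℂ)) / 2) (by fun_prop)

theorem differentiable_theta (τ : UpperHalfPlane) : Differentiable ℂ (theta τ) :=
  (differentiable_thetaAux τ).div_const _

theorem meromorphic_theta_affine (τ : UpperHalfPlane) (c : ℂ) :
    Meromorphic (fun z => theta τ (z + c)) := fun z =>
  (((differentiable_theta τ).comp (by fun_prop : Differentiable ℂ fun z : ℂ => z + c)).analyticAt
    z).meromorphicAt

/-! ### Quivers with weights -/

/-- A quiver with vertex set `I` and arrow set `H`, together with the integers `m_h`, `m_{h^*}`. -/
structure WeightedQuiver (I H : Type*) where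
  /-- the vertex an arrow leaves -/
  out : H → I
  /-- the vertex an arrow enters -/
  inc : H → I
  /-- the integer `m_h` -/
  m : H → ℤ
  /-- the integer `m_{h^*}` attached to the reversed arrow -/
  mstar : H → ℤ

variable {I H : Type*} [Fintype I] [DecidableEq I] [Fintype H]

/-- The arrows from `k` to `l`. -/
def WeightedQuiver.arrows (Q : WeightedQuiver I H) (k l : I) : Finset H :=
  Finset.univ.filter fun h => Q.out h = k ∧ Q.inc h = l

/-- The Cartan matrix `c_{kk} = 2`, `c_{kl} = - a_{kl} - a_{lk}` for `k ≠ l`. -/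
def WeightedQuiver.cartan (Q : WeightedQuiver I H) (k l : I) : ℤ :=
  if k = l then 2 else -((Q.arrows k l).card : ℤ) - ((Q.arrows l k).card : ℤ)

/-- The matrix `1 - (a_{kl})`. -/
def WeightedQuiver.euler (Q : WeightedQuiver I H) (k l : I) : ℤ :=
  (if k = l then 1 else 0) - ((Q.arrows k l).card : ℤ)

/-- The weights used for `t₁ = t₂ = ħ/2`: `m_h + m_{h^*} = 2`, and for two distinct vertices `k`, `l`
joined by `a = -c_{kl}` arrows, the numbers `m_h` (for `h : k → l`) and `m_{h^*}` (for `h : l → k`)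
are `a, a - 2, …, -a + 2`. If all these arrows `h_1, …, h_a` go from `k` to `l`, this is
`m_{h_p} = a + 2 - 2p`, `m_{h_p^*} = -a + 2p` up to the numbering of the arrows. -/
def WeightedQuiver.StandardWeights (Q : WeightedQuiver I H) : Prop :=
  (∀ h, Q.m h + Q.mstar h = 2) ∧
  ∀ k l, k ≠ l →
    (Q.arrows k l).val.map Q.m + (Q.arrows l k).val.map Q.mstar =
      (Multiset.range ((Q.arrows k l).card + (Q.arrows l k).card)).map fun p =>
        (((Q.arrows k l).card : ℤ) + ((Q.arrows l k).card : ℤ)) - 2 * (p : ℤ)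

/-! ### The shuffle algebra

A point of the `I`-coloured Hilbert scheme is a finite multiset of coloured points, so a family of
`𝔖_v`-invariant functions of the variables `(z^i_t)_{i ∈ I, t ∈ [1, v^i]}`, one for each dimension
vector `v`, is a function on `Multiset (I × ℂ)`. -/

/-- The factor of `fac₁(z_A | z_B)` at `x ∈ A`, `y ∈ B`. -/
def fac₁ (τ : UpperHalfPlane) (t₁ t₂ : ℂ) (x y : I × ℂ) : ℂ :=
  if x.1 = y.1 then theta τ (x.2 - y.2 + t₁ + t₂) / theta τ (y.2 - x.2) else 1

/-- The factor of `fac₂(z_A | z_B)` at `x ∈ A`, `y ∈ B`. -/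
def fac₂ (Q : WeightedQuiver I H) (τ : UpperHalfPlane) (t₁ t₂ : ℂ) (x y : I × ℂ) : ℂ :=
  (∏ h ∈ Q.arrows x.1 y.1, theta τ (y.2 - x.2 + Q.m h * t₁)) *
    ∏ h ∈ Q.arrows y.1 x.1, theta τ (y.2 - x.2 + Q.mstar h * t₂)

/-- `fac(z_A | z_B)`. -/
def fac (Q : WeightedQuiver I H) (τ : UpperHalfPlane) (t₁ t₂ : ℂ) (A B : Multiset (I × ℂ)) : ℂ :=
  (A.map fun x => (B.map fun y => fac₁ τ t₁ t₂ x y * fac₂ Q τ t₁ t₂ x y).prod).prod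

/-- The dimension vector of a coloured multiset. -/
def dimVec (A : Multiset (I × ℂ)) (k : I) : ℤ := ((A.map Prod.fst).count k : ℤ)

/-- The sign `(-1)^{(v₂, (1 - a) v₁)}`, where `v₁ = dim A`, `v₂ = dim B`. -/
def shuffleSign (Q : WeightedQuiver I H) (A B : Multiset (I × ℂ)) : ℂ :=
  (-1 : ℂ) ^ (∑ k, ∑ l, dimVec B k * Q.euler k l * dimVec A l)

/-- The signed kernel of the shuffle product at `t₁ = t₂ = ħ/2`. -/
def kernel (Q : WeightedQuiver I H) (τ : UpperHalfPlane) (hbar : ℂ) (A B : Multiset (I × ℂ)) : ℂ :=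
  shuffleSign Q A B * fac Q τ (hbar / 2) (hbar / 2) A B

/-- Functions on coloured configurations of points of `ℂ`. -/
def ShuffleFun (_Q : WeightedQuiver I H) (_τ : UpperHalfPlane) (_hbar : ℂ) : Type _ :=
  Multiset (I × ℂ) → ℂ

namespace ShuffleFun

variable {Q : WeightedQuiver I H} {τ : UpperHalfPlane} {hbar : ℂ}

instance : AddCommGroup (ShuffleFun Q τ hbar) :=
  inferInstanceAs (AddCommGroup (Multiset (I × ℂ) → ℂ))

instance : Module ℂ (ShuffleFun Q τ hbar) :=
  inferInstanceAs (Module ℂ (Multiset (I × ℂ) → ℂ))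

/-- The shuffle product
`(f₁ ⋆ f₂)(z) = ∑_{(A, B)} (-1)^{(v₂, (1 - a) v₁)} f₁(z_A) f₂(z_B) fac(z_A | z_B)`,
the sum being over all ways to distribute the points between `A` and `B`. -/
def star (f₁ f₂ : ShuffleFun Q τ hbar) : ShuffleFun Q τ hbar := fun X =>
  (X.antidiagonal.map fun p => kernel Q τ hbar p.1 p.2 * (f₁ p.1 * f₂ p.2)).sum

/-- The unit: the function `1` on the empty configuration. -/
def unit : ShuffleFun Q τ hbar := fun X => if X = 0 then 1 else 0

theorem dimVec_add (A B : Multiset (I × ℂ)) (k : I) :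
    dimVec (A + B) k = dimVec A k + dimVec B k := by
  simp [dimVec]

theorem kernel_add_left (A B C : Multiset (I × ℂ)) :
    kernel Q τ hbar (A + B) C = kernel Q τ hbar A C * kernel Q τ hbar B C := by
  have h : shuffleSign Q (A + B) C = shuffleSign Q A C * shuffleSign Q B C := by
    unfold shuffleSign
    rw [← zpow_add₀ (by norm_num)]
    simp [dimVec_add, mul_add, Finset.sum_add_distrib]
  simp only [kernel, h, fac, Multiset.map_add, Multiset.prod_add]
  ring

theorem kernel_add_right (A B C : Multiset (I × ℂ)) :
    kernel Q τ hbar A (B + C) = kernel Q τ hbar A B * kernel Q τ hbar A C := by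
  have h : shuffleSign Q A (B + C) = shuffleSign Q A B * shuffleSign Q A C := by
    unfold shuffleSign
    rw [← zpow_add₀ (by norm_num)]
    simp [dimVec_add, add_mul, Finset.sum_add_distrib]
  simp only [kernel, h, fac, Multiset.map_add, Multiset.prod_add, Multiset.prod_map_mul]
  ring

theorem kernel_zero_left (A : Multiset (I × ℂ)) : kernel Q τ hbar 0 A = 1 := by
  simp [kernel, shuffleSign, fac, dimVec]

theorem kernel_zero_right (A : Multiset (I × ℂ)) : kernel Q τ hbar A 0 = 1 := by
  simp [kernel, shuffleSign, fac, dimVec]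

theorem sum_antidiagonal_assoc {α : Type*} (X : Multiset α)
    (F : Multiset α → Multiset α → Multiset α → ℂ) :
    (X.antidiagonal.map fun p => (p.1.antidiagonal.map fun q => F q.1 q.2 p.2).sum).sum =
      (X.antidiagonal.map fun p => (p.2.antidiagonal.map fun q => F p.1 q.1 q.2).sum).sum := by
  induction X using Multiset.induction_on generalizing F with
  | empty => simp
  | cons a s ih =>
    have h1 := ih (fun A B C => F A B (a ::ₘ C))
    have h2 := ih (fun A B C => F A (a ::ₘ B) C)
    have h3 := ih (fun A B C => F (a ::ₘ A) B C)
    simp only [Multiset.antidiagonal_cons, Multiset.map_add, Multiset.sum_add, Multiset.map_map,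
      Function.comp_def, Prod.map_fst, Prod.map_snd, id, Multiset.sum_map_add] at h1 h2 h3 ⊢
    rw [h1, h2, h3]
    ring

theorem sum_antidiagonal_left {α : Type*} (X : Multiset α)
    (F : Multiset α → Multiset α → ℂ) (hF : ∀ A B, A ≠ 0 → F A B = 0) :
    (X.antidiagonal.map fun p => F p.1 p.2).sum = F 0 X := by
  induction X using Multiset.induction_on generalizing F with
  | empty => simp
  | cons a s ih =>
    simp only [Multiset.antidiagonal_cons, Multiset.map_add, Multiset.sum_add, Multiset.map_map,
      Function.comp_def, Prod.map_fst, Prod.map_snd, id]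
    rw [ih (fun A B => F A (a ::ₘ B)) fun A B h => hF _ _ h]
    simp [hF _ _ (Multiset.cons_ne_zero)]

theorem sum_antidiagonal_right {α : Type*} (X : Multiset α)
    (F : Multiset α → Multiset α → ℂ) (hF : ∀ A B, B ≠ 0 → F A B = 0) :
    (X.antidiagonal.map fun p => F p.1 p.2).sum = F X 0 := by
  have h := sum_antidiagonal_left X (fun A B => F B A) fun A B h => hF _ _ h
  rw [← Multiset.map_swap_antidiagonal, Multiset.map_map]
  exact h

theorem star_assoc (f₁ f₂ f₃ : ShuffleFun Q τ hbar) :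
    star (star f₁ f₂) f₃ = star f₁ (star f₂ f₃) := by
  funext X
  have h := sum_antidiagonal_assoc X fun A B C =>
    kernel Q τ hbar A B * kernel Q τ hbar A C * kernel Q τ hbar B C * (f₁ A * f₂ B * f₃ C)
  unfold star
  refine Eq.trans ?_ (h.trans ?_)
  · refine congrArg Multiset.sum (Multiset.map_congr rfl fun p _ => ?_)
    rw [← Multiset.sum_map_mul_right, ← Multiset.sum_map_mul_left]
    refine congrArg Multiset.sum (Multiset.map_congr rfl fun q hq => ?_)
    rw [← Multiset.mem_antidiagonal.1 hq, kernel_add_left]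
    ring
  · refine congrArg Multiset.sum (Multiset.map_congr rfl fun p _ => ?_)
    rw [← Multiset.sum_map_mul_left, ← Multiset.sum_map_mul_left]
    refine congrArg Multiset.sum (Multiset.map_congr rfl fun q hq => ?_)
    rw [← Multiset.mem_antidiagonal.1 hq, kernel_add_right]
    ring

theorem unit_star (f : ShuffleFun Q τ hbar) : star unit f = f := by
  funext X
  unfold star
  rw [sum_antidiagonal_left X (fun A B => kernel Q τ hbar A B * (unit (Q := Q) (τ := τ)
    (hbar := hbar) A * f B)) fun A B h => by simp [unit, h]]
  simp [unit, kernel_zero_left]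

theorem star_unit (f : ShuffleFun Q τ hbar) : star f unit = f := by
  funext X
  unfold star
  rw [sum_antidiagonal_right X (fun A B => kernel Q τ hbar A B * (f A * unit (Q := Q) (τ := τ)
    (hbar := hbar) B)) fun A B h => by simp [unit, h]]
  simp [unit, kernel_zero_right]

theorem star_add (f₁ f₂ f₃ : ShuffleFun Q τ hbar) :
    star f₁ (f₂ + f₃) = star f₁ f₂ + star f₁ f₃ := by
  funext X
  change _ = star f₁ f₂ X + star f₁ f₃ X
  unfold star
  rw [← Multiset.sum_map_add]
  refine congrArg Multiset.sum (Multiset.map_congr rfl fun p _ => ?_)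
  change _ * (_ * (f₂ p.2 + f₃ p.2)) = _
  ring

theorem add_star (f₁ f₂ f₃ : ShuffleFun Q τ hbar) :
    star (f₁ + f₂) f₃ = star f₁ f₃ + star f₂ f₃ := by
  funext X
  change _ = star f₁ f₃ X + star f₂ f₃ X
  unfold star
  rw [← Multiset.sum_map_add]
  refine congrArg Multiset.sum (Multiset.map_congr rfl fun p _ => ?_)
  change _ * ((f₁ p.1 + f₂ p.1) * _) = _
  ring

theorem smul_star (r : ℂ) (f₁ f₂ : ShuffleFun Q τ hbar) : star (r • f₁) f₂ = r • star f₁ f₂ := by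
  funext X
  change _ = r * star f₁ f₂ X
  unfold star
  rw [← Multiset.sum_map_mul_left]
  refine congrArg Multiset.sum (Multiset.map_congr rfl fun p _ => ?_)
  change _ * ((r * f₁ p.1) * _) = _
  ring

theorem star_smul (r : ℂ) (f₁ f₂ : ShuffleFun Q τ hbar) : star f₁ (r • f₂) = r • star f₁ f₂ := by
  funext X
  change _ = r * star f₁ f₂ X
  unfold star
  rw [← Multiset.sum_map_mul_left]
  refine congrArg Multiset.sum (Multiset.map_congr rfl fun p _ => ?_)
  change _ * (_ * (r * f₂ p.2)) = _
  ring

instance : Ring (ShuffleFun Q τ hbar) :=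
  { (inferInstance : AddCommGroup (ShuffleFun Q τ hbar)) with
    mul := star
    one := unit
    mul_assoc := star_assoc
    one_mul := unit_star
    mul_one := star_unit
    left_distrib := star_add
    right_distrib := add_star
    zero_mul := fun f => by
      have h := smul_star (0 : ℂ) 0 f
      rwa [zero_smul, zero_smul] at h
    mul_zero := fun f => by
      have h := star_smul (0 : ℂ) f 0
      rwa [zero_smul, zero_smul] at h }

instance : Algebra ℂ (ShuffleFun Q τ hbar) := Algebra.ofModule smul_star star_smul

/-- The configuration `X` avoids the hyperplanes `z_s = c` and `z_s - z_t = c` for all `c ∈ C`. -/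
def Avoids (C : Set ℂ) (X : Multiset (I × ℂ)) : Prop :=
  (∀ x ∈ X, x.2 ∉ C) ∧ ∀ x y, ({x, y} : Multiset (I × ℂ)) ≤ X → x.2 - y.2 ∉ C

theorem Avoids.mono {C D : Set ℂ} {X Y : Multiset (I × ℂ)} (h : Avoids D X) (hC : C ⊆ D)
    (hY : Y ≤ X) : Avoids C Y :=
  ⟨fun x hx hc => h.1 x (Multiset.mem_of_le hY hx) (hC hc),
    fun x y hxy hc => h.2 x y (hxy.trans hY) (hC hc)⟩

variable (Q τ hbar) in
/-- Two functions represent the same rational section if they agree away from countably many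
hyperplanes `z_s = c`, `z_s - z_t = c`. (The values of a meromorphic function at its poles are
irrelevant.) This is compatible with the algebra structure. -/
def agreement : RingCon (ShuffleFun Q τ hbar) where
  r f₁ f₂ := ∃ C : Set ℂ, C.Countable ∧ ∀ X, Avoids C X → f₁ X = f₂ X
  iseqv :=
    ⟨fun _ => ⟨∅, Set.countable_empty, fun _ _ => rfl⟩,
      fun ⟨C, hC, h⟩ => ⟨C, hC, fun X hX => (h X hX).symm⟩,
      fun ⟨C, hC, h⟩ ⟨D, hD, h'⟩ => ⟨C ∪ D, hC.union hD, fun X hX =>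
        (h X (hX.mono Set.subset_union_left le_rfl)).trans
          (h' X (hX.mono Set.subset_union_right le_rfl))⟩⟩
  mul' := by
    rintro f₁ f₂ f₃ f₄ ⟨C, hC, h⟩ ⟨D, hD, h'⟩
    refine ⟨C ∪ D, hC.union hD, fun X hX => ?_⟩
    refine congrArg Multiset.sum (Multiset.map_congr rfl fun p hp => ?_)
    have hX' := Multiset.mem_antidiagonal.1 hp
    rw [h p.1 (hX.mono Set.subset_union_left (hX' ▸ Multiset.le_add_right _ _)),
      h' p.2 (hX.mono Set.subset_union_right (hX' ▸ Multiset.le_add_left _ _))]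
  add' := by
    rintro f₁ f₂ f₃ f₄ ⟨C, hC, h⟩ ⟨D, hD, h'⟩
    refine ⟨C ∪ D, hC.union hD, fun X hX => ?_⟩
    change f₁ X + f₃ X = f₂ X + f₄ X
    rw [h X (hX.mono Set.subset_union_left le_rfl), h' X (hX.mono Set.subset_union_right le_rfl)]

/-- The function supported on the configurations of one point `z` of colour `k`, with value `f z`:
an element of dimension vector `e_k`. -/
def single (k : I) (f : ℂ → ℂ) : ShuffleFun Q τ hbar := fun X =>
  ((X.map fun x => if X = {x} ∧ x.1 = k then f x.2 else 0)).sum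

end ShuffleFun

/-- The ambient shuffle algebra of functions of coloured configurations, with the product `⋆`. -/
abbrev SH (Q : WeightedQuiver I H) (τ : UpperHalfPlane) (hbar : ℂ) : Type _ :=
  (ShuffleFun.agreement Q τ hbar).Quotient

/-- The algebra of meromorphic functions on `ℂ`. -/
def Mer : Subalgebra ℂ (ℂ → ℂ) where
  carrier := {f | Meromorphic f}
  mul_mem' hf hg := fun z => (hf z).mul (hg z)
  add_mem' hf hg := fun z => (hf z).add (hg z)
  algebraMap_mem' r := fun z => MeromorphicAt.const r z

variable (Q : WeightedQuiver I H) (τ : UpperHalfPlane) (hbar : ℂ)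

/-- The element of `SH_{e_k}` given by a meromorphic function of the single variable `z_k`. -/
def vertexElt (k : I) (f : Mer) : SH Q τ hbar :=
  (ShuffleFun.single k f.1 : ShuffleFun Q τ hbar)

/-- The spherical subalgebra `SH^sph`, generated by the `SH_{e_k}`, `k ∈ I`. -/
def SHsph : Subalgebra ℂ (SH Q τ hbar) :=
  Algebra.adjoin ℂ {x | ∃ (k : I) (f : Mer), x = vertexElt Q τ hbar k f}

/-- `SH_{e_k} ⊆ SH^sph`. -/
def sphElt (k : I) (f : Mer) : SHsph Q τ hbar :=
  ⟨vertexElt Q τ hbar k f, Algebra.subset_adjoin ⟨k, f, rfl⟩⟩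

/-! ### The Cartan part -/

/-- The polynomial algebra `Sym(𝔥)[Φ⁺_{k,n} : k ∈ I, n ≥ 0]`. -/
abbrev CartanPoly (I : Type*) (𝔥 : Type*) [AddCommGroup 𝔥] [Module ℂ 𝔥] : Type _ :=
  MvPolynomial (I × ℕ) (SymmetricAlgebra ℂ 𝔥)

/-- The commutative algebra `SH⁰`: the polynomial algebra on `𝔥` and on the coefficients of the series
`Φ⁺_k(u) = ∑ Φ⁺_{k,n} u^n`, with the constant terms inverted so that `Φ⁺_k(u)⁻¹` exists. -/
abbrev SH0 (I : Type*) (𝔥 : Type*) [AddCommGroup 𝔥] [Module ℂ 𝔥] : Type _ :=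
  Localization (Submonoid.closure
    (Set.range fun k : I => (MvPolynomial.X (k, 0) : CartanPoly I 𝔥)))

/-- The coefficient `Φ⁺_{k,n}` in `SH⁰`. -/
def phiCoeff (𝔥 : Type*) [AddCommGroup 𝔥] [Module ℂ 𝔥] (k : I) (n : ℕ) : SH0 I 𝔥 :=
  algebraMap (CartanPoly I 𝔥) (SH0 I 𝔥) (MvPolynomial.X (k, n))

/-- An element of `𝔥`, regarded in `SH⁰`. -/
def cartanElt {𝔥 : Type*} [AddCommGroup 𝔥] [Module ℂ 𝔥] (h : 𝔥) : SH0 I 𝔥 :=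
  algebraMap (CartanPoly I 𝔥) (SH0 I 𝔥) (MvPolynomial.C (SymmetricAlgebra.ι ℂ 𝔥 h))

/-! ### Taylor coefficients and residues -/

/-- The `n`-th Taylor coefficient of `f` at `z`. -/
def taylorCoeff (f : ℂ → ℂ) (n : ℕ) (z : ℂ) : ℂ := iteratedDeriv n f z / (n.factorial : ℂ)

theorem meromorphic_taylorCoeff {f : ℂ → ℂ} (hf : Meromorphic f) (n : ℕ) (c : ℂ) :
    Meromorphic fun z => taylorCoeff f n (c - z) := by
  intro z
  have h : MeromorphicAt (iteratedDeriv n f) (c - z) := by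
    rw [iteratedDeriv_eq_iterate]
    exact hf.iterated_deriv (c - z)
  have h' := h.comp_analyticAt (f := iteratedDeriv n f) (g := fun z : ℂ => c - z) (by fun_prop)
  exact h'.div (MeromorphicAt.const _ z)

theorem meromorphic_g (lam : ℂ) : Meromorphic (g τ lam) := fun z =>
  (meromorphic_theta_affine τ lam z).div
    (((differentiable_theta τ).analyticAt z).meromorphicAt.mul (MeromorphicAt.const _ z))

/-- `w ↦ ϑ(w + a) / ϑ(w - a)` for `a = c_{kj} ħ / 2`. -/
def phiFactor (k j : I) (w : ℂ) : ℂ :=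
  theta τ (w + Q.cartan k j * hbar / 2) / theta τ (w - Q.cartan k j * hbar / 2)

theorem meromorphic_phiFactor (k j : I) : Meromorphic (phiFactor Q τ hbar k j) := fun z =>
  (meromorphic_theta_affine τ _ z).div (by
    simpa only [sub_eq_add_neg] using meromorphic_theta_affine τ (-(Q.cartan k j * hbar / 2)) z)

/-- The coefficient of `u^n` in
`Φ̂_{k,e_j}(u) = ϑ(u - z_j + c_{kj} ħ/2) / ϑ(u - z_j - c_{kj} ħ/2)`, a function of `z_j`. -/
def phiHat (k j : I) (n : ℕ) : Mer :=
  ⟨fun z => taylorCoeff (phiFactor Q τ hbar k j) n (0 - z),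
    meromorphic_taylorCoeff (meromorphic_phiFactor Q τ hbar k j) n 0⟩

/-- The residue at `z = 0` of a function which is meromorphic there. -/
def residueAtZero (f : ℂ → ℂ) : ℂ :=
  Filter.limUnder (𝓝[>] (0 : ℝ)) fun r : ℝ => (2 * Real.pi * Complex.I)⁻¹ * ∮ z in C(0, r), f z

/-- The pairing `(f, f') = Res_{z = 0} f(z) f'(-z) dz` on `SH_{e_k}`. -/
def pairing (f f' : ℂ → ℂ) : ℂ := residueAtZero fun z => f z * f' (-z)

/-- `∑ₙ (zⁿ f, f') φₙ`, which is `Res_{z = 0} φ(z) f(z) f'(-z) dz` for the series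
`φ(z) = ∑ₙ φₙ zⁿ`. Only finitely many summands are nonzero if `f`, `f'` are meromorphic. -/
def pairingSeries {A : Type*} [AddCommGroup A] [Module ℂ A] (φ : ℕ → A) (f f' : ℂ → ℂ) : A :=
  ∑ᶠ n : ℕ, pairing (fun z => z ^ n * f z) f' • φ n

/-! ### The Drinfeld double -/

variable {𝔥 : Type*} [AddCommGroup 𝔥] [Module ℂ 𝔥] (α : I → Module.Dual ℂ 𝔥)

/-- The free algebra on the elements of `SH^sph`, `SH⁰` and `SH^{sph,coop}`. As an algebra,
`SH^{sph,coop}` is `SH^sph`. -/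
abbrev FreeDouble (𝔥 : Type*) [AddCommGroup 𝔥] [Module ℂ 𝔥] : Type _ :=
  FreeAlgebra ℂ (SHsph Q τ hbar ⊕ SH0 I 𝔥 ⊕ SHsph Q τ hbar)

/-- The generator `a⁺`, `a ∈ SH^sph`. -/
def fpos (𝔥 : Type*) [AddCommGroup 𝔥] [Module ℂ 𝔥] (a : SHsph Q τ hbar) :
    FreeDouble Q τ hbar 𝔥 := FreeAlgebra.ι ℂ (Sum.inl a)

/-- The generator `c`, `c ∈ SH⁰`. -/
def fzero (c : SH0 I 𝔥) : FreeDouble Q τ hbar 𝔥 := FreeAlgebra.ι ℂ (Sum.inr (Sum.inl c))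

/-- The generator `a⁻`, `a ∈ SH^{sph,coop}`. -/
def fneg (𝔥 : Type*) [AddCommGroup 𝔥] [Module ℂ 𝔥] (a : SHsph Q τ hbar) :
    FreeDouble Q τ hbar 𝔥 := FreeAlgebra.ι ℂ (Sum.inr (Sum.inr a))

/-- The relations of the reduced Drinfeld double of `SH^sph ⊗ SH⁰`. -/
inductive DoubleRel : FreeDouble Q τ hbar 𝔥 → FreeDouble Q τ hbar 𝔥 → Prop
  -- `SH^sph`, `SH⁰` and `SH^{sph,coop}` are subalgebras
  | pos_scalar (r : ℂ) : DoubleRel (fpos Q τ hbar 𝔥 (algebraMap ℂ _ r)) (algebraMap ℂ _ r)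
  | pos_add (a b : SHsph Q τ hbar) :
      DoubleRel (fpos Q τ hbar 𝔥 (a + b)) (fpos Q τ hbar 𝔥 a + fpos Q τ hbar 𝔥 b)
  | pos_mul (a b : SHsph Q τ hbar) :
      DoubleRel (fpos Q τ hbar 𝔥 (a * b)) (fpos Q τ hbar 𝔥 a * fpos Q τ hbar 𝔥 b)
  | zero_scalar (r : ℂ) : DoubleRel (fzero Q τ hbar (algebraMap ℂ _ r)) (algebraMap ℂ _ r)
  | zero_add (c d : SH0 I 𝔥) :
      DoubleRel (fzero Q τ hbar (c + d)) (fzero Q τ hbar c + fzero Q τ hbar d)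
  | zero_mul (c d : SH0 I 𝔥) :
      DoubleRel (fzero Q τ hbar (c * d)) (fzero Q τ hbar c * fzero Q τ hbar d)
  | neg_scalar (r : ℂ) : DoubleRel (fneg Q τ hbar 𝔥 (algebraMap ℂ _ r)) (algebraMap ℂ _ r)
  | neg_add (a b : SHsph Q τ hbar) :
      DoubleRel (fneg Q τ hbar 𝔥 (a + b)) (fneg Q τ hbar 𝔥 a + fneg Q τ hbar 𝔥 b)
  | neg_mul (a b : SHsph Q τ hbar) :
      DoubleRel (fneg Q τ hbar 𝔥 (a * b)) (fneg Q τ hbar 𝔥 a * fneg Q τ hbar 𝔥 b)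
  -- `𝔥` acts on `SH_{e_j}` with weight `α_j`, and on `SH^coop_{e_j}` with weight `-α_j`
  | weight_pos (h : 𝔥) (j : I) (f : Mer) :
      DoubleRel
        (fzero Q τ hbar (cartanElt h) * fpos Q τ hbar 𝔥 (sphElt Q τ hbar j f))
        (fpos Q τ hbar 𝔥 (sphElt Q τ hbar j f) * fzero Q τ hbar (cartanElt h) +
          α j h • fpos Q τ hbar 𝔥 (sphElt Q τ hbar j f))
  | weight_neg (h : 𝔥) (j : I) (f : Mer) :
      DoubleRel
        (fzero Q τ hbar (cartanElt h) * fneg Q τ hbar 𝔥 (sphElt Q τ hbar j f))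
        (fneg Q τ hbar 𝔥 (sphElt Q τ hbar j f) * fzero Q τ hbar (cartanElt h) -
          α j h • fneg Q τ hbar 𝔥 (sphElt Q τ hbar j f))
  -- `Φ⁺_k(u) f = (f Φ̂_k(u)) Φ⁺_k(u)` for `f ∈ SH_{e_j}`
  | phi_pos (k j : I) (n : ℕ) (f : Mer) :
      DoubleRel
        (fzero Q τ hbar (phiCoeff 𝔥 k n) * fpos Q τ hbar 𝔥 (sphElt Q τ hbar j f))
        (∑ p ∈ Finset.HasAntidiagonal.antidiagonal n,
          fpos Q τ hbar 𝔥 (sphElt Q τ hbar j (f * phiHat Q τ hbar k j p.1)) *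
            fzero Q τ hbar (phiCoeff 𝔥 k p.2))
  -- `Φ⁻_k(u) f = (f Φ̂_k(u)) Φ⁻_k(u)` for `f ∈ SH^coop_{e_j}`, where `Φ⁻_k(u) = Φ⁺_k(-u)`
  | phi_neg (k j : I) (n : ℕ) (f : Mer) :
      DoubleRel
        (((-1 : ℂ) ^ n • fzero Q τ hbar (phiCoeff 𝔥 k n)) *
          fneg Q τ hbar 𝔥 (sphElt Q τ hbar j f))
        (∑ p ∈ Finset.HasAntidiagonal.antidiagonal n,
          fneg Q τ hbar 𝔥 (sphElt Q τ hbar j (f * phiHat Q τ hbar k j p.1)) *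
            ((-1 : ℂ) ^ p.2 • fzero Q τ hbar (phiCoeff 𝔥 k p.2)))
  -- the relation `∑ a⁻₁ b⁺₂ (a₂, b₁) = ∑ b⁺₁ a⁻₂ (b₂, a₁)` for `a ∈ SH^coop_{e_k}`, `b ∈ SH_{e_k}`,
  -- with `Δ(b) = Φ⁺_k(z) ⊗ b + b ⊗ 1` and `Δ(a) = Φ⁻_k(z) ⊗ a + a ⊗ 1`
  | cross_same (k : I) (a b : Mer) :
      DoubleRel
        (pairingSeries (fun n => (-1 : ℂ) ^ n • fzero Q τ hbar (phiCoeff 𝔥 k n)) a.1 b.1 +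
          fneg Q τ hbar 𝔥 (sphElt Q τ hbar k a) * fpos Q τ hbar 𝔥 (sphElt Q τ hbar k b))
        (fpos Q τ hbar 𝔥 (sphElt Q τ hbar k b) * fneg Q τ hbar 𝔥 (sphElt Q τ hbar k a) +
          pairingSeries (fun n => fzero Q τ hbar (phiCoeff 𝔥 k n)) b.1 a.1)
  -- the same relation for `a ∈ SH^coop_{e_l}`, `b ∈ SH_{e_k}`, `k ≠ l`: here `(a, b) = 0`
  | cross_ne (k l : I) (hkl : k ≠ l) (a b : Mer) :
      DoubleRel
        (fneg Q τ hbar 𝔥 (sphElt Q τ hbar l a) * fpos Q τ hbar 𝔥 (sphElt Q τ hbar k b))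
        (fpos Q τ hbar 𝔥 (sphElt Q τ hbar k b) * fneg Q τ hbar 𝔥 (sphElt Q τ hbar l a))

/-- The (reduced) Drinfeld double `D(SH^sph)`, generated by `SH^sph`, `SH⁰`, `SH^{sph,coop}`. -/
abbrev Double : Type _ := RingQuot (DoubleRel Q τ hbar α)

/-- `SH^sph → D(SH^sph)`. -/
def pos (a : SHsph Q τ hbar) : Double Q τ hbar α :=
  RingQuot.mkAlgHom ℂ _ (fpos Q τ hbar 𝔥 a)

/-- `SH⁰ → D(SH^sph)`. -/
def zer (c : SH0 I 𝔥) : Double Q τ hbar α := RingQuot.mkAlgHom ℂ _ (fzero Q τ hbar c)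

/-- `SH^{sph,coop} → D(SH^sph)`. -/
def neg (a : SHsph Q τ hbar) : Double Q τ hbar α :=
  RingQuot.mkAlgHom ℂ _ (fneg Q τ hbar 𝔥 a)

/-! ### The generating series -/

/-- The coefficient of `u^n` in `g_λ(u + s - z_k)`, a function of `z_k`. -/
def gCoeff (lam s : ℂ) (n : ℕ) : Mer :=
  ⟨fun z => taylorCoeff (g τ lam) n (s - z), meromorphic_taylorCoeff (meromorphic_g τ lam) n s⟩

/-- The series `𝔛⁺_k(u + s, λ) = g_{λ_k}(u + s - z_k)` in `D(SH^sph)[[u]]`, as a function of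
the number `λ_k` and of the shift `s`. -/
def currentPos (k : I) (lam s : ℂ) : PowerSeries (Double Q τ hbar α) :=
  PowerSeries.mk fun n => pos Q τ hbar α (sphElt Q τ hbar k (gCoeff τ lam s n))

/-- The series `𝔛⁻_k(u + s, λ)`: the element of `SH^{sph,coop}[[u]]` corresponding to
`-𝔛⁺_k(-(u + s), -λ) = -g_{-λ_k}(-u - s - z_k) = g_{λ_k}(u + s + z_k)`. -/
def currentNeg (k : I) (lam s : ℂ) : PowerSeries (Double Q τ hbar α) :=
  PowerSeries.mk fun n =>
    neg Q τ hbar α (sphElt Q τ hbar k (-((-1 : ℂ) ^ n • gCoeff τ (-lam) (-s) n)))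

/-- `𝔛^ε_k(u + s, λ)` for a sign `ε = ±1`. -/
def current (ε : ℤˣ) (k : I) (lam s : ℂ) : PowerSeries (Double Q τ hbar α) :=
  if ε = 1 then currentPos Q τ hbar α k lam s else currentNeg Q τ hbar α k lam s

/-- The series `Φ⁺_k(u)`. -/
def phiPlus (k : I) : PowerSeries (Double Q τ hbar α) :=
  PowerSeries.mk fun n => zer Q τ hbar α (phiCoeff 𝔥 k n)

/-- The series `Φ⁻_k(u) = Φ⁺_k(-u)`. -/
def phiMinus (k : I) : PowerSeries (Double Q τ hbar α) :=
  PowerSeries.mk fun n => (-1 : ℂ) ^ n • zer Q τ hbar α (phiCoeff 𝔥 k n)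

/-- The series `Φ_k(u) = ϑ(ħ) Φ⁺_k(u) + ϑ(ħ) Φ⁻_k(-u)`. -/
def phi (k : I) : PowerSeries (Double Q τ hbar α) :=
  PowerSeries.mk fun n =>
    theta τ hbar • PowerSeries.coeff n (phiPlus Q τ hbar α k) +
      theta τ hbar • ((-1 : ℂ) ^ n • PowerSeries.coeff n (phiMinus Q τ hbar α k))

/-! ### Series in two variables

`A⟦u, v⟧` is `A⟦X⟧⟦X⟧`, with `u` the outer and `v` the inner variable. -/

/-- A series in the first variable `u`. -/
def inU {A : Type*} [Ring A] (s : PowerSeries A) : PowerSeries (PowerSeries A) :=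
  PowerSeries.map PowerSeries.C s

/-- A series in the second variable `v`. -/
def inV {A : Type*} [Ring A] (s : PowerSeries A) : PowerSeries (PowerSeries A) :=
  PowerSeries.C s

/-- The Taylor expansion of `F(u - v)` at `u = v = 0`, with coefficients in `A`. -/
def diffSeries (A : Type*) [Ring A] [Algebra ℂ A] (F : ℂ → ℂ) : PowerSeries (PowerSeries A) :=
  PowerSeries.mk fun i => PowerSeries.mk fun j =>
    algebraMap ℂ A
      ((-1) ^ j * iteratedDeriv (i + j) F 0 / ((i.factorial : ℂ) * (j.factorial : ℂ)))

/-- An element of `A` as a constant series in one variable. -/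
def const {A : Type*} [Ring A] (x : A) : PowerSeries A := PowerSeries.C x

end EllQG
end

noncomputable section

namespace EllQG

open Finset.HasAntidiagonal (antidiagonal)

section ThetaFunction

/-! ### Theta function identities -/

/-! Everything rests on one theta identity. The double series of ϑ(x+y)ϑ(x-y), split by the parity
of the two indices, is a 2×2 determinant O(x)E(y) - E(x)O(y) (`thetaAux_mul_thetaAux`). The Plücker
relation for such determinants is the three term relation `theta_three_term`. The same determinant
also gives ϑ'(0) ≠ 0 and confines the zeros of ϑ to ℤ + τℤ.

EQ1 and EQ2 are the defining relations of the double read coefficientwise. In EQ3, after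
conjugation, and in EQ4, both sides live in one half of the double. There a coefficient is the image
of a shuffle element, and it is zero as soon as a representing function vanishes off countably many
hyperplanes (`Represents.eq_zero`). So these relations reduce to identities of meromorphic functions
near u = v = 0, at generic positions of the points. Conjugation by Φ_i(u) multiplies g_λ by a
quotient of theta functions, and EQ3 is a single instance of the three term relation
(`g_exchange_phiFactor`). In EQ4 the two orders of multiplication carry different shuffle kernels.
For the prescribed weights almost all theta factors cancel in their quotient, which is
ϑ(z-w+a)/ϑ(z-w-a) (`ShuffleFun.kernel_exchange`). What is left is `g_exchange`, which follows from
four instances of the three term relation.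

EQ5 is a residue computation. The cross relation expresses the commutator as -2 Res_{z=0} Φ⁺(z)
g_{λ₁}(u-z) g_{λ₂}(v-z) dz, expanded for u and v small compared with z. The residue theorem would
collect the poles at z = u and z = v and give 2(g_{λ₁}(u-v)Φ⁺(v) + g_{λ₂}(v-u)Φ⁺(u)). The formal
version writes g_λ(w) = 1/w + e(w) with e analytic. The polar parts then produce the divided
difference of Φ⁺, and the analytic parts produce products with e₁(u-v) and e₂(v-u)
(`current_commutator_eq`). Multiplication by ϑ(u-v) clears the divided difference
(`current_commutator`). -/

open Complex in
theorem exp_pi_I_add_int (z : ℂ) (n : ℤ) : exp (z + 2 * Real.pi * I * n) = exp z := by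
  rw [exp_add, show (2 * Real.pi * I * n : ℂ) = n * (2 * Real.pi * I) by ring,
    exp_int_mul_two_pi_mul_I, mul_one]

/-- The even part of the product expansion of `ϑ(x + y) ϑ(x - y)`. -/
def thetaEven (τ : UpperHalfPlane) (x : ℂ) : ℂ := jacobiTheta₂ (2 * x) (2 * (τ : ℂ))

/-- The odd part of the product expansion of `ϑ(x + y) ϑ(x - y)`. -/
def thetaOdd (τ : UpperHalfPlane) (x : ℂ) : ℂ :=
  Complex.exp (2 * Real.pi * Complex.I * x) * jacobiTheta₂ (2 * x + τ) (2 * (τ : ℂ))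

theorem two_mul_im_pos (τ : UpperHalfPlane) : 0 < (2 * (τ : ℂ)).im := by
  simpa using τ.im_pos

/-- The bijection of `ℤ × ℤ ⊕ ℤ × ℤ` with `ℤ × ℤ` by parity of the difference. -/
def parityEquiv : (ℤ × ℤ) ⊕ (ℤ × ℤ) ≃ ℤ × ℤ where
  toFun := Sum.elim (fun p => (p.1 + p.2, p.1 - p.2)) fun p => (p.1 + p.2, p.1 - p.2 - 1)
  invFun p := if (p.1 - p.2) % 2 = 0 then Sum.inl ((p.1 + p.2) / 2, (p.1 - p.2) / 2)
    else Sum.inr ((p.1 + p.2 + 1) / 2, (p.1 - p.2 - 1) / 2)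
  left_inv := by
    rintro (⟨k, l⟩ | ⟨k, l⟩)
    · have h : (k + l - (k - l)) % 2 = 0 := by omega
      simp only [Sum.elim_inl, h, if_true]
      congr 2 <;> omega
    · have h : ¬ (k + l - (k - l - 1)) % 2 = 0 := by omega
      simp only [Sum.elim_inr, h, if_false]
      congr 2 <;> omega
  right_inv := by
    rintro ⟨m, n⟩
    by_cases h : (m - n) % 2 = 0
    · simp only [h, if_true, Sum.elim_inl]
      ext <;> simp <;> omega
    · simp only [h, if_false, Sum.elim_inr]
      ext <;> simp <;> omega

theorem HasSum.mul_complex {ι κ : Type*} {f : ι → ℂ} {g : κ → ℂ} {a b : ℂ} (hf : HasSum f a)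
    (hg : HasSum g b) : HasSum (fun p : ι × κ => f p.1 * g p.2) (a * b) :=
  hf.mul hg (summable_mul_of_summable_norm hf.summable.norm hg.summable.norm)

/-- In the double series with indices m, n, the variables x and y occur through m+n+1 and m-n. These
have opposite parities, so summing over each parity class of m-n separates x from y. -/
theorem thetaAux_mul_thetaAux (τ : UpperHalfPlane) (x y : ℂ) :
    thetaAux τ (x + y) * thetaAux τ (x - y) =
      thetaOdd τ x * thetaEven τ y - thetaEven τ x * thetaOdd τ y := by
  have hs : ∀ z, HasSum (fun n : ℤ => Complex.exp (Real.pi * Complex.I * z) *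
      jacobiTheta₂_term n (z + (1 + (τ : ℂ)) / 2) τ) (thetaAux τ z) := fun z =>
    (hasSum_jacobiTheta₂_term _ τ.im_pos).mul_left _
  have hE : ∀ z, HasSum (fun n : ℤ => jacobiTheta₂_term n (2 * z) (2 * τ)) (thetaEven τ z) :=
    fun z => hasSum_jacobiTheta₂_term _ (two_mul_im_pos τ)
  have hO : ∀ z, HasSum (fun n : ℤ => Complex.exp (2 * Real.pi * Complex.I * z) *
      jacobiTheta₂_term n (2 * z + τ) (2 * τ)) (thetaOdd τ z) := fun z =>
    (hasSum_jacobiTheta₂_term _ (two_mul_im_pos τ)).mul_left _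
  have h1 := parityEquiv.hasSum_iff.2 (HasSum.mul_complex (hs (x + y)) (hs (x - y)))
  rw [sub_eq_add_neg (thetaOdd τ x * _)]
  refine h1.unique (HasSum.sum ?_ ?_)
  · convert HasSum.mul_complex (hO x) (hE y) using 2 with p
    obtain ⟨k, l⟩ := p
    simp only [Function.comp_apply, parityEquiv, Equiv.coe_fn_mk, Sum.elim_inl, jacobiTheta₂_term,
      ← Complex.exp_add]
    -- The shift by 1/2 contributes exp(πi(m+n)). It is 1 here, where m+n = 2k, and -1 in the other
    -- class, where m+n = 2k-1; this is the minus sign of the determinant.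
    rw [← exp_pi_I_add_int _ (-k)]
    congr 1
    push_cast
    ring
  · refine (HasSum.mul_complex (hE x) (hO y)).neg.congr_fun fun p => ?_
    obtain ⟨k, l⟩ := p
    simp only [Function.comp_apply, parityEquiv, Equiv.coe_fn_mk, Sum.elim_inr, jacobiTheta₂_term,
      ← Complex.exp_add]
    rw [← neg_one_mul, ← Complex.exp_pi_mul_I, ← Complex.exp_add, ← exp_pi_I_add_int _ (1 - k)]
    congr 1
    push_cast
    ring

theorem thetaAux_zero (τ : UpperHalfPlane) : thetaAux τ 0 = 0 := by
  have h := thetaAux_mul_thetaAux τ 0 0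
  -- The determinant vanishes at x = y = 0, so the square of the value at 0 is zero.
  simpa [mul_comm] using h

theorem thetaAux_neg (τ : UpperHalfPlane) (z : ℂ) : thetaAux τ (-z) = -thetaAux τ z := by
  unfold thetaAux
  have h := jacobiTheta₂_add_left' (-(z + (1 + (τ : ℂ)) / 2) + 1) τ
  rw [jacobiTheta₂_add_left, jacobiTheta₂_neg_left] at h
  rw [show -z + (1 + (τ : ℂ)) / 2 = -(z + (1 + (τ : ℂ)) / 2) + 1 + τ by ring, h, ← mul_assoc,
    ← neg_mul, ← Complex.exp_add, ← Complex.exp_add_pi_mul_I, ← exp_pi_I_add_int _ 1]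
  congr 2
  push_cast
  ring

theorem thetaAux_add_one (τ : UpperHalfPlane) (z : ℂ) : thetaAux τ (z + 1) = -thetaAux τ z := by
  unfold thetaAux
  rw [show z + 1 + (1 + (τ : ℂ)) / 2 = z + (1 + (τ : ℂ)) / 2 + 1 by ring, jacobiTheta₂_add_left,
    mul_add, Complex.exp_add, mul_one, Complex.exp_pi_mul_I]
  ring

theorem thetaAux_add_tau (τ : UpperHalfPlane) (z : ℂ) : thetaAux τ (z + τ) =
    -(Complex.exp (-(2 * Real.pi * Complex.I * z) - Real.pi * Complex.I * τ) * thetaAux τ z) := by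
  unfold thetaAux
  rw [show z + τ + (1 + (τ : ℂ)) / 2 = z + (1 + (τ : ℂ)) / 2 + τ by ring, jacobiTheta₂_add_left',
    ← mul_assoc, ← mul_assoc, ← neg_mul, ← Complex.exp_add, ← Complex.exp_add,
    ← Complex.exp_add_pi_mul_I, ← exp_pi_I_add_int _ 1]
  congr 2
  push_cast
  ring

/-! ### Nonvanishing, derivative at zero, and location of the zeros of ϑ -/

theorem exists_jacobiTheta₂_ne_zero (τ : UpperHalfPlane) : ∃ z, jacobiTheta₂ z τ ≠ 0 := by
  by_contra! h0
  let f : ℤ → C(ℝ, ℂ) := fun n => ⟨fun x => jacobiTheta₂_term n x τ, by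
    unfold jacobiTheta₂_term; fun_prop⟩
  -- On the real line the norm of each term does not depend on x, so the series may be integrated
  -- termwise over [0,1]. Only the term n = 0 survives, with integral 1, whereas a vanishing theta
  -- series would integrate to 0.
  have hsum : Summable fun n => ‖(f n).restrict
      (⟨Set.uIcc 0 1, isCompact_uIcc⟩ : TopologicalSpace.Compacts ℝ)‖ := by
    refine Summable.of_nonneg_of_le (fun _ => norm_nonneg _) (fun n => ?_)
      (hasSum_jacobiTheta₂_term 0 τ.im_pos).summable.norm
    rw [ContinuousMap.norm_le _ (norm_nonneg _)]
    intro x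
    simp [f, norm_jacobiTheta₂_term]
  have h := intervalIntegral.hasSum_intervalIntegral_of_summable_norm (a := 0) (b := 1) hsum
  have h1 : ∀ x : ℝ, ∑' n, f n x = 0 := fun x => h0 x
  simp only [h1, intervalIntegral.integral_zero] at h
  refine one_ne_zero (α := ℂ) ((hasSum_ite_eq (0 : ℤ) (1 : ℂ)).unique (h.congr_fun ?_))
  intro n
  simp only [f, ContinuousMap.coe_mk, jacobiTheta₂_term]
  split_ifs with hn
  · simp [hn]
  · simp only [Complex.exp_add]
    rw [intervalIntegral.integral_mul_const, integral_exp_mul_complex (by simp [hn])]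
    have h2 := exp_pi_I_add_int 0 n
    rw [zero_add] at h2
    simp [h2]

theorem exists_thetaAux_ne_zero (τ : UpperHalfPlane) : ∃ z, thetaAux τ z ≠ 0 := by
  obtain ⟨z, hz⟩ := exists_jacobiTheta₂_ne_zero τ
  refine ⟨z - (1 + (τ : ℂ)) / 2, mul_ne_zero (Complex.exp_ne_zero _) ?_⟩
  rwa [sub_add_cancel]

theorem differentiable_thetaEven (τ : UpperHalfPlane) : Differentiable ℂ (thetaEven τ) :=
  fun z => (differentiableAt_jacobiTheta₂_fst _ (two_mul_im_pos τ)).comp z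
    (f := fun w : ℂ => 2 * w) (by fun_prop)

theorem differentiable_thetaOdd (τ : UpperHalfPlane) : Differentiable ℂ (thetaOdd τ) := by
  intro z
  unfold thetaOdd
  exact DifferentiableAt.mul (by fun_prop)
    ((differentiableAt_jacobiTheta₂_fst _ (two_mul_im_pos τ)).comp z
      (f := fun w : ℂ => 2 * w + τ) (by fun_prop))

/-- Two entire functions whose logarithmic derivatives differ by a constant. -/
theorem eq_exp_mul_of_deriv_mul_sub {f k : ℂ → ℂ} (hf : Differentiable ℂ f)
    (hk : Differentiable ℂ k) (β : ℂ) {z₀ : ℂ} (hz₀ : k z₀ ≠ 0)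
    (h : ∀ z, deriv f z * k z - deriv k z * f z = β * (f z * k z)) :
    ∃ c, ∀ z, f z = c * Complex.exp (β * z) * k z := by
  obtain ⟨r, hr, hball⟩ := Metric.eventually_nhds_iff_ball.1 (hk.continuous.continuousAt.eventually_ne hz₀)
  let q : ℂ → ℂ := fun z => Complex.exp (-(β * z)) * (f z / k z)
  have hq : ∀ z ∈ Metric.ball z₀ r, HasDerivAt q 0 z := by
    intro z hz
    have h1 : HasDerivAt (fun z => Complex.exp (-(β * z))) (Complex.exp (-(β * z)) * (-β)) z := by
      have := ((hasDerivAt_id z).const_mul β).neg.cexp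
      simpa using this
    have h2 := h1.mul (((hf z).hasDerivAt).div ((hk z).hasDerivAt) (hball z hz))
    have h3 := h z
    have h4 := hball z hz
    refine HasDerivAt.congr_deriv h2 ?_
    rw [Pi.div_apply]
    field_simp
    linear_combination Complex.exp (-(β * z)) * h3
  have hconst : ∀ z ∈ Metric.ball z₀ r, q z = q z₀ := fun z hz =>
    Metric.isOpen_ball.is_const_of_deriv_eq_zero (convex_ball _ _).isPreconnected
      (fun z hz => (hq z hz).differentiableAt.differentiableWithinAt)
      (fun z hz => (hq z hz).deriv) hz (Metric.mem_ball_self hr)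
  refine ⟨q z₀, fun z => congrFun (AnalyticOnNhd.eq_of_eventuallyEq (z₀ := z₀)
    (f := f) (g := fun z => q z₀ * Complex.exp (β * z) * k z)
    (fun z _ => hf.analyticAt z) (fun z _ => Differentiable.analyticAt (by fun_prop) z) ?_) z⟩
  filter_upwards [Metric.ball_mem_nhds z₀ hr] with z hz
  have h4 := hball z hz
  rw [← hconst z hz]
  simp only [q]
  rw [Complex.exp_neg]
  have := Complex.exp_ne_zero (β * z)
  field_simp

/-- Differentiating the determinant formula in x at x = y gives ϑ(2y)ϑ'(0) = O'(y)E(y) - E'(y)O(y).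
If ϑ'(0) = 0, the Wronskian of O and E vanishes, so either E is zero or O is a multiple of E. In
both cases the determinant is identically zero, contradicting ϑ(z)² ≠ 0 for some z. -/
theorem deriv_thetaAux_zero_ne_zero (τ : UpperHalfPlane) : deriv (thetaAux τ) 0 ≠ 0 := by
  intro h0
  have hprod : (∃ c, ∀ z, thetaOdd τ z = c * Complex.exp (0 * z) * thetaEven τ z) → False := by
    rintro ⟨c, hc⟩
    obtain ⟨z, hz⟩ := exists_thetaAux_ne_zero τ
    have h := thetaAux_mul_thetaAux τ z 0
    rw [hc, hc] at h
    simp only [add_zero, sub_zero, zero_mul, Complex.exp_zero, mul_one] at h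
    exact mul_ne_zero hz hz (h.trans (by ring))
  by_cases hE : ∃ z, thetaEven τ z ≠ 0
  · obtain ⟨z₀, hz₀⟩ := hE
    refine hprod (eq_exp_mul_of_deriv_mul_sub (differentiable_thetaOdd τ)
      (differentiable_thetaEven τ) 0 hz₀ fun y => ?_)
    have hd : HasDerivAt (thetaAux τ) 0 (y - y) := by
      rw [sub_self]
      simpa only [h0] using (differentiable_thetaAux τ 0).hasDerivAt
    have h1 := ((differentiable_thetaAux τ (y + y)).hasDerivAt.comp_add_const y y).mul
      (hd.comp_sub_const y y)
    have h2 := ((differentiable_thetaOdd τ y).hasDerivAt.mul_const (thetaEven τ y)).sub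
      ((differentiable_thetaEven τ y).hasDerivAt.mul_const (thetaOdd τ y))
    have h3 := h1.unique (h2.congr_of_eventuallyEq (.of_forall fun x => ?_))
    · simp only [sub_self, thetaAux_zero, mul_zero, add_zero] at h3
      linear_combination -h3
    · exact thetaAux_mul_thetaAux τ x y
  · push Not at hE
    obtain ⟨z, hz⟩ := exists_thetaAux_ne_zero τ
    have h := thetaAux_mul_thetaAux τ z 0
    rw [hE, hE] at h
    simp only [add_zero, sub_zero, mul_zero, zero_mul] at h
    exact mul_ne_zero hz hz h

/-- A zero w makes the vectors (O,E) at y+w and at y parallel. This forces s(z+w) = c·exp(βz)·s(z),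
and comparing both sides under z ↦ z+1 and z ↦ z+τ leaves only lattice points for w. No contour
integral is used. -/
theorem mem_periodLattice_of_thetaAux_eq_zero (τ : UpperHalfPlane) {w : ℂ}
    (hw : thetaAux τ w = 0) : w ∈ periodLattice τ := by
  set s := thetaAux τ with hs
  have hdiff : Differentiable ℂ s := differentiable_thetaAux τ
  have hpar : ∀ y, thetaOdd τ (y + w) * thetaEven τ y = thetaEven τ (y + w) * thetaOdd τ y := by
    intro y
    have h := thetaAux_mul_thetaAux τ (y + w) y
    rw [show y + w - y = w by ring, ← hs, hw, mul_zero] at h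
    linear_combination -h
  -- Both products of values of s are determinants with first column at (A+B)/2, shifted by w or
  -- not. Since these columns are parallel, the quotient of the determinants does not depend on t.
  have hquad : ∀ A B t, s (A + t + w) * s (B - t + w) * (s A * s B) =
      s (A + t) * s (B - t) * (s (A + w) * s (B + w)) := by
    intro A B t
    have e1 := thetaAux_mul_thetaAux τ ((A + B) / 2 + w) ((A - B) / 2 + t)
    have e2 := thetaAux_mul_thetaAux τ ((A + B) / 2) ((A - B) / 2)
    have e3 := thetaAux_mul_thetaAux τ ((A + B) / 2) ((A - B) / 2 + t)
    have e4 := thetaAux_mul_thetaAux τ ((A + B) / 2 + w) ((A - B) / 2)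
    have hp := hpar ((A + B) / 2)
    rw [show (A + B) / 2 + w + ((A - B) / 2 + t) = A + t + w by ring,
      show (A + B) / 2 + w - ((A - B) / 2 + t) = B - t + w by ring] at e1
    rw [show (A + B) / 2 + ((A - B) / 2) = A by ring,
      show (A + B) / 2 - ((A - B) / 2) = B by ring] at e2
    rw [show (A + B) / 2 + ((A - B) / 2 + t) = A + t by ring,
      show (A + B) / 2 - ((A - B) / 2 + t) = B - t by ring] at e3
    rw [show (A + B) / 2 + w + ((A - B) / 2) = A + w by ring,
      show (A + B) / 2 + w - ((A - B) / 2) = B + w by ring] at e4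
    rw [hs, e1, e2, e3, e4]
    linear_combination (thetaOdd τ ((A - B) / 2 + t) * thetaEven τ ((A - B) / 2) -
      thetaEven τ ((A - B) / 2 + t) * thetaOdd τ ((A - B) / 2)) * hp
  -- The derivative of `hquad` at t = 0, with denominators cleared: the logarithmic derivative of
  -- s(z+w)/s(z) takes the same value at A and at B.
  have hdq : ∀ A B, (deriv s (A + w) * s A - deriv s A * s (A + w)) * (s B * s (B + w)) =
      (s A * s (A + w)) * (deriv s (B + w) * s B - deriv s B * s (B + w)) := by
    intro A B
    have hp : ∀ C, HasDerivAt (fun t => s (C + t)) (deriv s C) 0 := fun C => by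
      have h := (hdiff (C + 0)).hasDerivAt.comp_const_add C 0
      simpa using h
    have hm : ∀ C, HasDerivAt (fun t => s (C - t)) (-deriv s C) 0 := fun C => by
      have h := (hdiff (C - 0)).hasDerivAt.comp_const_sub C 0
      simpa using h
    have h1 := ((hp (A + w)).mul (hm (B + w))).mul_const (s A * s B)
    have h2 := ((hp A).mul (hm B)).mul_const (s (A + w) * s (B + w))
    have h3 := h1.unique (h2.congr_of_eventuallyEq (.of_forall fun t => ?_))
    · simp only [add_zero, sub_zero] at h3
      linear_combination h3
    · have := hquad A B t
      simp only [Pi.mul_apply]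
      rw [add_right_comm, show B + w - t = B - t + w by ring]
      exact this
  obtain ⟨z₁, hz₁⟩ := exists_thetaAux_ne_zero τ
  obtain ⟨b, hb⟩ : ∃ b, s b * s (b + w) ≠ 0 := by
    by_contra! hall
    have ha1 : AnalyticOnNhd ℂ s Set.univ := fun z _ => hdiff.analyticAt z
    have ha2 : AnalyticOnNhd ℂ (fun z => s (z + w)) Set.univ := fun z _ =>
      Differentiable.analyticAt (by fun_prop) z
    have := ha1.eq_zero_or_eq_zero_of_mul_eq_zero ha2 (by intro z _; exact hall z)
      isPreconnected_univ
    rcases this with h | h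
    · exact hz₁ (h z₁ trivial)
    · exact hz₁ (by simpa using h (z₁ - w) trivial)
  obtain ⟨c, hc⟩ := eq_exp_mul_of_deriv_mul_sub (f := fun z => s (z + w)) (k := s) (by fun_prop)
    hdiff ((deriv s (b + w) * s b - deriv s b * s (b + w)) / (s b * s (b + w)))
    (left_ne_zero_of_mul hb) (fun z => by
      have := hdq z b
      rw [deriv_comp_add_const, div_mul_eq_mul_div, eq_div_iff hb, this]
      ring)
  set β := (deriv s (b + w) * s b - deriv s b * s (b + w)) / (s b * s (b + w))
  have hbw := hc b
  have hb1 : s b ≠ 0 := left_ne_zero_of_mul hb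
  have hb2 : s (b + w) ≠ 0 := right_ne_zero_of_mul hb
  have hc0 : c ≠ 0 := by
    rintro rfl
    simp [hb2] at hbw
  have h1 : Complex.exp β = 1 := by
    have h := hc (b + 1)
    simp only [hs] at h hbw hb1
    rw [show b + 1 + w = b + w + 1 by ring, thetaAux_add_one, thetaAux_add_one, hbw, mul_add,
      Complex.exp_add, mul_one] at h
    have h5 : c * Complex.exp (β * b) * thetaAux τ b * (Complex.exp β - 1) = 0 := by
      linear_combination h
    have h6 : c * Complex.exp (β * b) * thetaAux τ b ≠ 0 :=
      mul_ne_zero (mul_ne_zero hc0 (Complex.exp_ne_zero _)) hb1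
    exact sub_eq_zero.1 ((mul_eq_zero.1 h5).resolve_left h6)
  have h2 : Complex.exp (-(2 * Real.pi * Complex.I * w)) = Complex.exp (β * τ) := by
    have h := hc (b + τ)
    simp only [hs] at h hbw hb1
    rw [show b + τ + w = b + w + τ by ring, thetaAux_add_tau, thetaAux_add_tau, hbw, mul_add β,
      Complex.exp_add, show -(2 * Real.pi * Complex.I * (b + w)) - Real.pi * Complex.I * (τ : ℂ) =
        -(2 * Real.pi * Complex.I * w) + (-(2 * Real.pi * Complex.I * b) -
          Real.pi * Complex.I * (τ : ℂ)) by ring, Complex.exp_add] at h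
    have h5 : c * Complex.exp (β * b) * thetaAux τ b * Complex.exp (-(2 * Real.pi * Complex.I * b) -
        Real.pi * Complex.I * (τ : ℂ)) * (Complex.exp (-(2 * Real.pi * Complex.I * w)) -
          Complex.exp (β * τ)) = 0 := by
      linear_combination -h
    have h6 : c * Complex.exp (β * b) * thetaAux τ b * Complex.exp (-(2 * Real.pi * Complex.I * b) -
        Real.pi * Complex.I * (τ : ℂ)) ≠ 0 :=
      mul_ne_zero (mul_ne_zero (mul_ne_zero hc0 (Complex.exp_ne_zero _)) hb1)
        (Complex.exp_ne_zero _)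
    exact sub_eq_zero.1 ((mul_eq_zero.1 h5).resolve_left h6)
  -- Now β = 2πi·n and -2πi·w = βτ + 2πi·m, hence w = -m - nτ.
  obtain ⟨n, hn⟩ := Complex.exp_eq_one_iff.1 h1
  obtain ⟨m, hm⟩ := Complex.exp_eq_exp_iff_exists_int.1 h2
  refine ⟨-m, -n, ?_⟩
  rw [hn] at hm
  have h7 := Complex.two_pi_I_ne_zero
  apply mul_left_cancel₀ h7
  push_cast
  linear_combination -hm

variable (τ : UpperHalfPlane)

theorem theta_neg (z : ℂ) : theta τ (-z) = -theta τ z := by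
  simp [theta, thetaAux_neg, neg_div]

theorem theta_zero : theta τ 0 = 0 := by
  simp [theta, thetaAux_zero]

theorem deriv_theta_zero : deriv (theta τ) 0 = 1 := by
  unfold theta
  rw [deriv_div_const]
  exact div_self (deriv_thetaAux_zero_ne_zero τ)

variable {τ} in
theorem theta_ne_zero {z : ℂ} (hz : z ∉ periodLattice τ) : theta τ z ≠ 0 :=
  div_ne_zero (fun h => hz (mem_periodLattice_of_thetaAux_eq_zero τ h))
    (deriv_thetaAux_zero_ne_zero τ)

/-- The three term relation. -/
theorem theta_three_term (x y z t : ℂ) :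
    theta τ (x + y) * theta τ (x - y) * (theta τ (z + t) * theta τ (z - t)) +
        theta τ (y + z) * theta τ (y - z) * (theta τ (x + t) * theta τ (x - t)) +
      theta τ (z + x) * theta τ (z - x) * (theta τ (y + t) * theta τ (y - t)) = 0 := by
  have h := thetaAux_mul_thetaAux τ
  have h0 := deriv_thetaAux_zero_ne_zero τ
  -- Each of the six products becomes a 2×2 determinant in the vectors (O,E) at x, y, z, t. The
  -- claim is then the Plücker relation.
  simp only [theta, div_mul_div_comm, h]
  field_simp
  ring

theorem countable_periodLattice : (periodLattice τ).Countable := by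
  have : periodLattice τ = Set.range fun p : ℤ × ℤ => (p.1 + p.2 * (τ : ℂ)) := by
    ext z
    simp [periodLattice, eq_comm]
  rw [this]
  exact Set.countable_range _

variable {τ} in
theorem neg_mem_periodLattice {z : ℂ} (hz : z ∈ periodLattice τ) : -z ∈ periodLattice τ := by
  obtain ⟨m, n, rfl⟩ := hz
  exact ⟨-m, -n, by push_cast; ring⟩

end ThetaFunction

/-! ### Taylor coefficients in one and two variables -/

section Taylor

variable {f k : ℂ → ℂ} {z : ℂ}

theorem taylorCoeff_congr (h : f =ᶠ[𝓝 z] k) (n : ℕ) : taylorCoeff f n z = taylorCoeff k n z := by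
  rw [taylorCoeff, taylorCoeff, (h.iteratedDeriv n).eq_of_nhds]

theorem taylorCoeff_add (hf : AnalyticAt ℂ f z) (hk : AnalyticAt ℂ k z) (n : ℕ) :
    taylorCoeff (fun w => f w + k w) n z = taylorCoeff f n z + taylorCoeff k n z := by
  rw [taylorCoeff, iteratedDeriv_fun_add hf.contDiffAt hk.contDiffAt, add_div]
  rfl

theorem taylorCoeff_const_mul (hf : AnalyticAt ℂ f z) (c : ℂ) (n : ℕ) :
    taylorCoeff (fun w => c * f w) n z = c * taylorCoeff f n z := by
  rw [taylorCoeff, taylorCoeff, mul_div_assoc']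
  congr 1
  exact iteratedDeriv_const_mul _ hf.contDiffAt

theorem taylorCoeff_zero (n : ℕ) : taylorCoeff (fun _ => 0) n z = 0 := by
  simp [taylorCoeff]

theorem taylorCoeff_const (c : ℂ) (n : ℕ) :
    taylorCoeff (fun _ => c) n z = if n = 0 then c else 0 := by
  rw [taylorCoeff, iteratedDeriv_const]
  split_ifs with h <;> simp [h]

theorem taylorCoeff_sum {ι : Type*} (s : Finset ι) {F : ι → ℂ → ℂ}
    (hF : ∀ i ∈ s, AnalyticAt ℂ (F i) z) (n : ℕ) :
    taylorCoeff (fun w => ∑ i ∈ s, F i w) n z = ∑ i ∈ s, taylorCoeff (F i) n z := by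
  classical
  induction s using Finset.induction_on with
  | empty => simp [taylorCoeff_zero]
  | insert a s ha ih =>
    simp only [Finset.sum_insert ha]
    rw [taylorCoeff_add (hF a (Finset.mem_insert_self _ _))
      (Finset.analyticAt_fun_sum s fun i hi => hF i (Finset.mem_insert_of_mem hi)),
      ih fun i hi => hF i (Finset.mem_insert_of_mem hi)]

theorem taylorCoeff_mul (hf : AnalyticAt ℂ f z) (hk : AnalyticAt ℂ k z) (n : ℕ) :
    taylorCoeff (fun w => f w * k w) n z =
      ∑ p ∈ antidiagonal n, taylorCoeff f p.1 z * taylorCoeff k p.2 z := by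
  rw [taylorCoeff, show (fun w => f w * k w) = f * k from rfl,
    iteratedDeriv_mul hf.contDiffAt hk.contDiffAt,
    Finset.Nat.sum_antidiagonal_eq_sum_range_succ
      (fun i j => taylorCoeff f i z * taylorCoeff k j z), Finset.sum_div]
  refine Finset.sum_congr rfl fun i hi => ?_
  have hi' : i ≤ n := Nat.lt_succ_iff.1 (Finset.mem_range.1 hi)
  have h1 : (n.factorial : ℂ) = n.choose i * i.factorial * (n - i).factorial := by
    exact_mod_cast (Nat.choose_mul_factorial_mul_factorial hi').symm
  have h2 : (i.factorial : ℂ) ≠ 0 := Nat.cast_ne_zero.2 i.factorial_ne_zero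
  have h3 : ((n - i).factorial : ℂ) ≠ 0 := Nat.cast_ne_zero.2 (n - i).factorial_ne_zero
  have h4 : (n.choose i : ℂ) ≠ 0 := Nat.cast_ne_zero.2 (Nat.choose_pos hi').ne'
  rw [h1, taylorCoeff, taylorCoeff]
  field_simp

theorem analyticAt_taylorCoeff (hf : AnalyticAt ℂ f z) (n : ℕ) :
    AnalyticAt ℂ (fun w => taylorCoeff f n w) z := by
  unfold taylorCoeff
  simp only [iteratedDeriv_eq_iterate]
  exact (hf.iterated_deriv n).div analyticAt_const (Nat.cast_ne_zero.2 n.factorial_ne_zero)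

theorem taylorCoeff_comp_add_const (f : ℂ → ℂ) (c : ℂ) (n : ℕ) (z : ℂ) :
    taylorCoeff (fun w => f (w + c)) n z = taylorCoeff f n (z + c) := by
  rw [taylorCoeff, iteratedDeriv_comp_add_const]
  rfl

theorem taylorCoeff_comp_const_sub (f : ℂ → ℂ) (c : ℂ) (n : ℕ) (z : ℂ) :
    taylorCoeff (fun w => f (c - w)) n z = (-1) ^ n * taylorCoeff f n (c - z) := by
  rw [taylorCoeff, iteratedDeriv_comp_const_sub, taylorCoeff]
  simp [mul_div_assoc]

/-- The coefficient of `u^m v^n` in the iterated Taylor expansion of `G` at `u = v = 0`. -/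
def taylorCoeff₂ (G : ℂ → ℂ → ℂ) (m n : ℕ) : ℂ :=
  taylorCoeff (fun u => taylorCoeff (G u) n 0) m 0

/-- Functions of two variables whose iterated Taylor expansion at `u = v = 0` makes sense. -/
def TaylorExpandable (G : ℂ → ℂ → ℂ) : Prop :=
  (∀ᶠ u in 𝓝 0, AnalyticAt ℂ (G u) 0) ∧
    ∀ n, AnalyticAt ℂ (fun u => taylorCoeff (G u) n 0) 0

variable {G K : ℂ → ℂ → ℂ}

theorem TaylorExpandable.add (hG : TaylorExpandable G) (hK : TaylorExpandable K) :
    TaylorExpandable fun u v => G u v + K u v := by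
  refine ⟨?_, fun n => ((hG.2 n).add (hK.2 n)).congr ?_⟩
  · filter_upwards [hG.1, hK.1] with u h1 h2 using h1.add h2
  · filter_upwards [hG.1, hK.1] with u h1 h2 using (taylorCoeff_add h1 h2 n).symm

theorem TaylorExpandable.const_mul (hG : TaylorExpandable G) (c : ℂ) :
    TaylorExpandable fun u v => c * G u v := by
  refine ⟨?_, fun n => (analyticAt_const (v := c) |>.mul (hG.2 n)).congr ?_⟩
  · filter_upwards [hG.1] with u h1 using analyticAt_const.mul h1
  · filter_upwards [hG.1] with u h1 using (taylorCoeff_const_mul h1 c n).symm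

theorem TaylorExpandable.mul (hG : TaylorExpandable G) (hK : TaylorExpandable K) :
    TaylorExpandable fun u v => G u v * K u v := by
  refine ⟨?_, fun n => AnalyticAt.congr (f := fun u => ∑ p ∈ antidiagonal n,
    taylorCoeff (G u) p.1 0 * taylorCoeff (K u) p.2 0) ?_ ?_⟩
  · filter_upwards [hG.1, hK.1] with u h1 h2 using h1.mul h2
  · exact Finset.analyticAt_fun_sum _ fun p _ => (hG.2 p.1).mul (hK.2 p.2)
  · filter_upwards [hG.1, hK.1] with u h1 h2 using (taylorCoeff_mul h1 h2 n).symm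

theorem taylorExpandable_prod {f k : ℂ → ℂ} (hf : AnalyticAt ℂ f 0) (hk : AnalyticAt ℂ k 0) :
    TaylorExpandable fun u v => f u * k v := by
  refine ⟨.of_forall fun u => analyticAt_const.mul hk, fun n => ?_⟩
  simp only [taylorCoeff_const_mul hk]
  exact hf.mul analyticAt_const

theorem taylorExpandable_diff {F : ℂ → ℂ} (hF : AnalyticAt ℂ F 0) :
    TaylorExpandable fun u v => F (u - v) := by
  constructor
  · filter_upwards [hF.eventually_analyticAt] with u hu
    exact AnalyticAt.comp (g := F) (by simpa using hu) (by fun_prop)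
  · intro n
    simp only [taylorCoeff_comp_const_sub, sub_zero]
    exact analyticAt_const.mul (analyticAt_taylorCoeff hF n)

/-- The expansion is iterated, first in v and then in u, so the neighbourhood of v may shrink with
u. -/
theorem taylorCoeff₂_congr (h : ∀ᶠ u in 𝓝 0, ∀ᶠ v in 𝓝 0, G u v = K u v) (m n : ℕ) :
    taylorCoeff₂ G m n = taylorCoeff₂ K m n :=
  taylorCoeff_congr (h.mono fun _ hu => taylorCoeff_congr hu n) m

theorem taylorCoeff₂_zero (m n : ℕ) : taylorCoeff₂ (fun _ _ => 0) m n = 0 := by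
  simp [taylorCoeff₂, taylorCoeff_zero]

theorem taylorCoeff₂_add (hG : TaylorExpandable G) (hK : TaylorExpandable K) (m n : ℕ) :
    taylorCoeff₂ (fun u v => G u v + K u v) m n = taylorCoeff₂ G m n + taylorCoeff₂ K m n := by
  rw [taylorCoeff₂, taylorCoeff₂, taylorCoeff₂, ← taylorCoeff_add (hG.2 n) (hK.2 n)]
  refine taylorCoeff_congr ?_ m
  filter_upwards [hG.1, hK.1] with u h1 h2 using taylorCoeff_add h1 h2 n

theorem taylorCoeff₂_const_mul (hG : TaylorExpandable G) (c : ℂ) (m n : ℕ) :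
    taylorCoeff₂ (fun u v => c * G u v) m n = c * taylorCoeff₂ G m n := by
  rw [taylorCoeff₂, taylorCoeff₂, ← taylorCoeff_const_mul (hG.2 n)]
  refine taylorCoeff_congr ?_ m
  filter_upwards [hG.1] with u h1 using taylorCoeff_const_mul h1 c n

theorem taylorCoeff₂_mul (hG : TaylorExpandable G) (hK : TaylorExpandable K) (m n : ℕ) :
    taylorCoeff₂ (fun u v => G u v * K u v) m n =
      ∑ p ∈ antidiagonal m, ∑ q ∈ antidiagonal n,
        taylorCoeff₂ G p.1 q.1 * taylorCoeff₂ K p.2 q.2 := by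
  have h : (fun u => taylorCoeff (fun v => G u v * K u v) n 0) =ᶠ[𝓝 0] fun u =>
      ∑ q ∈ antidiagonal n, taylorCoeff (G u) q.1 0 * taylorCoeff (K u) q.2 0 := by
    filter_upwards [hG.1, hK.1] with u h1 h2 using taylorCoeff_mul h1 h2 n
  rw [taylorCoeff₂, taylorCoeff_congr h,
    taylorCoeff_sum _ fun p _ => (hG.2 p.1).mul (hK.2 p.2), Finset.sum_comm]
  exact Finset.sum_congr rfl fun q _ => taylorCoeff_mul (hG.2 q.1) (hK.2 q.2) m

theorem taylorCoeff₂_prod {f k : ℂ → ℂ} (hf : AnalyticAt ℂ f 0) (hk : AnalyticAt ℂ k 0)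
    (m n : ℕ) : taylorCoeff₂ (fun u v => f u * k v) m n =
      taylorCoeff f m 0 * taylorCoeff k n 0 := by
  simp only [taylorCoeff₂, taylorCoeff_const_mul hk]
  simp only [mul_comm _ (taylorCoeff k n 0)]
  exact taylorCoeff_const_mul hf _ m

/-- The coefficient of `u^i v^j` in the Taylor expansion of `F(u - v)`. -/
def diffCoeff (F : ℂ → ℂ) (i j : ℕ) : ℂ :=
  (-1) ^ j * iteratedDeriv (i + j) F 0 / ((i.factorial : ℂ) * (j.factorial : ℂ))

theorem taylorCoeff₂_diff {F : ℂ → ℂ} (hF : AnalyticAt ℂ F 0) (m n : ℕ) :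
    taylorCoeff₂ (fun u v => F (u - v)) m n = diffCoeff F m n := by
  simp only [taylorCoeff₂, taylorCoeff_comp_const_sub, sub_zero]
  rw [taylorCoeff_const_mul (analyticAt_taylorCoeff hF n), diffCoeff]
  unfold taylorCoeff
  have h : iteratedDeriv m (fun w => iteratedDeriv n F w / (n.factorial : ℂ)) 0 =
      iteratedDeriv (m + n) F 0 / (n.factorial : ℂ) := by
    simp only [div_eq_mul_inv, iteratedDeriv_mul_const_field]
    simp only [iteratedDeriv_eq_iterate, Function.iterate_add_apply]
  rw [h]
  field_simp

/-- Coefficients of a series in two variables. -/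
def coeff₂ {A : Type*} [Ring A] (m n : ℕ) (S : PowerSeries (PowerSeries A)) : A :=
  PowerSeries.coeff n (PowerSeries.coeff m S)

/-! ### Coefficients of formal series in u and v -/

section DiffSeries

variable {A : Type*} [Ring A]

theorem ext_coeff₂ {S T : PowerSeries (PowerSeries A)} (h : ∀ m n, coeff₂ m n S = coeff₂ m n T) :
    S = T := PowerSeries.ext fun m => PowerSeries.ext fun n => h m n

theorem coeff₂_mul (S T : PowerSeries (PowerSeries A)) (m n : ℕ) :
    coeff₂ m n (S * T) = ∑ p ∈ antidiagonal m, ∑ q ∈ antidiagonal n,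
      coeff₂ p.1 q.1 S * coeff₂ p.2 q.2 T := by
  simp [coeff₂, PowerSeries.coeff_mul, map_sum]

theorem coeff₂_add (S T : PowerSeries (PowerSeries A)) (m n : ℕ) :
    coeff₂ m n (S + T) = coeff₂ m n S + coeff₂ m n T := by
  simp [coeff₂]

theorem coeff₂_sub (S T : PowerSeries (PowerSeries A)) (m n : ℕ) :
    coeff₂ m n (S - T) = coeff₂ m n S - coeff₂ m n T := by
  simp [coeff₂]

theorem coeff₂_inU (s : PowerSeries A) (m n : ℕ) :
    coeff₂ m n (inU s) = if n = 0 then PowerSeries.coeff m s else 0 := by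
  simp [coeff₂, inU, PowerSeries.coeff_C]

theorem coeff₂_inV (s : PowerSeries A) (m n : ℕ) :
    coeff₂ m n (inV s) = if m = 0 then PowerSeries.coeff n s else 0 := by
  rw [coeff₂, inV, PowerSeries.coeff_C]
  split_ifs <;> simp

theorem coeff₂_mul_inU (s : PowerSeries A) (T : PowerSeries (PowerSeries A)) (m n : ℕ) :
    coeff₂ m n (T * inU s) =
      ∑ p ∈ antidiagonal m, coeff₂ p.1 n T * PowerSeries.coeff p.2 s := by
  simp only [coeff₂, inU, PowerSeries.coeff_mul (n := m), map_sum, PowerSeries.coeff_map,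
    PowerSeries.coeff_mul_C]

theorem coeff₂_inU_mul_inV (s t : PowerSeries A) (m n : ℕ) :
    coeff₂ m n (inU s * inV t) = PowerSeries.coeff m s * PowerSeries.coeff n t := by
  simp [coeff₂, inU, inV]

theorem coeff₂_inV_mul_inU (s t : PowerSeries A) (m n : ℕ) :
    coeff₂ m n (inV s * inU t) = PowerSeries.coeff n s * PowerSeries.coeff m t := by
  simp [coeff₂, inU, inV]

variable [Algebra ℂ A]

theorem coeff₂_smul (c : ℂ) (S : PowerSeries (PowerSeries A)) (m n : ℕ) :
    coeff₂ m n (c • S) = c • coeff₂ m n S := rfl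

theorem coeff₂_diffSeries (F : ℂ → ℂ) (m n : ℕ) :
    coeff₂ m n (diffSeries A F) = algebraMap ℂ A (diffCoeff F m n) := by
  simp [coeff₂, diffSeries, diffCoeff]

theorem coeff₂_diffSeries_mul (F : ℂ → ℂ) (S : PowerSeries (PowerSeries A)) (m n : ℕ) :
    coeff₂ m n (diffSeries A F * S) = ∑ p ∈ antidiagonal m, ∑ q ∈ antidiagonal n,
      diffCoeff F p.1 q.1 • coeff₂ p.2 q.2 S := by
  simp [coeff₂_mul, coeff₂_diffSeries, Algebra.smul_def]

end DiffSeries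

end Taylor

variable {I H : Type*} [Fintype I] [DecidableEq I] [Fintype H]

section DoubleGenerators

/-! ### Products of two one-particle functions -/

namespace ShuffleFun

variable {Q : WeightedQuiver I H} {τ : UpperHalfPlane} {hbar : ℂ}

theorem mul_def (f₁ f₂ : ShuffleFun Q τ hbar) (X : Multiset (I × ℂ)) : (f₁ * f₂) X =
    (X.antidiagonal.map fun p => kernel Q τ hbar p.1 p.2 * (f₁ p.1 * f₂ p.2)).sum := rfl

theorem single_singleton (k : I) (f : ℂ → ℂ) (x : I × ℂ) :
    (single k f : ShuffleFun Q τ hbar) {x} = if x.1 = k then f x.2 else 0 := by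
  simp [single]

theorem single_of_card_ne (k : I) (f : ℂ → ℂ) {X : Multiset (I × ℂ)} (hX : X.card ≠ 1) :
    (single k f : ShuffleFun Q τ hbar) X = 0 := by
  refine Multiset.sum_eq_zero fun c hc => ?_
  obtain ⟨x, -, rfl⟩ := Multiset.mem_map.1 hc
  rw [if_neg]
  rintro ⟨h, -⟩
  exact hX (by rw [h, Multiset.card_singleton])

theorem single_mul_single_of_card_ne (k l : I) (f f' : ℂ → ℂ) {X : Multiset (I × ℂ)}
    (hX : X.card ≠ 2) : (single k f * single l f' : ShuffleFun Q τ hbar) X = 0 := by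
  rw [mul_def]
  refine Multiset.sum_eq_zero fun c hc => ?_
  obtain ⟨p, hp, rfl⟩ := Multiset.mem_map.1 hc
  have h := congrArg Multiset.card (Multiset.mem_antidiagonal.1 hp)
  rw [Multiset.card_add] at h
  by_cases h1 : p.1.card = 1
  · rw [single_of_card_ne l f' (X := p.2) (by omega)]
    ring
  · rw [single_of_card_ne k f h1]
    ring

theorem single_mul_single_pair (k l : I) (f f' : ℂ → ℂ) (x y : I × ℂ) :
    (single k f * single l f' : ShuffleFun Q τ hbar) {x, y} =
      kernel Q τ hbar {x} {y} *
          ((if x.1 = k then f x.2 else 0) * (if y.1 = l then f' y.2 else 0)) +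
        kernel Q τ hbar {y} {x} *
          ((if y.1 = k then f y.2 else 0) * (if x.1 = l then f' x.2 else 0)) := by
  have h0 : ∀ (k : I) f, (single k f : ShuffleFun Q τ hbar) 0 = 0 := fun k f =>
    single_of_card_ne k f (by simp)
  have h2 : ∀ (k : I) f, (single k f : ShuffleFun Q τ hbar) (x ::ₘ {y}) = 0 := fun k f =>
    single_of_card_ne k f (by simp)
  rw [mul_def, Multiset.insert_eq_cons, Multiset.antidiagonal_cons,
    ← Multiset.cons_zero y, Multiset.antidiagonal_cons]
  simp [h0, h2, single_singleton]

theorem single_smul (k : I) (r : ℂ) (f : ℂ → ℂ) :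
    (single k (r • f) : ShuffleFun Q τ hbar) = r • single k f := by
  funext X
  change _ = r * single k f X
  unfold single
  rw [← Multiset.sum_map_mul_left]
  refine congrArg Multiset.sum (Multiset.map_congr rfl fun x _ => ?_)
  simp

theorem pair_mul_apply {i j : I} (hij : i ≠ j) (f f' : ℂ → ℂ) (z w : ℂ) :
    (single i f * single j f' : ShuffleFun Q τ hbar) {(i, z), (j, w)} =
      kernel Q τ hbar {(i, z)} {(j, w)} * (f z * f' w) := by
  rw [single_mul_single_pair]
  simp [hij]

theorem pair_mul_apply_swap {i j : I} (hij : i ≠ j) (f f' : ℂ → ℂ) (z w : ℂ) :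
    (single j f' * single i f : ShuffleFun Q τ hbar) {(i, z), (j, w)} =
      kernel Q τ hbar {(j, w)} {(i, z)} * (f z * f' w) := by
  rw [single_mul_single_pair]
  simp [hij, mul_comm]

-- A product of one-point functions of two different colours is supported on pairs with one point of
-- each colour, so identities between such products need checking only there.
variable (Q τ hbar) in
theorem pair_cases {i j : I} (hij : i ≠ j) (X : Multiset (I × ℂ)) :
    (∃ z w, X = {(i, z), (j, w)}) ∨ ∀ f f' : ℂ → ℂ,
      (single i f * single j f' : ShuffleFun Q τ hbar) X = 0 ∧
        (single j f' * single i f : ShuffleFun Q τ hbar) X = 0 := by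
  by_cases hX : X.card = 2
  · obtain ⟨⟨k, z⟩, ⟨l, w⟩, rfl⟩ := Multiset.card_eq_two.1 hX
    by_cases h1 : k = i ∧ l = j
    · obtain ⟨rfl, rfl⟩ := h1
      exact .inl ⟨z, w, rfl⟩
    by_cases h2 : k = j ∧ l = i
    · obtain ⟨rfl, rfl⟩ := h2
      exact .inl ⟨w, z, Multiset.pair_comm _ _⟩
    right
    intro f f'
    have h3 : k = i → l ≠ j := fun h h' => h1 ⟨h, h'⟩
    have h4 : l = i → k ≠ j := fun h h' => h2 ⟨h', h⟩
    have h5 : l = j → k ≠ i := fun h h' => h1 ⟨h', h⟩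
    have h6 : k = j → l ≠ i := fun h h' => h2 ⟨h, h'⟩
    constructor <;> rw [single_mul_single_pair] <;> split_ifs <;> simp_all
  · exact .inr fun f f' => ⟨single_mul_single_of_card_ne _ _ _ _ hX,
      single_mul_single_of_card_ne _ _ _ _ hX⟩

theorem shuffleSign_singleton (x y : I × ℂ) :
    shuffleSign Q {x} {y} = (-1 : ℂ) ^ (Q.euler y.1 x.1) := by
  have h : ∀ (x : I × ℂ) k, dimVec {x} k = if k = x.1 then 1 else 0 := by
    intro x k
    simp [dimVec, Multiset.count_singleton]
  simp [shuffleSign, h]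

/-- The exchange relation of the kernel for two distinct colours. -/
theorem kernel_exchange (hQ : Q.StandardWeights) {i j : I} (hij : i ≠ j) (z w : ℂ) :
    kernel Q τ hbar {(i, z)} {(j, w)} * theta τ (z - w - Q.cartan i j / 2 * hbar) =
      kernel Q τ hbar {(j, w)} {(i, z)} * theta τ (z - w + Q.cartan i j / 2 * hbar) := by
  set A := (Q.arrows i j).card + (Q.arrows j i).card with hA
  -- The standard weights merge the products over the two directions of arrows into one product over
  -- the progression A, A-2, …, -A+2.
  have hfac₂ : ∀ k l : I, k ≠ l → ∀ z w : ℂ, fac₂ Q τ (hbar / 2) (hbar / 2) (k, z) (l, w) =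
      ∏ p ∈ Finset.range ((Q.arrows k l).card + (Q.arrows l k).card), theta τ (w - z +
        (((Q.arrows k l).card + (Q.arrows l k).card : ℕ) - 2 * (p : ℂ)) * (hbar / 2)) := by
    intro k l hkl z w
    have h := congrArg (fun M : Multiset ℤ =>
      (M.map fun p : ℤ => theta τ (w - z + p * (hbar / 2))).prod) (hQ.2 k l hkl)
    simp only [Multiset.map_add, Multiset.map_map, Multiset.prod_add] at h
    refine Eq.trans h ?_
    rw [Finset.prod, Finset.range_val]
    simp only [Multiset.bind_def, Multiset.pure_def, Multiset.bind_singleton, Multiset.map_map]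
    refine congrArg Multiset.prod (Multiset.map_congr rfl fun p _ => ?_)
    simp
  have hker : ∀ k l : I, k ≠ l → ∀ z w : ℂ, kernel Q τ hbar {(k, z)} {(l, w)} =
      (-1 : ℂ) ^ (Q.arrows l k).card *
      ∏ p ∈ Finset.range ((Q.arrows k l).card + (Q.arrows l k).card), theta τ (w - z +
        (((Q.arrows k l).card + (Q.arrows l k).card : ℕ) - 2 * (p : ℂ)) * (hbar / 2)) := by
    intro k l hkl z w
    rw [kernel, shuffleSign_singleton, fac]
    simp only [Multiset.map_singleton, Multiset.prod_singleton, fac₁, hkl, if_false, one_mul,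
      hfac₂ k l hkl]
    congr 1
    rw [WeightedQuiver.euler, if_neg hkl.symm, zero_sub, zpow_neg, zpow_natCast, ← inv_pow]
    norm_num
  have hcartan : (Q.cartan i j : ℂ) = -(A : ℂ) := by
    simp only [WeightedQuiver.cartan, hij, if_false, hA]
    push_cast
    ring
  rw [hker i j hij, hker j i hij.symm, hcartan, add_comm (Q.arrows j i).card, ← hA]
  -- The extra theta factor is, up to sign, the missing term -A of the progression. The completed
  -- progression A, …, -A is symmetric, so reversing it and using oddness identifies both sides up
  -- to the sign (-1)^(A+1), which the shuffle signs absorb.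
  have h1 : (∏ p ∈ Finset.range A, theta τ (w - z + ((A : ℂ) - 2 * (p : ℂ)) * (hbar / 2))) *
      theta τ (z - w - -(A : ℂ) / 2 * hbar) =
      -∏ p ∈ Finset.range (A + 1), theta τ (w - z + ((A : ℂ) - 2 * (p : ℂ)) * (hbar / 2)) := by
    rw [Finset.prod_range_succ, ← mul_neg, ← theta_neg]
    congr 2
    ring
  have h2 : (∏ p ∈ Finset.range A, theta τ (z - w + ((A : ℂ) - 2 * (p : ℂ)) * (hbar / 2))) *
      theta τ (z - w + -(A : ℂ) / 2 * hbar) = (-1) ^ (A + 1) *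
      ∏ p ∈ Finset.range (A + 1), theta τ (w - z + ((A : ℂ) - 2 * (p : ℂ)) * (hbar / 2)) := by
    have h3 : ∏ p ∈ Finset.range (A + 1), theta τ (z - w + ((A : ℂ) - 2 * (p : ℂ)) * (hbar / 2)) =
        (∏ p ∈ Finset.range A, theta τ (z - w + ((A : ℂ) - 2 * (p : ℂ)) * (hbar / 2))) *
          theta τ (z - w + -(A : ℂ) / 2 * hbar) := by
      rw [Finset.prod_range_succ]
      congr 2
      ring
    rw [← h3, ← Finset.prod_range_reflect]
    rw [show (-1 : ℂ) ^ (A + 1) = ∏ p ∈ Finset.range (A + 1), (-1 : ℂ) by simp,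
      ← Finset.prod_mul_distrib]
    refine Finset.prod_congr rfl fun p hp => ?_
    have hp' : p ≤ A := Nat.lt_succ_iff.1 (Finset.mem_range.1 hp)
    rw [neg_one_mul, ← theta_neg, Nat.add_sub_cancel, Nat.cast_sub hp']
    congr 1
    ring
  rw [mul_assoc, h1, mul_assoc, h2, hA, pow_succ, pow_add]
  have h4 : ((-1 : ℂ) ^ (Q.arrows i j).card) * (-1) ^ (Q.arrows i j).card = 1 := by
    rw [← mul_pow]
    simp
  linear_combination (-1 : ℂ) ^ (Q.arrows j i).card * (∏ p ∈ Finset.range (A + 1),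
    theta τ (w - z + ((A : ℂ) - 2 * (p : ℂ)) * (hbar / 2))) * h4

end ShuffleFun

variable (Q : WeightedQuiver I H) (τ : UpperHalfPlane) (hbar : ℂ)

theorem vertexElt_smul (k : I) (r : ℂ) (f : Mer) :
    vertexElt Q τ hbar k (r • f) = r • vertexElt Q τ hbar k f :=
  congrArg (RingCon.toQuotient (c := ShuffleFun.agreement Q τ hbar))
    (ShuffleFun.single_smul k r f.1)

theorem sphElt_smul (k : I) (r : ℂ) (f : Mer) :
    sphElt Q τ hbar k (r • f) = r • sphElt Q τ hbar k f :=
  Subtype.ext (vertexElt_smul Q τ hbar k r f)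

theorem sphElt_zero (k : I) : sphElt Q τ hbar k 0 = 0 := by
  simpa using sphElt_smul Q τ hbar k 0 0

/-! ### The three subalgebras of the double -/

variable {𝔥 : Type*} [AddCommGroup 𝔥] [Module ℂ 𝔥] (α : I → Module.Dual ℂ 𝔥)

variable {Q τ hbar α} in
theorem Double.rel {x y : FreeDouble Q τ hbar 𝔥} (h : DoubleRel Q τ hbar α x y) :
    RingQuot.mkAlgHom ℂ (DoubleRel Q τ hbar α) x = RingQuot.mkAlgHom ℂ (DoubleRel Q τ hbar α) y :=
  RingQuot.mkAlgHom_rel ℂ h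

/-- `SH^sph → D(SH^sph)` as a homomorphism of algebras. -/
def posHom : SHsph Q τ hbar →ₐ[ℂ] Double Q τ hbar α where
  toFun := pos Q τ hbar α
  map_one' := by
    simpa [pos] using Double.rel (α := α) (DoubleRel.pos_scalar 1)
  map_zero' := by
    simpa [pos] using Double.rel (α := α) (DoubleRel.pos_scalar 0)
  map_mul' a b := by
    simpa [pos] using Double.rel (α := α) (DoubleRel.pos_mul a b)
  map_add' a b := by
    simpa [pos] using Double.rel (α := α) (DoubleRel.pos_add a b)
  commutes' r := by
    simpa [pos] using Double.rel (α := α) (DoubleRel.pos_scalar r)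

/-- `SH^{sph,coop} → D(SH^sph)` as a homomorphism of algebras. -/
def negHom : SHsph Q τ hbar →ₐ[ℂ] Double Q τ hbar α where
  toFun := neg Q τ hbar α
  map_one' := by
    simpa [neg] using Double.rel (α := α) (DoubleRel.neg_scalar 1)
  map_zero' := by
    simpa [neg] using Double.rel (α := α) (DoubleRel.neg_scalar 0)
  map_mul' a b := by
    simpa [neg] using Double.rel (α := α) (DoubleRel.neg_mul a b)
  map_add' a b := by
    simpa [neg] using Double.rel (α := α) (DoubleRel.neg_add a b)
  commutes' r := by
    simpa [neg] using Double.rel (α := α) (DoubleRel.neg_scalar r)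

/-- `SH⁰ → D(SH^sph)` as a homomorphism of algebras. -/
def zerHom : SH0 I 𝔥 →ₐ[ℂ] Double Q τ hbar α where
  toFun := zer Q τ hbar α
  map_one' := by
    simpa [zer] using Double.rel (Q := Q) (τ := τ) (hbar := hbar) (α := α) (DoubleRel.zero_scalar 1)
  map_zero' := by
    simpa [zer] using Double.rel (Q := Q) (τ := τ) (hbar := hbar) (α := α) (DoubleRel.zero_scalar 0)
  map_mul' a b := by
    simpa [zer] using
      Double.rel (Q := Q) (τ := τ) (hbar := hbar) (α := α) (DoubleRel.zero_mul a b)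
  map_add' a b := by
    simpa [zer] using
      Double.rel (Q := Q) (τ := τ) (hbar := hbar) (α := α) (DoubleRel.zero_add a b)
  commutes' r := by
    simpa [zer] using Double.rel (Q := Q) (τ := τ) (hbar := hbar) (α := α) (DoubleRel.zero_scalar r)

/-- The embedding of the positive half for `ε = 1` and of the negative half for `ε = -1`. -/
def halfHom (ε : ℤˣ) : SHsph Q τ hbar →ₐ[ℂ] Double Q τ hbar α :=
  if ε = 1 then posHom Q τ hbar α else negHom Q τ hbar α

theorem zer_commute (c d : SH0 I 𝔥) :
    zer Q τ hbar α c * zer Q τ hbar α d = zer Q τ hbar α d * zer Q τ hbar α c := by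
  have h : zerHom Q τ hbar α (c * d) = zerHom Q τ hbar α (d * c) := by rw [mul_comm]
  rwa [map_mul, map_mul] at h

/-- The sign in Φ⁻(u) = Φ⁺(-u) cancels that of the argument -u, so both summands of Φ_k(u) equal
ϑ(ħ)Φ⁺_k(u). -/
theorem coeff_phi (k : I) (n : ℕ) : PowerSeries.coeff n (phi Q τ hbar α k) =
    (2 * theta τ hbar) • zer Q τ hbar α (phiCoeff 𝔥 k n) := by
  have h : (-1 : ℂ) ^ n * (-1) ^ n = 1 := by
    rw [← mul_pow]
    simp
  simp only [phi, phiPlus, phiMinus, PowerSeries.coeff_mk, smul_smul]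
  rw [← add_smul, h]
  congr 1
  ring

/-- The constant term is 2ϑ(ħ)Φ⁺_{k,0}. Here ϑ(ħ) ≠ 0 since ħ is not a lattice point, and Φ⁺_{k,0}
is inverted in `SH0`. -/
theorem isUnit_phi (hhbar : hbar ∉ periodLattice τ) (k : I) : IsUnit (phi Q τ hbar α k) := by
  rw [PowerSeries.isUnit_iff_constantCoeff, ← PowerSeries.coeff_zero_eq_constantCoeff_apply,
    coeff_phi]
  have h : IsUnit (phiCoeff 𝔥 k 0) := IsLocalization.map_units (SH0 I 𝔥)
    (⟨_, Submonoid.subset_closure ⟨k, rfl⟩⟩ : Submonoid.closure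
      (Set.range fun k : I => (MvPolynomial.X (k, 0) : CartanPoly I 𝔥)))
  have h' : IsUnit (zer Q τ hbar α (phiCoeff 𝔥 k 0)) := h.map (zerHom Q τ hbar α)
  exact h'.smul (Units.mk0 _ (mul_ne_zero two_ne_zero (theta_ne_zero hhbar)))

/-- The function of `z_k` whose image is the coefficient of `u^n` in `𝔛^ε_k(u + s, λ)`. -/
def currentFun (ε : ℤˣ) (lam s : ℂ) (n : ℕ) : Mer :=
  if ε = 1 then gCoeff τ lam s n else -((-1 : ℂ) ^ n • gCoeff τ (-lam) (-s) n)

theorem coeff_current (ε : ℤˣ) (k : I) (lam s : ℂ) (n : ℕ) :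
    PowerSeries.coeff n (current Q τ hbar α ε k lam s) =
      halfHom Q τ hbar α ε (sphElt Q τ hbar k (currentFun τ ε lam s n)) := by
  unfold current halfHom currentFun
  split_ifs
  · rw [currentPos, PowerSeries.coeff_mk]
    rfl
  · rw [currentNeg, PowerSeries.coeff_mk]
    rfl

theorem g_neg_neg (lam z : ℂ) : g τ (-lam) (-z) = -g τ lam z := by
  rw [g, g, ← neg_add, theta_neg, theta_neg, theta_neg, neg_mul_neg, neg_div]

/-- The oddness g_{-λ}(-z) = -g_λ(z) brings both signs into the common form g_λ(u+s-εz), so EQ3 and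
EQ4 are proved once for ε = ±1. -/
theorem currentFun_apply (ε : ℤˣ) (lam s : ℂ) (n : ℕ) (z : ℂ) :
    (currentFun τ ε lam s n).1 z =
      taylorCoeff (fun u => g τ lam (u + (s - ((ε : ℤ) : ℂ) * z))) n 0 := by
  unfold currentFun
  split_ifs with h
  · subst h
    simp [taylorCoeff_comp_add_const, gCoeff]
  · obtain rfl := (Int.units_eq_one_or ε).resolve_left h
    have h1 : (fun u => g τ lam (u + (s - (((-1 : ℤˣ) : ℤ) : ℂ) * z))) =
        fun u => (-1 : ℂ) * g τ (-lam) ((-s - z) - u) := by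
      funext u
      rw [show -s - z - u = -(u + (s - (((-1 : ℤˣ) : ℤ) : ℂ) * z)) by push_cast; ring, g_neg_neg]
      ring
    rw [h1]
    -- The position z may be a pole, so `taylorCoeff_const_mul` does not apply; negation commutes
    -- with iterated derivatives unconditionally.
    have h2 : taylorCoeff (fun u => (-1 : ℂ) * g τ (-lam) ((-s - z) - u)) n 0 =
        (-1) * taylorCoeff (fun u => g τ (-lam) ((-s - z) - u)) n 0 := by
      simp only [taylorCoeff, neg_one_mul, iteratedDeriv_fun_neg, neg_div]
    rw [h2, taylorCoeff_comp_const_sub, sub_zero]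
    change -((-1 : ℂ) ^ n * taylorCoeff (g τ (-lam)) n (-s - z)) = _
    ring

/-- The coefficient of `u^n` in `Φ̂_{k,e_j}(ε u)`. -/
def phiHatSigned (ε : ℤˣ) (k j : I) (n : ℕ) : Mer := ((ε : ℤ) : ℂ) ^ n • phiHat Q τ hbar k j n

theorem phiHatSigned_apply (ε : ℤˣ) (k j : I) (n : ℕ) (z : ℂ) :
    (phiHatSigned Q τ hbar ε k j n).1 z =
      taylorCoeff (fun u => phiFactor Q τ hbar k j (((ε : ℤ) : ℂ) * u - z)) n 0 := by
  change ((ε : ℤ) : ℂ) ^ n * taylorCoeff (phiFactor Q τ hbar k j) n (0 - z) = _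
  rcases Int.units_eq_one_or ε with rfl | rfl
  · simp [sub_eq_add_neg, taylorCoeff_comp_add_const]
  · have h : (fun u => phiFactor Q τ hbar k j ((((-1 : ℤˣ) : ℤ) : ℂ) * u - z)) =
        fun u => phiFactor Q τ hbar k j (-z - u) := by
      funext u
      congr 1
      push_cast
      ring
    rw [h, taylorCoeff_comp_const_sub]
    simp

/-- On the negative half the defining relation concerns Φ⁻(u) = Φ⁺(-u). Replacing u by -u restores
Φ⁺ and moves the sign into the multiplier, which becomes Φ̂(εu). -/
theorem zer_mul_half (ε : ℤˣ) (k j : I) (n : ℕ) (f : Mer) :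
    zer Q τ hbar α (phiCoeff 𝔥 k n) * halfHom Q τ hbar α ε (sphElt Q τ hbar j f) =
      ∑ p ∈ antidiagonal n,
        halfHom Q τ hbar α ε (sphElt Q τ hbar j (f * phiHatSigned Q τ hbar ε k j p.1)) *
          zer Q τ hbar α (phiCoeff 𝔥 k p.2) := by
  rcases Int.units_eq_one_or ε with rfl | rfl
  · have h := Double.rel (DoubleRel.phi_pos (Q := Q) (τ := τ) (hbar := hbar) (α := α) k j n f)
    simp only [map_mul, map_sum] at h
    simpa [phiHatSigned, halfHom] using! h
  · have h := Double.rel (DoubleRel.phi_neg (Q := Q) (τ := τ) (hbar := hbar) (α := α) k j n f)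
    have h1 : (-1 : ℂ) ^ n * (-1) ^ n = 1 := by
      rw [← mul_pow]
      simp
    have h2 : ∀ p ∈ antidiagonal n, ((-1 : ℂ) ^ n * (-1) ^ p.2) = (-1) ^ p.1 := by
      intro p hp
      rw [← Finset.HasAntidiagonal.mem_antidiagonal.1 hp, pow_add, mul_assoc, ← mul_pow]
      simp
    simp only [map_mul, map_smul, map_sum, smul_mul_assoc, mul_smul_comm] at h
    have h3 := congrArg (fun x => (-1 : ℂ) ^ n • x) h
    simp only [smul_smul, h1, one_smul, Finset.smul_sum] at h3
    refine Eq.trans h3 (Finset.sum_congr rfl fun p hp => ?_)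
    rw [h2 p hp, phiHatSigned, mul_smul_comm, sphElt_smul, map_smul, smul_mul_assoc]
    simp [halfHom]
    rfl

end DoubleGenerators

/-! ### Consequences of the three term relation -/

section ThetaIdentities

variable (τ : UpperHalfPlane)

theorem theta_three_term_four (p q r s : ℂ) :
    theta τ p * theta τ q * (theta τ r * theta τ s) +
        theta τ ((p - q + r + s) / 2) * theta τ ((p - q - r - s) / 2) *
          (theta τ ((p + q + r - s) / 2) * theta τ ((p + q - r + s) / 2)) +
      theta τ ((p + q + r + s) / 2) * theta τ ((r + s - p - q) / 2) *
        (theta τ ((p - q + r - s) / 2) * theta τ ((p - q - r + s) / 2)) = 0 := by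
  -- Chosen so that x ± y = p, q and z ± t = r, s: the first product then has four free arguments.
  have h := theta_three_term τ ((p + q) / 2) ((p - q) / 2) ((r + s) / 2) ((r - s) / 2)
  convert h using 3 <;> congr 2 <;> ring_nf

/-- After denominators are cleared this is one three term relation. It is the analytic content of
EQ3, with t = εz_j and b = εa. -/
theorem g_exchange_phiFactor {u v t b lam : ℂ} (h1 : theta τ (u - t - b) ≠ 0)
    (h2 : theta τ (v - t) ≠ 0) (h3 : theta τ lam ≠ 0) (h4 : theta τ (lam + 2 * b) ≠ 0) :
    theta τ (u - v - b) * (theta τ (u - t + b) / theta τ (u - t - b) * g τ lam (v - t)) =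
      theta τ (u - v + b) * g τ (lam + 2 * b) (v - t) +
        theta τ (2 * b) * theta τ (u - v - b - lam) / theta τ lam *
          g τ (lam + 2 * b) (u - b - t) := by
  have h := theta_three_term_four τ (u - v - b) (v - t + lam) (u - t + b) (lam + 2 * b)
  rw [show (u - v - b - (v - t + lam) + (u - t + b) + (lam + 2 * b)) / 2 = u - v + b by ring,
    show (u - v - b - (v - t + lam) - (u - t + b) - (lam + 2 * b)) / 2 =
      -(v - t + (lam + 2 * b)) by ring,
    show (u - v - b + (v - t + lam) + (u - t + b) - (lam + 2 * b)) / 2 = u - t - b by ring,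
    show (u - v - b + (v - t + lam) - (u - t + b) + (lam + 2 * b)) / 2 = lam by ring,
    show (u - v - b + (v - t + lam) + (u - t + b) + (lam + 2 * b)) / 2 =
      u - b - t + (lam + 2 * b) by ring,
    show (u - t + b + (lam + 2 * b) - (u - v - b) - (v - t + lam)) / 2 = 2 * b by ring,
    show (u - v - b - (v - t + lam) + (u - t + b) - (lam + 2 * b)) / 2 = u - v - b - lam by ring,
    show (u - v - b - (v - t + lam) - (u - t + b) + (lam + 2 * b)) / 2 = -(v - t) by ring,
    theta_neg, theta_neg] at h
  simp only [g]
  generalize theta τ (lam + 2 * b) = x₁ at *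
  generalize theta τ (2 * b) = x₂ at *
  generalize theta τ (v - t + (lam + 2 * b)) = x₃ at *
  generalize theta τ (u - b - t + (lam + 2 * b)) = x₄ at *
  rw [show u - b - t = u - t - b by ring]
  field_simp
  linear_combination h

/-- With V = v-t and X = u+l-t this merges the two terms of EQ4 that share the factor g_{l+b}(u-s).
The result contains ϑ(l-b)ϑ(u-v+l), which is the coefficient of the third term. -/
theorem theta_combine_left (l b V X : ℂ) :
    theta τ (2 * l) * theta τ (X - l - V - b) * theta τ (V + (l - b)) * theta τ X -
        theta τ (l + b) * theta τ (X - l - V - l) * theta τ (X + (l - b)) * theta τ V =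
      theta τ (l - b) * theta τ (X - l - V + l) * theta τ (X - l - b) * theta τ (V + 2 * l) := by
  have h := theta_three_term_four τ (2 * l) (X - l - V - b) (V + (l - b)) X
  rw [show (2 * l - (X - l - V - b) + (V + (l - b)) + X) / 2 = V + 2 * l by ring,
    show (2 * l - (X - l - V - b) - (V + (l - b)) - X) / 2 = -(X - l - b) by ring,
    show (2 * l + (X - l - V - b) + (V + (l - b)) - X) / 2 = l - b by ring,
    show (2 * l + (X - l - V - b) - (V + (l - b)) + X) / 2 = X - l - V + l by ring,
    show (2 * l + (X - l - V - b) + (V + (l - b)) + X) / 2 = X + (l - b) by ring,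
    show (V + (l - b) + X - 2 * l - (X - l - V - b)) / 2 = V by ring,
    show (2 * l - (X - l - V - b) + (V + (l - b)) - X) / 2 = -(X - l - V - l) by ring,
    show (2 * l - (X - l - V - b) - (V + (l - b)) + X) / 2 = l + b by ring,
    theta_neg, theta_neg] at h
  linear_combination h

/-- The left side is antisymmetric in b. The factor ϑ(2b)ϑ(w-l) on the right does not involve U,
which lets the instances U = u-s and U = v+l-s cancel in `g_exchange`. -/
theorem theta_antisymmetrize (l b w U : ℂ) :
    theta τ (w + b) * theta τ (l - b) * theta τ (U + (l + b)) * theta τ (U + w - b) -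
        theta τ (w - b) * theta τ (l + b) * theta τ (U + (l - b)) * theta τ (U + w + b) =
      -(theta τ (2 * b) * theta τ (w - l) * theta τ U * theta τ (U + w + l)) := by
  have h := theta_three_term_four τ (w + b) (l - b) (U + (l + b)) (U + w - b)
  rw [show (w + b - (l - b) + (U + (l + b)) + (U + w - b)) / 2 = U + w + b by ring,
    show (w + b - (l - b) - (U + (l + b)) - (U + w - b)) / 2 = -(U + (l - b)) by ring,
    show (w + b + (l - b) + (U + (l + b)) - (U + w - b)) / 2 = l + b by ring,
    show (w + b + (l - b) - (U + (l + b)) + (U + w - b)) / 2 = w - b by ring,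
    show (w + b + (l - b) + (U + (l + b)) + (U + w - b)) / 2 = U + w + l by ring,
    show (U + (l + b) + (U + w - b) - (w + b) - (l - b)) / 2 = U by ring,
    show (w + b - (l - b) + (U + (l + b)) - (U + w - b)) / 2 = 2 * b by ring,
    show (w + b - (l - b) - (U + (l + b)) + (U + w - b)) / 2 = w - l by ring,
    theta_neg] at h
  linear_combination h

/-- This is EQ4 for functions: s and t are the signed positions of the two points, and ϑ(s-t±b) come
from the exchange of kernels. `theta_combine_left` at b and at -b merges two terms on each side;
what remains is two antisymmetrizations in b, and these cancel each other. -/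
theorem g_exchange {u v s t b l : ℂ} (h1 : theta τ (u - s) ≠ 0) (h2 : theta τ (v - t) ≠ 0)
    (h3 : theta τ (u + l - t) ≠ 0) (h4 : theta τ (v + l - s) ≠ 0) (h5 : theta τ (l + b) ≠ 0)
    (h6 : theta τ (l - b) ≠ 0) :
    theta τ (s - t + b) *
        (theta τ (2 * l) * theta τ (u - v - b) * (g τ (l + b) (u - s) * g τ (l - b) (v - t)) -
          theta τ (l + b) * theta τ (u - v - l) *
            (g τ (l + b) (u - s) * g τ (l - b) (u + l - t)) -
          theta τ (l - b) * theta τ (u - v + l) *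
            (g τ (l + b) (v + l - s) * g τ (l - b) (v - t))) =
      theta τ (s - t - b) *
        (theta τ (2 * l) * theta τ (u - v + b) * (g τ (l - b) (u - s) * g τ (l + b) (v - t)) -
          theta τ (l - b) * theta τ (u - v - l) *
            (g τ (l - b) (u - s) * g τ (l + b) (u + l - t)) -
          theta τ (l + b) * theta τ (u - v + l) *
            (g τ (l - b) (v + l - s) * g τ (l + b) (v - t))) := by
  have e1 := theta_combine_left τ l b (v - t) (u + l - t)
  have e2 := theta_combine_left τ l (-b) (v - t) (u + l - t)
  have e3 := theta_antisymmetrize τ l b (s - t) (u - s)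
  have e4 := theta_antisymmetrize τ l b (s - t) (v + l - s)
  rw [sub_neg_eq_add, sub_neg_eq_add, sub_neg_eq_add, ← sub_eq_add_neg] at e2
  rw [show u + l - t - l - (v - t) = u - v by ring,
    show u + l - t - l = u - s + (s - t) by ring] at e1 e2
  rw [show u - s + (s - t) + l = u + l - t by ring] at e3
  rw [show v + l - s + (s - t) = v - t + l by ring, show v - t + l + l = v - t + 2 * l by ring,
    show v - t + l - b = v - t + (l - b) by ring, show v - t + l + b = v - t + (l + b) by ring]
    at e4
  simp only [g]
  generalize theta τ (s - t + b) = wp at *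
  generalize theta τ (s - t - b) = wm at *
  generalize theta τ (u - s) = tU at *
  generalize theta τ (v - t) = tV at *
  generalize theta τ (u + l - t) = tX at *
  generalize theta τ (v + l - s) = tY at *
  generalize theta τ (l + b) = lp at *
  generalize theta τ (l - b) = lm at *
  generalize theta τ (u - v + l) = dl at *
  generalize theta τ (v - t + 2 * l) = v2 at *
  generalize theta τ (u - s + (l + b)) = up at *
  generalize theta τ (u - s + (l - b)) = um at *
  field_simp
  linear_combination wp * up * tY * e1 - wm * um * tY * e2 + dl * v2 * tY * e3 -
    dl * tU * tX * e4

end ThetaIdentities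

/-! ### Series represented by functions -/

section Represents

variable {Q : WeightedQuiver I H} {τ : UpperHalfPlane} {hbar : ℂ}
  {𝔥 : Type*} [AddCommGroup 𝔥] [Module ℂ 𝔥] {α : I → Module.Dual ℂ 𝔥}

/-- The coefficients of `S` are the images of those of the expansion of `G` at `u = v = 0`, for
configurations which avoid `C`. -/
def Represents (ε : ℤˣ) (C : Set ℂ) (S : PowerSeries (PowerSeries (Double Q τ hbar α)))
    (G : Multiset (I × ℂ) → ℂ → ℂ → ℂ) : Prop :=
  ∃ (c : ℕ → ℕ → SHsph Q τ hbar) (r : ℕ → ℕ → ShuffleFun Q τ hbar),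
    (∀ m n, coeff₂ m n S = halfHom Q τ hbar α ε (c m n)) ∧
    (∀ m n, RingCon.mkₐ ℂ (ShuffleFun.agreement Q τ hbar) (r m n) = (c m n).1) ∧
    ∀ X, ShuffleFun.Avoids C X → TaylorExpandable (G X) ∧ ∀ m n, r m n X = taylorCoeff₂ (G X) m n

/-- The coefficients of `S` are the images of those of the expansion of `φ` at `u = v = 0`, as
functions of one variable of colour `k`. -/
def RepresentsSingle (ε : ℤˣ) (C : Set ℂ) (k : I)
    (S : PowerSeries (PowerSeries (Double Q τ hbar α))) (φ : ℂ → ℂ → ℂ → ℂ) : Prop :=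
  ∃ f : ℕ → ℕ → Mer, (∀ m n, coeff₂ m n S = halfHom Q τ hbar α ε (sphElt Q τ hbar k (f m n))) ∧
    ∀ z ∉ C, TaylorExpandable (φ z) ∧ ∀ m n, (f m n).1 z = taylorCoeff₂ (φ z) m n

variable {ε : ℤˣ} {C : Set ℂ} {S T : PowerSeries (PowerSeries (Double Q τ hbar α))}
  {G K : Multiset (I × ℂ) → ℂ → ℂ → ℂ}

/-- Vanishing off countably many hyperplanes means being zero in the quotient by
`ShuffleFun.agreement`. Only this direction is needed, so injectivity of the maps into the double
plays no role. -/
theorem Represents.eq_zero (h : Represents ε C S G) (hC : C.Countable)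
    (h0 : ∀ X, ShuffleFun.Avoids C X → ∀ᶠ u in 𝓝 0, ∀ᶠ v in 𝓝 0, G X u v = 0) : S = 0 := by
  obtain ⟨c, r, h1, h2, h3⟩ := h
  refine ext_coeff₂ fun m n => ?_
  have h4 : c m n = 0 := by
    refine Subtype.ext ((h2 m n).symm.trans ?_)
    refine (RingCon.eq (c := ShuffleFun.agreement Q τ hbar) (b := 0)).2 ⟨C, hC, fun X hX => ?_⟩
    rw [(h3 X hX).2, taylorCoeff₂_congr (h0 X hX), taylorCoeff₂_zero]
    rfl
  rw [h1, h4, map_zero]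
  simp [coeff₂]

theorem Represents.add (hS : Represents ε C S G) (hT : Represents ε C T K) :
    Represents ε C (S + T) fun X u v => G X u v + K X u v := by
  obtain ⟨c, r, h1, h2, h3⟩ := hS
  obtain ⟨c', r', h1', h2', h3'⟩ := hT
  refine ⟨fun m n => c m n + c' m n, fun m n => r m n + r' m n, fun m n => ?_, fun m n => ?_,
    fun X hX => ⟨(h3 X hX).1.add (h3' X hX).1, fun m n => ?_⟩⟩
  · rw [coeff₂_add, h1, h1', map_add]
  · rw [map_add, h2, h2']
    rfl
  · rw [taylorCoeff₂_add (h3 X hX).1 (h3' X hX).1, ← (h3 X hX).2, ← (h3' X hX).2]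
    rfl

theorem Represents.smul (hS : Represents ε C S G) (a : ℂ) :
    Represents ε C (a • S) fun X u v => a * G X u v := by
  obtain ⟨c, r, h1, h2, h3⟩ := hS
  refine ⟨fun m n => a • c m n, fun m n => a • r m n, fun m n => ?_, fun m n => ?_,
    fun X hX => ⟨(h3 X hX).1.const_mul a, fun m n => ?_⟩⟩
  · rw [coeff₂_smul, h1, map_smul]
  · rw [map_smul, h2]
    rfl
  · rw [taylorCoeff₂_const_mul (h3 X hX).1, ← (h3 X hX).2]
    rfl

theorem Represents.sub (hS : Represents ε C S G) (hT : Represents ε C T K) :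
    Represents ε C (S - T) fun X u v => G X u v - K X u v := by
  have h := hS.add (hT.smul (-1))
  simpa only [neg_smul, one_smul, neg_one_mul, ← sub_eq_add_neg] using h

theorem ShuffleFun.sum_apply {ι : Type*} (s : Finset ι) (f : ι → ShuffleFun Q τ hbar)
    (X : Multiset (I × ℂ)) : (∑ i ∈ s, f i) X = ∑ i ∈ s, f i X := by
  classical
  induction s using Finset.induction_on with
  | empty => rfl
  | insert a s ha ih =>
    rw [Finset.sum_insert ha, Finset.sum_insert ha, ← ih]
    rfl

theorem Represents.diff_mul (hS : Represents ε C S G) {F : ℂ → ℂ} (hF : AnalyticAt ℂ F 0) :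
    Represents ε C (diffSeries _ F * S) fun X u v => F (u - v) * G X u v := by
  obtain ⟨c, r, h1, h2, h3⟩ := hS
  refine ⟨fun m n => ∑ p ∈ antidiagonal m, ∑ q ∈ antidiagonal n,
      diffCoeff F p.1 q.1 • c p.2 q.2,
    fun m n => ∑ p ∈ antidiagonal m, ∑ q ∈ antidiagonal n, diffCoeff F p.1 q.1 • r p.2 q.2,
    fun m n => ?_, fun m n => ?_,
    fun X hX => ⟨(taylorExpandable_diff hF).mul (h3 X hX).1, fun m n => ?_⟩⟩
  · simp only [coeff₂_diffSeries_mul, h1, map_sum, map_smul]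
  · simp only [map_sum, map_smul, h2, AddSubmonoidClass.coe_finsetSum, Subalgebra.coe_smul]
  · rw [taylorCoeff₂_mul (taylorExpandable_diff hF) (h3 X hX).1]
    simp only [ShuffleFun.sum_apply, taylorCoeff₂_diff hF, ← (h3 X hX).2]
    rfl

variable {φ ψ : ℂ → ℂ → ℂ → ℂ} {i j k : I}

theorem taylorExpandable_zero : TaylorExpandable fun _ _ => 0 :=
  ⟨.of_forall fun _ => analyticAt_const, fun n => by
    simpa only [taylorCoeff_zero] using analyticAt_const⟩

theorem RepresentsSingle.represents (hS : RepresentsSingle ε C k S φ) :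
    Represents ε C S fun X u v =>
      (ShuffleFun.single k (fun z => φ z u v) : ShuffleFun Q τ hbar) X := by
  obtain ⟨f, h1, h2⟩ := hS
  refine ⟨fun m n => sphElt Q τ hbar k (f m n), fun m n => ShuffleFun.single k (f m n).1, h1,
    fun m n => rfl, fun X hX => ?_⟩
  by_cases hcard : X.card = 1
  · obtain ⟨x, rfl⟩ := Multiset.card_eq_one.1 hcard
    have hx := hX.1 x (Multiset.mem_singleton_self x)
    simp only [ShuffleFun.single_singleton]
    split_ifs
    · exact h2 _ hx
    · exact ⟨taylorExpandable_zero, fun m n => (taylorCoeff₂_zero m n).symm⟩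
  · simp only [ShuffleFun.single_of_card_ne k _ hcard]
    exact ⟨taylorExpandable_zero, fun m n => (taylorCoeff₂_zero m n).symm⟩

/-- At a pair of points of colours i and j only one splitting contributes. The kernel depends on the
positions alone, so it is a constant for the expansion in u and v. -/
theorem RepresentsSingle.mul (hij : i ≠ j) (hS : RepresentsSingle ε C i S φ)
    (hT : RepresentsSingle ε C j T ψ) :
    Represents ε C (S * T) fun X u v => (ShuffleFun.single i (fun z => φ z u v) *
      ShuffleFun.single j (fun z => ψ z u v) : ShuffleFun Q τ hbar) X := by
  obtain ⟨f, h1, h2⟩ := hS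
  obtain ⟨f', h1', h2'⟩ := hT
  refine ⟨fun m n => ∑ p ∈ antidiagonal m, ∑ q ∈ antidiagonal n,
      sphElt Q τ hbar i (f p.1 q.1) * sphElt Q τ hbar j (f' p.2 q.2),
    fun m n => ∑ p ∈ antidiagonal m, ∑ q ∈ antidiagonal n,
      ShuffleFun.single i (f p.1 q.1).1 * ShuffleFun.single j (f' p.2 q.2).1,
    fun m n => ?_, fun m n => ?_, fun X hX => ?_⟩
  · simp only [coeff₂_mul, h1, h1', map_sum, map_mul]
  · simp only [map_sum, map_mul, AddSubmonoidClass.coe_finsetSum, Subalgebra.coe_mul]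
    rfl
  · rcases ShuffleFun.pair_cases Q τ hbar hij X with ⟨z, w, rfl⟩ | h
    · have hz := h2 z (hX.1 (i, z) (by simp))
      have hw := h2' w (hX.1 (j, w) (by simp))
      simp only [ShuffleFun.pair_mul_apply hij, ShuffleFun.sum_apply]
      refine ⟨(hz.1.mul hw.1).const_mul _, fun m n => ?_⟩
      rw [taylorCoeff₂_const_mul (hz.1.mul hw.1), taylorCoeff₂_mul hz.1 hw.1]
      simp only [hz.2, hw.2, Finset.mul_sum]
    · simp only [ShuffleFun.sum_apply, (h _ _).1, Finset.sum_const_zero]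
      exact ⟨taylorExpandable_zero, fun m n => (taylorCoeff₂_zero m n).symm⟩

/-! ### Generic positions, away from the poles of the currents -/

variable (τ) in
/-- The set of points at which one of the theta functions `ϑ(z - s)`, `s ∈ S`, vanishes. -/
def latticeTranslates (s : Set ℂ) : Set ℂ := {z | ∃ c ∈ s, z - c ∈ periodLattice τ}

theorem countable_latticeTranslates {s : Set ℂ} (hs : s.Countable) :
    (latticeTranslates τ s).Countable := by
  have h : latticeTranslates τ s = ⋃ c ∈ s, (fun z => z + c) '' periodLattice τ := by
    ext z
    simp [latticeTranslates, ← sub_eq_add_neg]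
  rw [h]
  exact hs.biUnion fun c _ => (countable_periodLattice τ).image _

/-- Both c and -c are required in s because for ε = -1 the argument is c+z, whose zeros lie at
translates of -c. -/
theorem theta_sub_ne_zero {s : Set ℂ} {z c : ℂ} (hz : z ∉ latticeTranslates τ s) (hc : c ∈ s)
    (hc' : -c ∈ s) (ε : ℤˣ) : theta τ (c - ((ε : ℤ) : ℂ) * z) ≠ 0 := by
  rcases Int.units_eq_one_or ε with rfl | rfl
  · refine theta_ne_zero fun h => hz ⟨c, hc, ?_⟩
    simpa using neg_mem_periodLattice h
  · refine theta_ne_zero fun h => hz ⟨-c, hc', ?_⟩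
    simpa [add_comm] using h

theorem analyticAt_theta (z : ℂ) : AnalyticAt ℂ (theta τ) z := (differentiable_theta τ).analyticAt z

theorem analyticAt_g {lam z : ℂ} (hlam : theta τ lam ≠ 0) (hz : theta τ z ≠ 0) :
    AnalyticAt ℂ (g τ lam) z :=
  (AnalyticAt.comp (g := theta τ) (analyticAt_theta _) (by fun_prop)).div
    ((analyticAt_theta z).mul analyticAt_const) (mul_ne_zero hz hlam)

theorem analyticAt_g_shift {lam c : ℂ} (hlam : theta τ lam ≠ 0) (hc : theta τ c ≠ 0) :
    AnalyticAt ℂ (fun u => g τ lam (u + c)) 0 :=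
  AnalyticAt.comp (g := g τ lam) (analyticAt_g hlam (by simpa using hc)) (by fun_prop)

theorem representsSingle_inU {s : Set ℂ} {lam c : ℂ} (hlam : theta τ lam ≠ 0) (hc : c ∈ s)
    (hc' : -c ∈ s) (k : I) : RepresentsSingle ε (latticeTranslates τ s) k
      (inU (current Q τ hbar α ε k lam c))
      fun z u _ => g τ lam (u + (c - ((ε : ℤ) : ℂ) * z)) := by
  refine ⟨fun m n => if n = 0 then currentFun τ ε lam c m else 0, fun m n => ?_, fun z hz => ?_⟩
  · rw [coeff₂_inU]
    dsimp only
    split_ifs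
    · exact coeff_current ..
    · rw [sphElt_zero, map_zero]
  · have h1 := analyticAt_g_shift hlam (theta_sub_ne_zero hz hc hc' ε)
    have h2 := taylorExpandable_prod h1 (k := fun _ => 1) analyticAt_const
    have h3 := taylorCoeff₂_prod h1 (k := fun _ => 1) analyticAt_const
    simp only [mul_one] at h2 h3
    refine ⟨h2, fun m n => ?_⟩
    rw [h3, taylorCoeff_const]
    dsimp only
    split_ifs
    · rw [mul_one, currentFun_apply]
    · rw [mul_zero]
      rfl

theorem representsSingle_inV {s : Set ℂ} {lam c : ℂ} (hlam : theta τ lam ≠ 0) (hc : c ∈ s)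
    (hc' : -c ∈ s) (k : I) : RepresentsSingle ε (latticeTranslates τ s) k
      (inV (current Q τ hbar α ε k lam c))
      fun z _ v => g τ lam (v + (c - ((ε : ℤ) : ℂ) * z)) := by
  refine ⟨fun m n => if m = 0 then currentFun τ ε lam c n else 0, fun m n => ?_, fun z hz => ?_⟩
  · rw [coeff₂_inV]
    dsimp only
    split_ifs
    · exact coeff_current ..
    · rw [sphElt_zero, map_zero]
  · have h1 := analyticAt_g_shift hlam (theta_sub_ne_zero hz hc hc' ε)
    have h2 := taylorExpandable_prod (f := fun _ => 1) analyticAt_const h1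
    have h3 := taylorCoeff₂_prod (f := fun _ => 1) analyticAt_const h1
    simp only [one_mul] at h2 h3
    refine ⟨h2, fun m n => ?_⟩
    rw [h3, taylorCoeff_const]
    dsimp only
    split_ifs
    · rw [one_mul, currentFun_apply]
    · rw [zero_mul]
      rfl

theorem eventually_theta_add_ne_zero {c : ℂ} (hc : theta τ c ≠ 0) :
    ∀ᶠ u in 𝓝 (0 : ℂ), theta τ (u + c) ≠ 0 := by
  have h : ContinuousAt (fun u : ℂ => theta τ (u + c)) 0 :=
    ((differentiable_theta τ).continuous.comp (continuous_add_const c)).continuousAt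
  exact h.eventually_ne (by simpa using hc)

end Represents

section Relations

variable {Q : WeightedQuiver I H} {τ : UpperHalfPlane} {hbar : ℂ}
  {𝔥 : Type*} [AddCommGroup 𝔥] [Module ℂ 𝔥] {α : I → Module.Dual ℂ 𝔥}

/-! ### The relations between the Cartan part and the currents -/

theorem phi_commute (i j : I) :
    inU (phi Q τ hbar α i) * inV (phi Q τ hbar α j) =
      inV (phi Q τ hbar α j) * inU (phi Q τ hbar α i) := by
  refine ext_coeff₂ fun m n => ?_
  simp only [coeff₂_inU_mul_inV, coeff₂_inV_mul_inU, coeff_phi, smul_mul_assoc, mul_smul_comm]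
  rw [zer_commute]

theorem cartan_commute_phi (h : 𝔥) (i : I) :
    const (zer Q τ hbar α (cartanElt h)) * phi Q τ hbar α i =
      phi Q τ hbar α i * const (zer Q τ hbar α (cartanElt h)) := by
  refine PowerSeries.ext fun n => ?_
  rw [const, PowerSeries.coeff_C_mul, PowerSeries.coeff_mul_C, coeff_phi, smul_mul_assoc,
    mul_smul_comm, zer_commute]

theorem cartan_mul_half (ε : ℤˣ) (h : 𝔥) (j : I) (f : Mer) :
    zer Q τ hbar α (cartanElt h) * halfHom Q τ hbar α ε (sphElt Q τ hbar j f) -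
        halfHom Q τ hbar α ε (sphElt Q τ hbar j f) * zer Q τ hbar α (cartanElt h) =
      (((ε : ℤ) : ℂ) * α j h) • halfHom Q τ hbar α ε (sphElt Q τ hbar j f) := by
  rcases Int.units_eq_one_or ε with rfl | rfl
  · have h1 := Double.rel (DoubleRel.weight_pos (Q := Q) (τ := τ) (hbar := hbar) (α := α) h j f)
    simp only [map_mul, map_add, map_smul] at h1
    rw [sub_eq_iff_eq_add']
    simpa [halfHom] using! h1
  · have h1 := Double.rel (DoubleRel.weight_neg (Q := Q) (τ := τ) (hbar := hbar) (α := α) h j f)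
    simp only [map_mul, map_sub, map_smul] at h1
    rw [sub_eq_iff_eq_add']
    refine Eq.trans h1 ((sub_eq_add_neg _ _).trans (congrArg _ ?_))
    rw [show ((((-1 : ℤˣ) : ℤ) : ℂ) * α j h) = -α j h by simp]
    exact (neg_smul (α j h) (negHom Q τ hbar α (sphElt Q τ hbar j f))).symm

theorem cartan_current (ε : ℤˣ) (h : 𝔥) (i : I) (lam s : ℂ) :
    const (zer Q τ hbar α (cartanElt h)) * current Q τ hbar α ε i lam s -
        current Q τ hbar α ε i lam s * const (zer Q τ hbar α (cartanElt h)) =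
      (((ε : ℤ) : ℂ) * α i h) • current Q τ hbar α ε i lam s := by
  refine PowerSeries.ext fun n => ?_
  rw [const, map_sub, PowerSeries.coeff_C_mul, PowerSeries.coeff_mul_C, coeff_current,
    cartan_mul_half, ← coeff_current]
  rfl

variable (Q τ hbar α) in
/-- The series `Φ_i(u) 𝔛_j^ε(v, λ) Φ_i(u)⁻¹`. -/
def conjugatedCurrent (ε : ℤˣ) (i j : I) (lam : ℂ) : PowerSeries (PowerSeries (Double Q τ hbar α)) :=
  PowerSeries.mk fun m => PowerSeries.mk fun n => halfHom Q τ hbar α ε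
    (sphElt Q τ hbar j (currentFun τ ε lam 0 n * phiHatSigned Q τ hbar ε i j m))

theorem phi_mul_current (ε : ℤˣ) (i j : I) (lam : ℂ) :
    inU (phi Q τ hbar α i) * inV (current Q τ hbar α ε j lam 0) =
      conjugatedCurrent Q τ hbar α ε i j lam * inU (phi Q τ hbar α i) := by
  refine ext_coeff₂ fun m n => ?_
  rw [coeff₂_inU_mul_inV, coeff₂_mul_inU, coeff_phi, coeff_current, smul_mul_assoc, zer_mul_half,
    Finset.smul_sum]
  refine Finset.sum_congr rfl fun p _ => ?_
  rw [coeff_phi, mul_smul_comm]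
  simp [coeff₂, conjugatedCurrent]

theorem phi_conj_current (hhbar : hbar ∉ periodLattice τ) (ε : ℤˣ) (i j : I) (lam : ℂ) :
    inU (phi Q τ hbar α i) * inV (current Q τ hbar α ε j lam 0) *
        inU (Ring.inverse (phi Q τ hbar α i)) =
      conjugatedCurrent Q τ hbar α ε i j lam := by
  have h : inU (phi Q τ hbar α i) * inU (Ring.inverse (phi Q τ hbar α i)) = 1 := by
    rw [inU, inU, ← map_mul, Ring.mul_inverse_cancel _ (isUnit_phi Q τ hbar α hhbar i), map_one]
  rw [phi_mul_current, mul_assoc, h, mul_one]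

theorem phiFactor_signed (ε : ℤˣ) (i j : I) (u z : ℂ) :
    phiFactor Q τ hbar i j (((ε : ℤ) : ℂ) * u - z) =
      theta τ (u - ((ε : ℤ) : ℂ) * z + ((ε : ℤ) : ℂ) * (Q.cartan i j / 2 * hbar)) /
        theta τ (u - ((ε : ℤ) : ℂ) * z - ((ε : ℤ) : ℂ) * (Q.cartan i j / 2 * hbar)) := by
  rw [phiFactor]
  rcases Int.units_eq_one_or ε with rfl | rfl
  · congr 2 <;> push_cast <;> ring
  · rw [← neg_div_neg_eq, ← theta_neg, ← theta_neg]
    congr 2 <;> push_cast <;> ring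

theorem representsSingle_conjugatedCurrent {s : Set ℂ} {lam : ℂ} (hlam : theta τ lam ≠ 0)
    (ε : ℤˣ) (i j : I) (h0 : 0 ∈ s) (h1 : ((ε : ℤ) : ℂ) * (Q.cartan i j / 2 * hbar) ∈ s)
    (h2 : -(((ε : ℤ) : ℂ) * (Q.cartan i j / 2 * hbar)) ∈ s) :
    RepresentsSingle ε (latticeTranslates τ s) j (conjugatedCurrent Q τ hbar α ε i j lam)
      fun z u v => theta τ (u - ((ε : ℤ) : ℂ) * z + ((ε : ℤ) : ℂ) * (Q.cartan i j / 2 * hbar)) /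
        theta τ (u - ((ε : ℤ) : ℂ) * z - ((ε : ℤ) : ℂ) * (Q.cartan i j / 2 * hbar)) *
          g τ lam (v + (0 - ((ε : ℤ) : ℂ) * z)) := by
  refine ⟨fun m n => currentFun τ ε lam 0 n * phiHatSigned Q τ hbar ε i j m, fun m n => ?_,
    fun z hz => ?_⟩
  · simp [coeff₂, conjugatedCurrent]
  · have e1 := analyticAt_g_shift hlam (theta_sub_ne_zero hz h0 (by simpa using h0) ε)
    have e2 := theta_sub_ne_zero hz h2 (by simpa using h1) ε
    have e3 : AnalyticAt ℂ (fun u => theta τ (u - ((ε : ℤ) : ℂ) * z +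
        ((ε : ℤ) : ℂ) * (Q.cartan i j / 2 * hbar)) /
        theta τ (u - ((ε : ℤ) : ℂ) * z - ((ε : ℤ) : ℂ) * (Q.cartan i j / 2 * hbar))) 0 := by
      refine (AnalyticAt.comp (g := theta τ) (analyticAt_theta _) (by fun_prop)).div
        (AnalyticAt.comp (g := theta τ) (analyticAt_theta _) (by fun_prop)) ?_
      convert e2 using 2
      ring
    refine ⟨taylorExpandable_prod e3 e1, fun m n => ?_⟩
    rw [taylorCoeff₂_prod e3 e1]
    change (currentFun τ ε lam 0 n).1 z * (phiHatSigned Q τ hbar ε i j m).1 z = _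
    rw [currentFun_apply, phiHatSigned_apply, mul_comm]
    simp only [phiFactor_signed]

theorem analyticAt_theta_sub (b : ℂ) : AnalyticAt ℂ (fun w => theta τ (w - b)) 0 :=
  AnalyticAt.comp (g := theta τ) (analyticAt_theta _) (by fun_prop)

theorem analyticAt_theta_add (b : ℂ) : AnalyticAt ℂ (fun w => theta τ (w + b)) 0 :=
  AnalyticAt.comp (g := theta τ) (analyticAt_theta _) (by fun_prop)

/-- All terms are one-point functions of colour j, so `Represents.eq_zero` reduces the claim to
`g_exchange_phiFactor` at a single point. -/
theorem phi_current_exchange (hhbar : hbar ∉ periodLattice τ) (ε : ℤˣ) (i j : I)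
    {lam lam' a e : ℂ} (ha : a = Q.cartan i j / 2 * hbar) (he : e = ((ε : ℤ) : ℂ))
    (hlam' : lam' = lam + 2 * (e * a)) (h1 : lam ∉ periodLattice τ) (h2 : lam' ∉ periodLattice τ) :
    diffSeries (Double Q τ hbar α) (fun w => theta τ (w - e * a)) *
        (inU (phi Q τ hbar α i) * inV (current Q τ hbar α ε j lam 0) *
          inU (Ring.inverse (phi Q τ hbar α i))) =
      diffSeries (Double Q τ hbar α) (fun w => theta τ (w + e * a)) *
          inV (current Q τ hbar α ε j lam' 0) +
        e • (diffSeries (Double Q τ hbar α) (fun w =>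
            theta τ (2 * a) * theta τ (w - e * a - lam) / theta τ lam) *
          inU (current Q τ hbar α ε j lam' (-(e * a)))) := by
  have t1 := theta_ne_zero h1
  have t2 := theta_ne_zero h2
  set b := e * a with hb
  let s : Set ℂ := {0, b, -b}
  have s0 : (0 : ℂ) ∈ s := by simp [s]
  have s1 : b ∈ s := by simp [s]
  have s2 : -b ∈ s := by simp [s]
  have hF : AnalyticAt ℂ (fun w => theta τ (2 * a) * theta τ (w - b - lam) / theta τ lam) 0 := by
    have := analyticAt_theta_sub (τ := τ) (b + lam)
    simp only [← sub_sub] at this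
    exact (analyticAt_const.mul this).div analyticAt_const t1
  rw [phi_conj_current hhbar, ← sub_eq_zero]
  have hb' : ((ε : ℤ) : ℂ) * (Q.cartan i j / 2 * hbar) = b := by rw [hb, ha, he]
  have r0 := representsSingle_conjugatedCurrent (α := α) t1 ε i j s0 (hb' ▸ s1) (hb' ▸ s2)
  have r1 := representsSingle_inV (Q := Q) (hbar := hbar) (α := α) (ε := ε) t2 s0
    (by simpa using s0) j
  have r2 := representsSingle_inU (Q := Q) (hbar := hbar) (α := α) (ε := ε) t2 s2
    (by simpa using s1) j
  have r := (r0.represents.diff_mul (analyticAt_theta_sub (τ := τ) b)).sub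
    ((r1.represents.diff_mul (analyticAt_theta_add (τ := τ) b)).add ((r2.represents.diff_mul hF).smul e))
  refine r.eq_zero (countable_latticeTranslates (by simp [s])) fun X hX => ?_
  by_cases hcard : X.card = 1
  swap
  · simp only [ShuffleFun.single_of_card_ne j _ hcard]
    simp
  obtain ⟨x, rfl⟩ := Multiset.card_eq_one.1 hcard
  have hx := hX.1 x (Multiset.mem_singleton_self x)
  simp only [ShuffleFun.single_singleton]
  split_ifs with hxj
  swap
  · simp
  filter_upwards [eventually_theta_add_ne_zero (theta_sub_ne_zero hx s2 (by simpa using s1) ε)]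
    with u hu
  filter_upwards [eventually_theta_add_ne_zero (theta_sub_ne_zero hx s0 (by simpa using s0) ε)]
    with v hv
  have key := g_exchange_phiFactor τ (u := u) (v := v) (t := ((ε : ℤ) : ℂ) * x.2) (b := b)
    (lam := lam) (by convert hu using 2; ring) (by convert hv using 2; ring) t1 (hlam' ▸ t2)
  -- Oddness of ϑ turns b = ea into the explicit sign in front of the second term of EQ3.
  have hodd : theta τ (2 * b) = e * theta τ (2 * a) := by
    rcases Int.units_eq_one_or ε with rfl | rfl
    · simp [hb, he]
    · simp [hb, he, theta_neg]
  rw [hb', show v + (0 - ((ε : ℤ) : ℂ) * x.2) = v - ((ε : ℤ) : ℂ) * x.2 by ring,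
    show u + (-b - ((ε : ℤ) : ℂ) * x.2) = u - b - ((ε : ℤ) : ℂ) * x.2 by ring, hlam', key, hodd]
  ring

/-! ### The exchange relation of two currents of different colours -/

theorem current_exchange (hQ : Q.StandardWeights) (ε : ℤˣ) {i j : I} (hij : i ≠ j) {l a b : ℂ}
    (ha : a = Q.cartan i j / 2 * hbar) (hb : b = ((ε : ℤ) : ℂ) * a)
    (h1 : l + b ∉ periodLattice τ) (h2 : l - b ∉ periodLattice τ) :
    diffSeries (Double Q τ hbar α) (fun w => theta τ (2 * l) * theta τ (w - b)) *
          (inU (current Q τ hbar α ε i (l + b) 0) * inV (current Q τ hbar α ε j (l - b) 0)) -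
        diffSeries (Double Q τ hbar α) (fun w => theta τ (l + b) * theta τ (w - l)) *
          (inU (current Q τ hbar α ε i (l + b) 0) * inU (current Q τ hbar α ε j (l - b) l)) -
        diffSeries (Double Q τ hbar α) (fun w => theta τ (l - b) * theta τ (w + l)) *
          (inV (current Q τ hbar α ε i (l + b) l) * inV (current Q τ hbar α ε j (l - b) 0)) =
      diffSeries (Double Q τ hbar α) (fun w => theta τ (2 * l) * theta τ (w + b)) *
          (inV (current Q τ hbar α ε j (l + b) 0) * inU (current Q τ hbar α ε i (l - b) 0)) -
        diffSeries (Double Q τ hbar α) (fun w => theta τ (l - b) * theta τ (w - l)) *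
          (inU (current Q τ hbar α ε j (l + b) l) * inU (current Q τ hbar α ε i (l - b) 0)) -
        diffSeries (Double Q τ hbar α) (fun w => theta τ (l + b) * theta τ (w + l)) *
          (inV (current Q τ hbar α ε j (l + b) 0) * inV (current Q τ hbar α ε i (l - b) l)) := by
  have t1 := theta_ne_zero h1
  have t2 := theta_ne_zero h2
  let s : Set ℂ := {0, b, -b, l, -l}
  have s0 : (0 : ℂ) ∈ s := by simp [s]
  have s0' : -(0 : ℂ) ∈ s := by simp [s]
  have s1 : b ∈ s := by simp [s]
  have s1' : -b ∈ s := by simp [s]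
  have s2 : l ∈ s := by simp [s]
  have s2' : -l ∈ s := by simp [s]
  have F1 : ∀ c d : ℂ, AnalyticAt ℂ (fun w => c * theta τ (w - d)) 0 := fun c d =>
    analyticAt_const.mul (analyticAt_theta_sub d)
  have F2 : ∀ c d : ℂ, AnalyticAt ℂ (fun w => c * theta τ (w + d)) 0 := fun c d =>
    analyticAt_const.mul (analyticAt_theta_add d)
  have U := @representsSingle_inU _ _ _ _ _ Q τ hbar 𝔥 _ _ α ε s
  have V := @representsSingle_inV _ _ _ _ _ Q τ hbar 𝔥 _ _ α ε s
  rw [← sub_eq_zero]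
  have r := (((((U t1 s0 s0' i).mul hij (V t2 s0 s0' j)).diff_mul (F1 (theta τ (2 * l)) b)).sub
      (((U t1 s0 s0' i).mul hij (U t2 s2 s2' j)).diff_mul (F1 (theta τ (l + b)) l))).sub
      (((V t1 s2 s2' i).mul hij (V t2 s0 s0' j)).diff_mul (F2 (theta τ (l - b)) l))).sub
    (((((V t1 s0 s0' j).mul hij.symm (U t2 s0 s0' i)).diff_mul (F2 (theta τ (2 * l)) b)).sub
      (((U t1 s2 s2' j).mul hij.symm (U t2 s0 s0' i)).diff_mul (F1 (theta τ (l - b)) l))).sub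
      (((V t1 s0 s0' j).mul hij.symm (V t2 s2 s2' i)).diff_mul (F2 (theta τ (l + b)) l)))
  refine r.eq_zero (countable_latticeTranslates (by simp [s])) fun X hX => ?_
  rcases ShuffleFun.pair_cases Q τ hbar hij X with ⟨z, w, rfl⟩ | h
  swap
  · simp only [(h _ _).1, (h _ _).2]
    simp
  have hz := hX.1 (i, z) (by simp)
  have hw := hX.1 (j, w) (by simp)
  have hzw := hX.2 (i, z) (j, w) le_rfl
  have nz := fun c (hc : c ∈ s) (hc' : -c ∈ s) =>
    eventually_theta_add_ne_zero (theta_sub_ne_zero hz hc hc' ε)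
  have nw := fun c (hc : c ∈ s) (hc' : -c ∈ s) =>
    eventually_theta_add_ne_zero (theta_sub_ne_zero hw hc hc' ε)
  filter_upwards [nz 0 s0 s0', nw l s2 s2'] with u hu1 hu2
  filter_upwards [nw 0 s0 s0', nz l s2 s2'] with v hv1 hv2
  simp only [ShuffleFun.pair_mul_apply hij, ShuffleFun.pair_mul_apply_swap hij]
  have hker := ShuffleFun.kernel_exchange (τ := τ) (hbar := hbar) hQ hij z w
  rw [← ha] at hker
  set e := ((ε : ℤ) : ℂ)
  -- The condition on differences in `ShuffleFun.Avoids` enters here: this factor is needed to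
  -- compare the two kernels, and it is cancelled at the end.
  have hne : theta τ (e * z - e * w + b) ≠ 0 := by
    have := theta_sub_ne_zero hzw s1' (by simpa using s1) ε
    rw [← neg_ne_zero, ← theta_neg] at this
    convert this using 2
    ring
  have hker' : kernel Q τ hbar {(i, z)} {(j, w)} * theta τ (e * z - e * w - b) =
      kernel Q τ hbar {(j, w)} {(i, z)} * theta τ (e * z - e * w + b) := by
    rw [hb]
    rcases Int.units_eq_one_or ε with rfl | rfl
    · simpa [e] using hker
    · rw [show e * z - e * w - e * a = -(z - w - a) by simp [e]; ring,
        show e * z - e * w + e * a = -(z - w + a) by simp [e]; ring, theta_neg, theta_neg]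
      linear_combination -hker
  have key := g_exchange τ (u := u) (v := v) (s := e * z) (t := e * w) (b := b) (l := l)
    (by convert hu1 using 2; ring) (by convert hv1 using 2; ring) (by convert hu2 using 2; ring)
    (by convert hv2 using 2; ring) t1 t2
  have hz0 : ∀ x, x + (0 - e * z) = x - e * z := fun x => by ring
  have hw0 : ∀ x, x + (0 - e * w) = x - e * w := fun x => by ring
  have hzl : ∀ x, x + (l - e * z) = x + l - e * z := fun x => by ring
  have hwl : ∀ x, x + (l - e * w) = x + l - e * w := fun x => by ring
  simp only [hz0, hw0, hzl, hwl]
  -- After multiplication by this factor, `key` replaces the left combination by ϑ(e(z-w)-b)·R, and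
  -- `hker'` exchanges the kernels.
  refine (mul_eq_zero.1 (?_ : theta τ (e * z - e * w + b) * _ = 0)).resolve_left hne
  set R := theta τ (2 * l) * theta τ (u - v + b) *
      (g τ (l - b) (u - e * z) * g τ (l + b) (v - e * w)) -
    theta τ (l - b) * theta τ (u - v - l) *
      (g τ (l - b) (u - e * z) * g τ (l + b) (u + l - e * w)) -
    theta τ (l + b) * theta τ (u - v + l) *
      (g τ (l - b) (v + l - e * z) * g τ (l + b) (v - e * w)) with hR
  linear_combination kernel Q τ hbar {(i, z)} {(j, w)} * key + R * hker' +
    theta τ (e * z - e * w + b) * kernel Q τ hbar {(j, w)} {(i, z)} * hR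

end Relations

/-! ### Residues of functions with a pole at zero -/

/-- By Cauchy's formula the circle integral is the same for all small radii, so the limit is that of
an eventually constant function. -/
theorem residueAtZero_eq {f h : ℂ → ℂ} {N : ℕ} (hh : AnalyticAt ℂ h 0)
    (hf : ∀ᶠ z in 𝓝[≠] 0, f z = h z / z ^ (N + 1)) : residueAtZero f = taylorCoeff h N 0 := by
  refine Filter.Tendsto.limUnder_eq (tendsto_const_nhds.congr' ?_)
  obtain ⟨δ, hδ, hδ'⟩ := Metric.eventually_nhds_iff_ball.1
    (hh.eventually_analyticAt.and (eventually_nhdsWithin_iff.1 hf))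
  filter_upwards [Ioo_mem_nhdsGT hδ] with r hr
  have h1 : ∮ z in C(0, r), f z = ∮ z in C(0, r), (1 / (z - 0) ^ (N + 1)) • h z := by
    refine circleIntegral.integral_congr hr.1.le fun z hz => ?_
    have hz' : ‖z‖ = r := by simpa using hz
    have hz0 : z ≠ 0 := norm_pos_iff.1 (hz' ▸ hr.1)
    rw [(hδ' z (by simpa [hz'] using hr.2)).2 hz0, sub_zero, smul_eq_mul]
    ring
  have h2 : DifferentiableOn ℂ h (Metric.closedBall 0 r) := fun z hz =>
    (hδ' z (Metric.closedBall_subset_ball hr.2 hz)).1.differentiableAt.differentiableWithinAt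
  rw [h1, h2.circleIntegral_one_div_sub_center_pow_smul hr.1, taylorCoeff, smul_eq_mul]
  have := Complex.two_pi_I_ne_zero
  field_simp

/-- The punctured plane is open, so an identity valid near 0 except at 0 can be differentiated at
every nearby nonzero point. -/
theorem eventually_nhdsNE_eventually_nhds {P : ℂ → Prop} (h : ∀ᶠ w in 𝓝[≠] (0 : ℂ), P w) :
    ∀ᶠ w in 𝓝[≠] (0 : ℂ), ∀ᶠ x in 𝓝 w, P x := by
  filter_upwards [eventually_eventually_nhdsWithin.2 h, self_mem_nhdsWithin] with w hw hw0
  rwa [isOpen_compl_singleton.nhdsWithin_eq hw0] at hw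

theorem eventually_nhdsNE_neg {P : ℂ → Prop} (h : ∀ᶠ w in 𝓝[≠] (0 : ℂ), P w) :
    ∀ᶠ w in 𝓝[≠] (0 : ℂ), P (-w) := by
  rw [eventually_nhdsWithin_iff] at h ⊢
  have h' : Filter.Tendsto (fun w : ℂ => -w) (𝓝 0) (𝓝 0) := by
    simpa using (continuous_neg (G := ℂ)).tendsto 0
  filter_upwards [h'.eventually h] with w hw hw0 using hw (by simpa using hw0)

theorem taylorCoeff_pow_mul {h : ℂ → ℂ} (hh : AnalyticAt ℂ h 0) (p N : ℕ) :
    taylorCoeff (fun z => z ^ p * h z) N 0 = if p ≤ N then taylorCoeff h (N - p) 0 else 0 := by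
  have h0 : ∀ j, taylorCoeff (fun z : ℂ => z ^ p) j 0 = if j = p then 1 else 0 := by
    intro j
    rw [taylorCoeff, iteratedDeriv_fun_pow_zero]
    split_ifs with hj
    · rw [hj, div_self (Nat.cast_ne_zero.2 p.factorial_ne_zero)]
    · simp
  rw [taylorCoeff_mul (by fun_prop) hh]
  simp only [h0, ite_mul, one_mul, zero_mul]
  rw [Finset.Nat.sum_antidiagonal_eq_sum_range_succ
    (fun i j => if i = p then taylorCoeff h j 0 else 0), Finset.sum_ite_eq']
  simp

theorem taylorCoeff_inv_neg {z : ℂ} (hz : z ≠ 0) (n : ℕ) :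
    taylorCoeff (fun w => w⁻¹) n (-z) = -(z ^ (n + 1))⁻¹ := by
  rw [taylorCoeff, iteratedDeriv_eq_iterate, show (fun w : ℂ => w⁻¹) = Inv.inv from rfl,
    iter_deriv_inv, show (-1 - (n : ℤ)) = -((n + 1 : ℕ) : ℤ) by push_cast; ring, zpow_neg,
    zpow_natCast, neg_pow z, mul_inv]
  have h1 : ((n.factorial : ℕ) : ℂ) ≠ 0 := Nat.cast_ne_zero.2 n.factorial_ne_zero
  have h2 : (-1 : ℂ) ^ n * (-1) ^ n = 1 := by
    rw [← mul_pow]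
    simp
  rw [pow_succ (-1 : ℂ), mul_inv, ← inv_pow, inv_neg, inv_one]
  field_simp
  linear_combination -h2

/-- The m-th Taylor coefficient of F at -z is the coefficient of u^m in F(u-z), so z plays the role
of v. -/
theorem taylorCoeff_taylorCoeff_neg {F : ℂ → ℂ} (m n : ℕ) :
    taylorCoeff (fun z => taylorCoeff F m (-z)) n 0 = diffCoeff F m n := by
  have h := taylorCoeff_comp_const_sub (taylorCoeff F m) 0 n 0
  simp only [zero_sub, neg_zero] at h
  rw [h, diffCoeff, mul_div_assoc]
  congr 1
  unfold taylorCoeff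
  simp only [div_eq_mul_inv, iteratedDeriv_mul_const_field]
  simp only [iteratedDeriv_eq_iterate, add_comm m n, Function.iterate_add_apply]
  rw [mul_inv]
  ring

theorem diffCoeff_comp_neg (F : ℂ → ℂ) (m n : ℕ) :
    diffCoeff (fun w => F (-w)) m n = diffCoeff F n m := by
  rw [diffCoeff, diffCoeff, iteratedDeriv_comp_neg, neg_zero, smul_eq_mul, pow_add, add_comm n m]
  have h2 : (-1 : ℂ) ^ n * (-1) ^ n = 1 := by
    rw [← mul_pow]
    simp
  rw [← mul_assoc, show (-1 : ℂ) ^ n * ((-1) ^ m * (-1) ^ n) = (-1) ^ m by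
    linear_combination (-1 : ℂ) ^ m * h2, mul_comm (m.factorial : ℂ)]

/-! ### Pairings of Taylor coefficients of functions with a simple pole -/

section SimplePole

variable {G₁ G₂ e₁ e₂ : ℂ → ℂ}

theorem taylorCoeff_neg_of_simple_pole {G e : ℂ → ℂ} (he : AnalyticAt ℂ e 0)
    (hG : ∀ᶠ w in 𝓝[≠] 0, G w = w⁻¹ + e w) (n : ℕ) :
    ∀ᶠ z in 𝓝[≠] 0, taylorCoeff G n (-z) =
      (-1 + z ^ (n + 1) * taylorCoeff e n (-z)) / z ^ (n + 1) := by
  have h1 := eventually_nhdsNE_neg (eventually_nhdsNE_eventually_nhds hG)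
  have h2 := eventually_nhdsNE_neg (he.eventually_analyticAt.filter_mono nhdsWithin_le_nhds)
  filter_upwards [h1, h2, self_mem_nhdsWithin] with z hz1 hz2 hz0
  have hz0' : z ≠ 0 := hz0
  rw [taylorCoeff_congr hz1, taylorCoeff_add (analyticAt_inv (neg_ne_zero.2 hz0')) hz2,
    taylorCoeff_inv_neg hz0']
  field_simp

variable (e₁ e₂) in
/-- The residue at zero of `z^k` times the product of the Taylor coefficients of order `m` and `n`
at `-z` of `w⁻¹ + e₁ w` and of `w⁻¹ + e₂ w`. -/
def poleCoeff (m n k : ℕ) : ℂ :=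
  (if k = m + n + 1 then 1 else 0) - (if k ≤ n then diffCoeff e₁ m (n - k) else 0) -
    if k ≤ m then diffCoeff (fun w => e₂ (-w)) (m - k) n else 0

variable (e₁ e₂) in
/-- The numerator of the function whose residue is `poleCoeff e₁ e₂ m n k`. -/
def poleNumerator (m n k : ℕ) (z : ℂ) : ℂ :=
  z ^ k * ((-1 + z ^ (m + 1) * taylorCoeff e₁ m (-z)) * (-1 + z ^ (n + 1) * taylorCoeff e₂ n (-z)))

theorem analyticAt_taylorCoeff_neg {e : ℂ → ℂ} (he : AnalyticAt ℂ e 0) (n : ℕ) :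
    AnalyticAt ℂ (fun z => taylorCoeff e n (-z)) 0 :=
  AnalyticAt.comp (g := fun w => taylorCoeff e n w)
    (by simpa using analyticAt_taylorCoeff he n) (by fun_prop)

theorem analyticAt_poleNumerator (h₁ : AnalyticAt ℂ e₁ 0) (h₂ : AnalyticAt ℂ e₂ 0) (m n k : ℕ) :
    AnalyticAt ℂ (poleNumerator e₁ e₂ m n k) 0 := by
  have := analyticAt_taylorCoeff_neg h₁ m
  have := analyticAt_taylorCoeff_neg h₂ n
  unfold poleNumerator
  fun_prop

theorem taylorCoeff_poleNumerator (h₁ : AnalyticAt ℂ e₁ 0) (h₂ : AnalyticAt ℂ e₂ 0) (m n k : ℕ) :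
    taylorCoeff (poleNumerator e₁ e₂ m n k) (m + n + 1) 0 = poleCoeff e₁ e₂ m n k := by
  have a₁ := analyticAt_taylorCoeff_neg h₁ m
  have a₂ := analyticAt_taylorCoeff_neg h₂ n
  -- Of the four terms of the expanded product, the last has order at least k+m+n+2 and misses the
  -- degree m+n+1. The first gives the pure pole contribution, and the other two give the expansions
  -- of e₁(u-v) and e₂(v-u).
  have h : poleNumerator e₁ e₂ m n k = fun z =>
      ((z ^ k * 1 + (-1) * (z ^ (k + m + 1) * taylorCoeff e₁ m (-z))) +
        (-1) * (z ^ (k + n + 1) * taylorCoeff e₂ n (-z))) +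
        z ^ (k + m + n + 2) * (taylorCoeff e₁ m (-z) * taylorCoeff e₂ n (-z)) := by
    funext z
    rw [poleNumerator]
    ring
  rw [h, taylorCoeff_add (by fun_prop) (by fun_prop), taylorCoeff_add (by fun_prop) (by fun_prop),
    taylorCoeff_add (by fun_prop) (by fun_prop), taylorCoeff_const_mul (by fun_prop),
    taylorCoeff_const_mul (by fun_prop), taylorCoeff_pow_mul (by fun_prop),
    taylorCoeff_pow_mul (by fun_prop), taylorCoeff_pow_mul (by fun_prop),
    taylorCoeff_pow_mul (by fun_prop), taylorCoeff_taylorCoeff_neg, taylorCoeff_taylorCoeff_neg,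
    taylorCoeff_const, poleCoeff, diffCoeff_comp_neg,
    show m + n + 1 - (k + m + 1) = n - k by omega, show m + n + 1 - (k + n + 1) = m - k by omega,
    if_neg (show ¬ k + m + n + 2 ≤ m + n + 1 by omega), add_zero]
  simp only [show k + m + 1 ≤ m + n + 1 ↔ k ≤ n by omega,
    show k + n + 1 ≤ m + n + 1 ↔ k ≤ m by omega]
  have h3 : (if k ≤ m + n + 1 then if m + n + 1 - k = 0 then (1 : ℂ) else 0 else 0) =
      if k = m + n + 1 then 1 else 0 := by
    split_ifs <;> first | rfl | omega
  rw [h3]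
  ring

theorem pairing_simple_pole (h₁ : AnalyticAt ℂ e₁ 0) (h₂ : AnalyticAt ℂ e₂ 0)
    (hG₁ : ∀ᶠ w in 𝓝[≠] 0, G₁ w = w⁻¹ + e₁ w) (hG₂ : ∀ᶠ w in 𝓝[≠] 0, G₂ w = w⁻¹ + e₂ w)
    (m n k : ℕ) : pairing (fun z => z ^ k * taylorCoeff G₁ m (-z)) (taylorCoeff G₂ n) =
      poleCoeff e₁ e₂ m n k := by
  rw [← taylorCoeff_poleNumerator h₁ h₂]
  refine residueAtZero_eq (analyticAt_poleNumerator h₁ h₂ m n k) ?_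
  filter_upwards [taylorCoeff_neg_of_simple_pole h₁ hG₁ m,
    taylorCoeff_neg_of_simple_pole h₂ hG₂ n, self_mem_nhdsWithin] with z hz1 hz2 hz0
  have hz0' : z ≠ 0 := hz0
  rw [hz1, hz2, poleNumerator]
  field_simp
  ring

/-- Substituting -z for z changes the sign of the residue, and z^k contributes (-1)^k. Together with
the signs in Φ⁻, this makes the two pairings in the cross relation reinforce each other. -/
theorem pairing_simple_pole_swap (h₁ : AnalyticAt ℂ e₁ 0) (h₂ : AnalyticAt ℂ e₂ 0)
    (hG₁ : ∀ᶠ w in 𝓝[≠] 0, G₁ w = w⁻¹ + e₁ w) (hG₂ : ∀ᶠ w in 𝓝[≠] 0, G₂ w = w⁻¹ + e₂ w)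
    (m n k : ℕ) : pairing (fun z => z ^ k * taylorCoeff G₂ n z) (fun z => taylorCoeff G₁ m (-z)) =
      -((-1) ^ k * poleCoeff e₁ e₂ m n k) := by
  have h0 := analyticAt_poleNumerator h₁ h₂ m n k
  have h0' : AnalyticAt ℂ (fun z => poleNumerator e₁ e₂ m n k (0 - z)) 0 :=
    AnalyticAt.comp (g := poleNumerator e₁ e₂ m n k) (by simpa using h0) (by fun_prop)
  have h3 : ∀ j : ℕ, (-1 : ℂ) ^ j * (-1) ^ j = 1 := fun j => by
    rw [← mul_pow]
    simp
  rw [← taylorCoeff_poleNumerator h₁ h₂]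
  have key : taylorCoeff (fun z => (-1) ^ k * (-1) ^ (m + n) * poleNumerator e₁ e₂ m n k (0 - z))
      (m + n + 1) 0 = -((-1) ^ k * taylorCoeff (poleNumerator e₁ e₂ m n k) (m + n + 1) 0) := by
    rw [taylorCoeff_const_mul h0', taylorCoeff_comp_const_sub, sub_zero, pow_succ]
    linear_combination (-(-1) ^ k * taylorCoeff (poleNumerator e₁ e₂ m n k) (m + n + 1) 0) *
      h3 (m + n)
  rw [← key]
  refine residueAtZero_eq (analyticAt_const.mul h0') ?_
  filter_upwards [eventually_nhdsNE_neg (taylorCoeff_neg_of_simple_pole h₁ hG₁ m),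
    eventually_nhdsNE_neg (taylorCoeff_neg_of_simple_pole h₂ hG₂ n), self_mem_nhdsWithin]
    with z hz1 hz2 hz0
  have hz0' : z ≠ 0 := hz0
  simp only [neg_neg] at hz1 hz2
  rw [poleNumerator, zero_sub, neg_neg, hz2, hz1]
  generalize -1 + (-z) ^ (m + 1) * taylorCoeff e₁ m z = p
  generalize -1 + (-z) ^ (n + 1) * taylorCoeff e₂ n z = q
  rw [mul_div_assoc', mul_div_assoc', div_mul_eq_mul_div, div_div, div_eq_div_iff (by simp [hz0']) (by simp [hz0']),
    neg_pow z k, neg_pow z (m + 1), neg_pow z (n + 1)]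
  have e : (-1 : ℂ) ^ k * (-1) ^ k * ((-1) ^ m * (-1) ^ m) * ((-1) ^ n * (-1) ^ n) = 1 := by
    rw [h3, h3, h3, one_mul, one_mul]
  linear_combination (-(z ^ k * q * p * z ^ (m + n + 2))) * e

end SimplePole

/-! ### Expansions of functions of `u - v` -/

section DiffSeries

variable {A : Type*} [Ring A] [Algebra ℂ A] {F K : ℂ → ℂ}

theorem coeff₂_mul_inV (s : PowerSeries A) (T : PowerSeries (PowerSeries A)) (m n : ℕ) :
    coeff₂ m n (T * inV s) = ∑ p ∈ antidiagonal n, coeff₂ m p.1 T * PowerSeries.coeff p.2 s := by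
  rw [coeff₂, inV, PowerSeries.coeff_mul_C, PowerSeries.coeff_mul]
  rfl

theorem diffSeries_congr (h : F =ᶠ[𝓝 0] K) : diffSeries A F = diffSeries A K := by
  refine ext_coeff₂ fun m n => ?_
  rw [coeff₂_diffSeries, coeff₂_diffSeries, diffCoeff, (h.iteratedDeriv _).eq_of_nhds]
  rfl

theorem diffSeries_mul (hF : AnalyticAt ℂ F 0) (hK : AnalyticAt ℂ K 0) :
    diffSeries A (fun w => F w * K w) = diffSeries A F * diffSeries A K := by
  refine ext_coeff₂ fun m n => ?_
  rw [coeff₂_mul, coeff₂_diffSeries, ← taylorCoeff₂_diff (hF.fun_mul hK),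
    taylorCoeff₂_mul (taylorExpandable_diff hF) (taylorExpandable_diff hK)]
  simp only [taylorCoeff₂_diff hF, taylorCoeff₂_diff hK, coeff₂_diffSeries, map_sum, map_mul]

theorem diffSeries_add (hF : AnalyticAt ℂ F 0) (hK : AnalyticAt ℂ K 0) :
    diffSeries A (fun w => F w + K w) = diffSeries A F + diffSeries A K := by
  refine ext_coeff₂ fun m n => ?_
  rw [coeff₂_add, coeff₂_diffSeries, ← taylorCoeff₂_diff (hF.fun_add hK),
    taylorCoeff₂_add (taylorExpandable_diff hF) (taylorExpandable_diff hK),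
    taylorCoeff₂_diff hF, taylorCoeff₂_diff hK, coeff₂_diffSeries, coeff₂_diffSeries, map_add]

variable (A) in
theorem diffSeries_id : diffSeries A (fun w => w) = inU PowerSeries.X - inV PowerSeries.X := by
  refine ext_coeff₂ fun m n => ?_
  rw [coeff₂_sub, coeff₂_inU, coeff₂_inV, coeff₂_diffSeries, diffCoeff,
    show (fun w : ℂ => w) = id from rfl, iteratedDeriv_id]
  rcases m with _ | _ | m <;> rcases n with _ | _ | n <;>
    simp [PowerSeries.coeff_X]
  rw [if_neg (by omega), zero_div, map_zero]

/-- The series `(s(u) - s(v)) / (u - v)`. -/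
def dividedDifference (s : PowerSeries A) : PowerSeries (PowerSeries A) :=
  PowerSeries.mk fun m => PowerSeries.mk fun n => PowerSeries.coeff (m + n + 1) s

theorem coeff₂_dividedDifference (s : PowerSeries A) (m n : ℕ) :
    coeff₂ m n (dividedDifference s) = PowerSeries.coeff (m + n + 1) s := by
  simp [coeff₂, dividedDifference]

theorem diffSeries_id_mul_dividedDifference (s : PowerSeries A) :
    diffSeries A (fun w => w) * dividedDifference s = inU s - inV s := by
  refine ext_coeff₂ fun m n => ?_
  rw [diffSeries_id, sub_mul, coeff₂_sub, coeff₂_sub, coeff₂_inU, coeff₂_inV,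
    show inU (PowerSeries.X : PowerSeries A) = PowerSeries.X by simp [inU]]
  have h1 : coeff₂ m n (PowerSeries.X * dividedDifference s) =
      if m = 0 then 0 else PowerSeries.coeff (m + n) s := by
    rcases m with _ | m
    · simp [coeff₂]
    · simp [coeff₂, PowerSeries.coeff_succ_X_mul, dividedDifference, add_right_comm]
  have h2 : coeff₂ m n (inV PowerSeries.X * dividedDifference s) =
      if n = 0 then 0 else PowerSeries.coeff (m + n) s := by
    rcases n with _ | n
    · simp [coeff₂, inV]
    · simp [coeff₂, inV, PowerSeries.coeff_succ_X_mul, dividedDifference, add_assoc]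
  rw [h1, h2]
  rcases m with _ | m <;> rcases n with _ | n <;> simp

end DiffSeries

/-! ### The polar part of `g` -/

section Polar

variable (τ : UpperHalfPlane)

theorem analyticAt_dslope {f : ℂ → ℂ} (hf : AnalyticAt ℂ f 0) : AnalyticAt ℂ (dslope f 0) 0 := by
  obtain ⟨s, hs, hd⟩ := (Complex.analyticAt_iff_eventually_differentiableAt.1 hf).exists_mem
  refine Complex.analyticAt_iff_eventually_differentiableAt.2 ?_
  have h := (Complex.differentiableOn_dslope hs).2 fun z hz => (hd z hz).differentiableWithinAt
  filter_upwards [eventually_mem_nhds_iff.2 hs] with z hz using h.differentiableAt hz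

theorem analyticAt_dslope_theta : AnalyticAt ℂ (dslope (theta τ) 0) 0 :=
  analyticAt_dslope (analyticAt_theta 0)

theorem mul_dslope_theta (w : ℂ) : w * dslope (theta τ) 0 w = theta τ w := by
  simpa [theta_zero] using sub_smul_dslope (theta τ) 0 w

theorem dslope_theta_zero : dslope (theta τ) 0 0 = 1 := by
  rw [dslope_same, deriv_theta_zero]

theorem dslope_theta_neg (w : ℂ) : dslope (theta τ) 0 (-w) = dslope (theta τ) 0 w := by
  rcases eq_or_ne w 0 with rfl | hw
  · rw [neg_zero]
  · have h1 := mul_dslope_theta τ w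
    have h2 := mul_dslope_theta τ (-w)
    rw [theta_neg] at h2
    exact mul_left_cancel₀ hw (by linear_combination -h1 - h2)

/-- With η(w) = ϑ(w)/w, the function w·g_λ(w) = ϑ(w+λ)/(η(w)ϑ(λ)) is analytic with value 1 at 0,
since ϑ'(0) = 1. Its difference quotient at 0 is e. -/
theorem exists_polar_part_g {lam : ℂ} (hlam : theta τ lam ≠ 0) :
    ∃ e : ℂ → ℂ, AnalyticAt ℂ e 0 ∧ (∀ᶠ w in 𝓝[≠] 0, g τ lam w = w⁻¹ + e w) ∧
      ∀ᶠ w in 𝓝 0, theta τ w * e w = theta τ (w + lam) / theta τ lam - dslope (theta τ) 0 w := by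
  have hη := analyticAt_dslope_theta τ
  have hη0 := dslope_theta_zero τ
  have hmul := mul_dslope_theta τ
  generalize dslope (theta τ) 0 = η at hη hη0 hmul ⊢
  obtain ⟨ψ, hψ'⟩ : ∃ ψ : ℂ → ℂ, ψ = fun w => theta τ (w + lam) / (η w * theta τ lam) := ⟨_, rfl⟩
  have hψ : AnalyticAt ℂ ψ 0 := by
    rw [hψ']
    exact (analyticAt_theta_add lam).div (hη.mul analyticAt_const)
      (mul_ne_zero (by simp [hη0]) hlam)
  have hψ0 : ψ 0 = 1 := by simp [hψ', hη0, hlam]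
  have key : ∀ w, w * dslope ψ 0 w = ψ w - 1 := fun w => by
    simpa [hψ0] using sub_smul_dslope ψ 0 w
  have hne : ∀ᶠ w in 𝓝 0, η w ≠ 0 := hη.continuousAt.eventually_ne (by simp [hη0])
  refine ⟨dslope ψ 0, analyticAt_dslope hψ, ?_, ?_⟩
  · filter_upwards [hne.filter_mono nhdsWithin_le_nhds, self_mem_nhdsWithin] with w hw hw0
    have hw0' : w ≠ 0 := hw0
    refine mul_left_cancel₀ hw0' ?_
    rw [mul_add, key, mul_inv_cancel₀ hw0', g, ← hmul w, hψ']
    field_simp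
    ring
  · filter_upwards [hne] with w hw
    rw [← hmul w, mul_right_comm, key, hψ']
    field_simp

end Polar

/-! ### The commutators of positive and negative currents -/

section Commutators

variable {Q : WeightedQuiver I H} {τ : UpperHalfPlane} {hbar : ℂ}
  {𝔥 : Type*} [AddCommGroup 𝔥] [Module ℂ 𝔥] {α : I → Module.Dual ℂ 𝔥}

theorem current_pos_commute_neg {i j : I} (hij : i ≠ j) (lam₁ lam₂ : ℂ) :
    inU (current Q τ hbar α 1 i lam₁ 0) * inV (current Q τ hbar α (-1) j lam₂ 0) =
      inV (current Q τ hbar α (-1) j lam₂ 0) * inU (current Q τ hbar α 1 i lam₁ 0) := by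
  refine ext_coeff₂ fun m n => ?_
  rw [coeff₂_inU_mul_inV, coeff₂_inV_mul_inU, coeff_current, coeff_current]
  have h := Double.rel (DoubleRel.cross_ne (Q := Q) (τ := τ) (hbar := hbar) (α := α) i j hij
    (currentFun τ (-1) lam₂ 0 n) (currentFun τ 1 lam₁ 0 m))
  simp only [map_mul] at h
  simpa [halfHom] using! h.symm

theorem halfHom_one (x : SHsph Q τ hbar) : halfHom Q τ hbar α 1 x = pos Q τ hbar α x := by
  simp only [halfHom, if_true]
  rfl

theorem halfHom_neg_one (x : SHsph Q τ hbar) : halfHom Q τ hbar α (-1) x = neg Q τ hbar α x := by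
  rw [halfHom, if_neg (by decide)]
  rfl

theorem map_pairingSeries {A B : Type*} [Ring A] [Algebra ℂ A] [Ring B] [Algebra ℂ B]
    (p : A →ₐ[ℂ] B) {N : ℕ} (φ : ℕ → A) {f f' : ℂ → ℂ} {r : ℕ → ℂ}
    (hr : ∀ k, pairing (fun z => z ^ k * f z) f' = r k) (hN : ∀ k, N ≤ k → r k = 0) :
    p (pairingSeries φ f f') = ∑ k ∈ Finset.range N, r k • p (φ k) := by
  have h : (Function.support fun k => r k • φ k) ⊆ Finset.range N := by
    intro k hk
    by_contra h
    exact hk (by simp [hN k (by simpa using h)])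
  simp only [pairingSeries, hr]
  rw [finsum_eq_sum_of_support_subset _ h, map_sum]
  simp only [map_smul]

theorem sub_eq_neg_two_smul {A : Type*} [Ring A] [Algebra ℂ A] {x y z : A} (h : -z + y = x + z) :
    x - y = (-2 : ℂ) • z := by
  rw [neg_smul, two_smul, eq_sub_of_add_eq h.symm]
  abel

/-- The sign (-1)^k of the coefficients of Φ⁻ cancels the one in `ha`, so the two pairing terms of
the cross relation are -S and S on opposite sides. This is the origin of the factor -2. -/
theorem pos_mul_neg_sub (i : I) {a b : Mer} {N : ℕ} {r : ℕ → ℂ}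
    (hb : ∀ k, pairing (fun z => z ^ k * b.1 z) a.1 = r k)
    (ha : ∀ k, pairing (fun z => z ^ k * a.1 z) b.1 = -((-1) ^ k * r k))
    (hN : ∀ k, N ≤ k → r k = 0) :
    pos Q τ hbar α (sphElt Q τ hbar i b) * neg Q τ hbar α (sphElt Q τ hbar i a) -
        neg Q τ hbar α (sphElt Q τ hbar i a) * pos Q τ hbar α (sphElt Q τ hbar i b) =
      (-2 : ℂ) • ∑ k ∈ Finset.range N, r k • zer Q τ hbar α (phiCoeff 𝔥 i k) := by
  have h := Double.rel (DoubleRel.cross_same (Q := Q) (τ := τ) (hbar := hbar) (α := α) i a b)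
  simp only [map_mul, map_add] at h
  rw [map_pairingSeries _ _ ha fun k hk => by rw [hN k hk, mul_zero, neg_zero],
    map_pairingSeries _ _ hb hN] at h
  have h1 : ∀ k, (-((-1 : ℂ) ^ k * r k)) • RingQuot.mkAlgHom ℂ (DoubleRel Q τ hbar α)
      ((-1 : ℂ) ^ k • fzero Q τ hbar (phiCoeff 𝔥 i k)) =
        -(r k • zer Q τ hbar α (phiCoeff 𝔥 i k)) := fun k => by
    have h2 : (-1 : ℂ) ^ k * (-1) ^ k = 1 := by
      rw [← mul_pow]
      simp
    rw [map_smul, smul_smul, show -((-1 : ℂ) ^ k * r k) * (-1) ^ k = -r k by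
      linear_combination -r k * h2, neg_smul]
    rfl
  simp only [h1, Finset.sum_neg_distrib] at h
  change _ + neg Q τ hbar α _ * pos Q τ hbar α _ = pos Q τ hbar α _ * neg Q τ hbar α _ +
    ∑ k ∈ Finset.range N, r k • zer Q τ hbar α (phiCoeff 𝔥 i k) at h
  exact sub_eq_neg_two_smul h

theorem sum_range_ite_le {M : Type*} [AddCommMonoid M] {m N : ℕ} (hm : m < N) (F : ℕ → ℕ → M) :
    ∑ k ∈ Finset.range N, (if k ≤ m then F (m - k) k else 0) =
      ∑ p ∈ antidiagonal m, F p.1 p.2 := by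
  rw [← Finset.Nat.sum_antidiagonal_swap]
  simp only [Prod.fst_swap, Prod.snd_swap]
  rw [Finset.Nat.sum_antidiagonal_eq_sum_range_succ (fun i j => F j i), ← Finset.sum_filter]
  refine Finset.sum_congr (Finset.ext fun k => ?_) fun _ _ => rfl
  simp only [Finset.mem_filter, Finset.mem_range]
  omega

theorem sum_poleCoeff_smul {A : Type*} [Ring A] [Algebra ℂ A] (e₁ e₂ : ℂ → ℂ) (m n : ℕ)
    (φ : ℕ → A) : ∑ k ∈ Finset.range (m + n + 2), poleCoeff e₁ e₂ m n k • φ k =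
      φ (m + n + 1) - ∑ p ∈ antidiagonal n, algebraMap ℂ A (diffCoeff e₁ m p.1) * φ p.2 -
        ∑ p ∈ antidiagonal m, algebraMap ℂ A (diffCoeff (fun w => e₂ (-w)) p.1 n) * φ p.2 := by
  simp only [poleCoeff, sub_smul, Finset.sum_sub_distrib, ← Algebra.smul_def, ite_smul, zero_smul,
    one_smul]
  congr 1
  · congr 1
    · simp
    · exact sum_range_ite_le (by omega) fun a b => diffCoeff e₁ m a • φ b
  · exact sum_range_ite_le (by omega) fun a b => diffCoeff (fun w => e₂ (-w)) a n • φ b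

/-- The three summands of `poleCoeff` are read as coefficients of u^m v^n: the isolated index k =
m+n+1 is the divided difference, and the two ranges k ≤ n and k ≤ m are convolutions with Φ⁺(v) and
Φ⁺(u). -/
theorem current_commutator_eq (i : I) {lam₁ lam₂ : ℂ} {e₁ e₂ : ℂ → ℂ} (h₁ : AnalyticAt ℂ e₁ 0)
    (h₂ : AnalyticAt ℂ e₂ 0) (hg₁ : ∀ᶠ w in 𝓝[≠] 0, g τ lam₁ w = w⁻¹ + e₁ w)
    (hg₂ : ∀ᶠ w in 𝓝[≠] 0, g τ lam₂ w = w⁻¹ + e₂ w) :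
    inU (current Q τ hbar α 1 i lam₁ 0) * inV (current Q τ hbar α (-1) i lam₂ 0) -
        inV (current Q τ hbar α (-1) i lam₂ 0) * inU (current Q τ hbar α 1 i lam₁ 0) =
      (-2 : ℂ) • (dividedDifference (phiPlus Q τ hbar α i) -
        diffSeries _ e₁ * inV (phiPlus Q τ hbar α i) -
        diffSeries _ (fun w => e₂ (-w)) * inU (phiPlus Q τ hbar α i)) := by
  refine ext_coeff₂ fun m n => ?_
  have hf₁ : (currentFun τ 1 lam₁ 0 m).1 = fun z => taylorCoeff (g τ lam₁) m (-z) := by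
    funext z
    rw [currentFun_apply, taylorCoeff_comp_add_const]
    simp
  have hf₂ : (currentFun τ (-1) lam₂ 0 n).1 = taylorCoeff (g τ lam₂) n := by
    funext z
    rw [currentFun_apply, taylorCoeff_comp_add_const]
    simp
  have h := pos_mul_neg_sub (Q := Q) (τ := τ) (hbar := hbar) (α := α) i
    (b := currentFun τ 1 lam₁ 0 m) (a := currentFun τ (-1) lam₂ 0 n) (N := m + n + 2)
    (r := poleCoeff e₁ e₂ m n)
    (fun k => by rw [hf₁, hf₂]; exact pairing_simple_pole h₁ h₂ hg₁ hg₂ m n k)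
    (fun k => by rw [hf₁, hf₂]; exact pairing_simple_pole_swap h₁ h₂ hg₁ hg₂ m n k)
    (fun k hk => by
      rw [poleCoeff, if_neg (by omega), if_neg (by omega), if_neg (by omega), sub_zero, sub_zero])
  rw [coeff₂_sub, coeff₂_inU_mul_inV, coeff₂_inV_mul_inU, coeff_current, coeff_current,
    coeff₂_smul, coeff₂_sub, coeff₂_sub, coeff₂_dividedDifference, coeff₂_mul_inV,
    coeff₂_mul_inU, halfHom_one, halfHom_neg_one]
  refine h.trans (congrArg _ ?_)
  simp only [coeff₂_diffSeries, phiPlus, PowerSeries.coeff_mk]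
  exact sum_poleCoeff_smul e₁ e₂ m n _

theorem current_commutator (i : I) {lam₁ lam₂ : ℂ} (h₁ : lam₁ ∉ periodLattice τ)
    (h₂ : lam₂ ∉ periodLattice τ) :
    theta τ hbar • (diffSeries (Double Q τ hbar α) (theta τ) *
        (inU (current Q τ hbar α 1 i lam₁ 0) * inV (current Q τ hbar α (-1) i lam₂ 0) -
          inV (current Q τ hbar α (-1) i lam₂ 0) * inU (current Q τ hbar α 1 i lam₁ 0))) =
      diffSeries (Double Q τ hbar α) (fun w => theta τ (w + lam₁) / theta τ lam₁) *
          inV (phi Q τ hbar α i) +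
        diffSeries (Double Q τ hbar α) (fun w => theta τ (w - lam₂) / theta τ lam₂) *
          inU (phi Q τ hbar α i) := by
  have t₁ := theta_ne_zero h₁
  have t₂ := theta_ne_zero h₂
  obtain ⟨e₁, a₁, g₁, i₁⟩ := exists_polar_part_g τ t₁
  obtain ⟨e₂, a₂, g₂, i₂⟩ := exists_polar_part_g τ t₂
  have hη := analyticAt_dslope_theta τ
  have hθ := analyticAt_theta (τ := τ) 0
  have a₂' : AnalyticAt ℂ (fun w => e₂ (-w)) 0 :=
    AnalyticAt.comp (g := e₂) (by simpa using a₂) (by fun_prop)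
  have hA₁ : AnalyticAt ℂ (fun w => theta τ (w + lam₁) / theta τ lam₁) 0 :=
    (analyticAt_theta_add lam₁).div analyticAt_const t₁
  have hA₂ : AnalyticAt ℂ (fun w => theta τ (w - lam₂) / theta τ lam₂) 0 :=
    (analyticAt_theta_sub lam₂).div analyticAt_const t₂
  set A := Double Q τ hbar α
  -- Put η(w) = ϑ(w)/w, an even function. By `d₀` the divided difference contributes η(u-v)(Φ⁺(u) -
  -- Φ⁺(v)), and the η terms in `d₁` and `d₂` cancel it exactly.
  have d₁ : diffSeries A (theta τ) * diffSeries A e₁ + diffSeries A (dslope (theta τ) 0) =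
      diffSeries A (fun w => theta τ (w + lam₁) / theta τ lam₁) := by
    rw [← diffSeries_mul hθ a₁, ← diffSeries_add (hθ.fun_mul a₁) hη]
    refine diffSeries_congr ?_
    filter_upwards [i₁] with w hw
    rw [hw, sub_add_cancel]
  have d₂ : diffSeries A (theta τ) * diffSeries A (fun w => e₂ (-w)) =
      diffSeries A (fun w => theta τ (w - lam₂) / theta τ lam₂) +
        diffSeries A (dslope (theta τ) 0) := by
    rw [← diffSeries_mul hθ a₂', ← diffSeries_add hA₂ hη]
    refine diffSeries_congr ?_
    have i₂' : ∀ᶠ w in 𝓝 (0 : ℂ), theta τ (-w) * e₂ (-w) =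
        theta τ (-w + lam₂) / theta τ lam₂ - dslope (theta τ) 0 (-w) :=
      Filter.Tendsto.eventually (by simpa using (continuous_neg (G := ℂ)).tendsto 0) i₂
    filter_upwards [i₂'] with w hw
    rw [theta_neg, dslope_theta_neg, show -w + lam₂ = -(w - lam₂) by ring, theta_neg] at hw
    linear_combination -hw
  have d₀ : diffSeries A (theta τ) =
      diffSeries A (dslope (theta τ) 0) * diffSeries A (fun w => w) := by
    rw [← diffSeries_mul hη (K := fun w => w) analyticAt_id]
    refine diffSeries_congr (.of_forall fun w => ?_)
    exact (mul_dslope_theta τ w).symm.trans (mul_comm _ _)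
  have hphi : phi Q τ hbar α i = (2 * theta τ hbar) • phiPlus Q τ hbar α i := by
    refine PowerSeries.ext fun n => ?_
    rw [coeff_phi, PowerSeries.coeff_smul, phiPlus, PowerSeries.coeff_mk]
  have hU : inU (phi Q τ hbar α i) = (2 * theta τ hbar) • inU (phiPlus Q τ hbar α i) := by
    rw [hphi]
    refine ext_coeff₂ fun m n => ?_
    simp [coeff₂_smul, coeff₂_inU]
  have hV : inV (phi Q τ hbar α i) = (2 * theta τ hbar) • inV (phiPlus Q τ hbar α i) := by
    rw [hphi]
    refine ext_coeff₂ fun m n => ?_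
    simp [coeff₂_smul, coeff₂_inV]
  rw [current_commutator_eq i a₁ a₂ g₁ g₂, hU, hV, ← d₁, mul_smul_comm, mul_sub, mul_sub,
    ← mul_assoc, ← mul_assoc, d₂]
  nth_rewrite 1 [d₀]
  rw [mul_assoc, diffSeries_id_mul_dividedDifference, mul_smul_comm, mul_smul_comm,
    ← smul_add, mul_comm 2 (theta τ hbar), mul_smul, mul_sub, add_mul, add_mul]
  refine congrArg _ ((neg_smul (2 : ℂ) _).trans ((smul_neg (2 : ℂ) _).symm.trans (congrArg _ ?_)))
  abel

end Commutators

theorem WeightedQuiver.cartan_symm {I H : Type*} [Fintype I] [DecidableEq I] [Fintype H]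
    (Q : WeightedQuiver I H) (i j : I) : Q.cartan i j = Q.cartan j i := by
  rcases eq_or_ne i j with rfl | h
  · rfl
  · rw [cartan, cartan, if_neg h, if_neg h.symm]
    ring

end EllQG

end

/-! ### The five relations, with weights λ translated into numbers (λ, α_k) -/

theorem mainTheorem1 {I H : Type*} [Fintype I] [DecidableEq I] [Fintype H]
    (Q : EllQG.WeightedQuiver I H) (hloop : ∀ h, Q.out h ≠ Q.inc h) (hQ : Q.StandardWeights)
    (τ : UpperHalfPlane) (hbar : ℂ) (hhbar : hbar ∉ EllQG.periodLattice τ)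
    {𝔥 : Type*} [AddCommGroup 𝔥] [Module ℂ 𝔥] (α : I → Module.Dual ℂ 𝔥)
    (B : LinearMap.BilinForm ℂ (Module.Dual ℂ 𝔥))
    (hB : ∀ i j, B (α i) (α j) = Q.cartan i j) :
    -- EQ1
    ((∀ i j,
        EllQG.inU (EllQG.phi Q τ hbar α i) * EllQG.inV (EllQG.phi Q τ hbar α j) =
          EllQG.inV (EllQG.phi Q τ hbar α j) * EllQG.inU (EllQG.phi Q τ hbar α i)) ∧
      ∀ (h : 𝔥) (i : I),
        EllQG.const (EllQG.zer Q τ hbar α (EllQG.cartanElt h)) * EllQG.phi Q τ hbar α i =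
          EllQG.phi Q τ hbar α i * EllQG.const (EllQG.zer Q τ hbar α (EllQG.cartanElt h))) ∧
    -- EQ2
    (∀ (ε : ℤˣ) (h : 𝔥) (i : I) (lam : Module.Dual ℂ 𝔥), B lam (α i) ∉ EllQG.periodLattice τ →
      EllQG.const (EllQG.zer Q τ hbar α (EllQG.cartanElt h)) *
            EllQG.current Q τ hbar α ε i (B lam (α i)) 0 -
          EllQG.current Q τ hbar α ε i (B lam (α i)) 0 *
            EllQG.const (EllQG.zer Q τ hbar α (EllQG.cartanElt h)) =
        (((ε : ℤ) : ℂ) * α i h) • EllQG.current Q τ hbar α ε i (B lam (α i)) 0) ∧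
    -- EQ3
    ((∀ i, IsUnit (EllQG.phi Q τ hbar α i)) ∧
      ∀ (ε : ℤˣ) (i j : I) (lam lam' : Module.Dual ℂ 𝔥) (a e : ℂ),
        a = Q.cartan i j / 2 * hbar → e = ((ε : ℤ) : ℂ) → lam' = lam + (e * hbar) • α i →
        B lam (α j) ∉ EllQG.periodLattice τ → B lam' (α j) ∉ EllQG.periodLattice τ →
        EllQG.diffSeries (EllQG.Double Q τ hbar α) (fun w => EllQG.theta τ (w - e * a)) *
            (EllQG.inU (EllQG.phi Q τ hbar α i) *
              EllQG.inV (EllQG.current Q τ hbar α ε j (B lam (α j)) 0) *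
              EllQG.inU (Ring.inverse (EllQG.phi Q τ hbar α i))) =
          EllQG.diffSeries (EllQG.Double Q τ hbar α) (fun w => EllQG.theta τ (w + e * a)) *
              EllQG.inV (EllQG.current Q τ hbar α ε j (B lam' (α j)) 0) +
            e • (EllQG.diffSeries (EllQG.Double Q τ hbar α) (fun w =>
                EllQG.theta τ (2 * a) * EllQG.theta τ (w - e * a - B lam (α j)) /
                  EllQG.theta τ (B lam (α j))) *
              EllQG.inU (EllQG.current Q τ hbar α ε j (B lam' (α j)) (-(e * a))))) ∧
    -- EQ4
    (∀ (ε : ℤˣ) (i j : I), i ≠ j →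
      ∀ (lam : Module.Dual ℂ 𝔥) (l a e li lj li' lj' : ℂ),
        B lam (α i) = l → B lam (α j) = l →
        a = Q.cartan i j / 2 * hbar → e = ((ε : ℤ) : ℂ) →
        li = B (lam + (e * (hbar / 2)) • α j) (α i) →
        lj = B (lam - (e * (hbar / 2)) • α i) (α j) →
        lj' = B (lam + (e * (hbar / 2)) • α i) (α j) →
        li' = B (lam - (e * (hbar / 2)) • α j) (α i) →
        l + a ∉ EllQG.periodLattice τ → l - a ∉ EllQG.periodLattice τ →
        EllQG.diffSeries (EllQG.Double Q τ hbar α)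
              (fun w => EllQG.theta τ (2 * l) * EllQG.theta τ (w - e * a)) *
            (EllQG.inU (EllQG.current Q τ hbar α ε i li 0) *
              EllQG.inV (EllQG.current Q τ hbar α ε j lj 0)) -
          EllQG.diffSeries (EllQG.Double Q τ hbar α)
              (fun w => EllQG.theta τ (l + e * a) * EllQG.theta τ (w - l)) *
            (EllQG.inU (EllQG.current Q τ hbar α ε i li 0) *
              EllQG.inU (EllQG.current Q τ hbar α ε j lj l)) -
          EllQG.diffSeries (EllQG.Double Q τ hbar α)
              (fun w => EllQG.theta τ (l - e * a) * EllQG.theta τ (w + l)) *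
            (EllQG.inV (EllQG.current Q τ hbar α ε i li l) *
              EllQG.inV (EllQG.current Q τ hbar α ε j lj 0)) =
        EllQG.diffSeries (EllQG.Double Q τ hbar α)
              (fun w => EllQG.theta τ (2 * l) * EllQG.theta τ (w + e * a)) *
            (EllQG.inV (EllQG.current Q τ hbar α ε j lj' 0) *
              EllQG.inU (EllQG.current Q τ hbar α ε i li' 0)) -
          EllQG.diffSeries (EllQG.Double Q τ hbar α)
              (fun w => EllQG.theta τ (l - e * a) * EllQG.theta τ (w - l)) *
            (EllQG.inU (EllQG.current Q τ hbar α ε j lj' l) *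
              EllQG.inU (EllQG.current Q τ hbar α ε i li' 0)) -
          EllQG.diffSeries (EllQG.Double Q τ hbar α)
              (fun w => EllQG.theta τ (l + e * a) * EllQG.theta τ (w + l)) *
            (EllQG.inV (EllQG.current Q τ hbar α ε j lj' 0) *
              EllQG.inV (EllQG.current Q τ hbar α ε i li' l))) ∧
    -- EQ5
    (∀ (i j : I), i ≠ j → ∀ lam₁ lam₂ : Module.Dual ℂ 𝔥,
      B lam₁ (α i) ∉ EllQG.periodLattice τ → B lam₂ (α j) ∉ EllQG.periodLattice τ →
      EllQG.inU (EllQG.current Q τ hbar α 1 i (B lam₁ (α i)) 0) *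
          EllQG.inV (EllQG.current Q τ hbar α (-1) j (B lam₂ (α j)) 0) =
        EllQG.inV (EllQG.current Q τ hbar α (-1) j (B lam₂ (α j)) 0) *
          EllQG.inU (EllQG.current Q τ hbar α 1 i (B lam₁ (α i)) 0)) ∧
    (∀ (i : I) (lam₁ lam₂ : Module.Dual ℂ 𝔥),
      B lam₁ (α i) ∉ EllQG.periodLattice τ → B lam₂ (α i) ∉ EllQG.periodLattice τ →
      EllQG.theta τ hbar •
          (EllQG.diffSeries (EllQG.Double Q τ hbar α) (EllQG.theta τ) *
            (EllQG.inU (EllQG.current Q τ hbar α 1 i (B lam₁ (α i)) 0) *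
                EllQG.inV (EllQG.current Q τ hbar α (-1) i (B lam₂ (α i)) 0) -
              EllQG.inV (EllQG.current Q τ hbar α (-1) i (B lam₂ (α i)) 0) *
                EllQG.inU (EllQG.current Q τ hbar α 1 i (B lam₁ (α i)) 0))) =
        EllQG.diffSeries (EllQG.Double Q τ hbar α)
              (fun w => EllQG.theta τ (w + B lam₁ (α i)) / EllQG.theta τ (B lam₁ (α i))) *
            EllQG.inV (EllQG.phi Q τ hbar α i) +
          EllQG.diffSeries (EllQG.Double Q τ hbar α)
              (fun w => EllQG.theta τ (w - B lam₂ (α i)) / EllQG.theta τ (B lam₂ (α i))) *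
            EllQG.inU (EllQG.phi Q τ hbar α i)) := by
  have hshift : ∀ (lam : Module.Dual ℂ 𝔥) (c : ℂ) (i j : I),
      B (lam + c • α i) (α j) = B lam (α j) + c * Q.cartan i j := fun lam c i j => by
    rw [map_add, map_smul, LinearMap.add_apply, LinearMap.smul_apply, hB, smul_eq_mul]
  have hshift' : ∀ (lam : Module.Dual ℂ 𝔥) (c : ℂ) (i j : I),
      B (lam - c • α i) (α j) = B lam (α j) - c * Q.cartan i j := fun lam c i j => by
    rw [map_sub, map_smul, LinearMap.sub_apply, LinearMap.smul_apply, hB, smul_eq_mul]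
  refine ⟨⟨EllQG.phi_commute, EllQG.cartan_commute_phi⟩,
    fun ε h i lam _ => EllQG.cartan_current ε h i _ 0,
    ⟨EllQG.isUnit_phi Q τ hbar α hhbar, ?_⟩, ?_,
    fun i j hij lam₁ lam₂ _ _ => EllQG.current_pos_commute_neg hij _ _,
    fun i lam₁ lam₂ h₁ h₂ => EllQG.current_commutator i h₁ h₂⟩
  · intro ε i j lam lam' a e ha he hlam' h1 h2
    refine EllQG.phi_current_exchange hhbar ε i j ha he ?_ h1 h2
    rw [hlam', hshift, ha]
    ring
  · intro ε i j hij lam l a e li lj li' lj' hi hj ha he hli hlj hlj' hli' h1 h2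
    have hli : li = l + e * a := by
      rw [hli, hshift, hi, Q.cartan_symm j i, ha]
      ring
    have hlj : lj = l - e * a := by
      rw [hlj, hshift', hj, ha]
      ring
    have hlj' : lj' = l + e * a := by
      rw [hlj', hshift, hj, ha]
      ring
    have hli' : li' = l - e * a := by
      rw [hli', hshift', hi, Q.cartan_symm j i, ha]
      ring
    -- For ε = -1 the two conditions on l ± a trade places.
    have hlat : l + e * a ∉ EllQG.periodLattice τ ∧ l - e * a ∉ EllQG.periodLattice τ := by
      rcases Int.units_eq_one_or ε with rfl | rfl
      · simpa [he] using And.intro h1 h2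
      · simpa [he, ← sub_eq_add_neg] using And.intro h2 h1
    rw [hli, hlj, hlj', hli']
    exact EllQG.current_exchange hQ ε hij ha (by rw [he]) hlat.1 hlat.2
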